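/- Let $T$ be the $(31,21)$-semiregular tree: the tree whose vertices are partitioned into types $0$ and $1$, neighbours having different types, such that vertices of type $0$ have degree $31$ and vertices of type $1$ have degree $21$. Equip $\mathrm{Aut}(T)$ with the permutation topology. Put $q_0=5$, $q_1=4$, and let $F_t=\mathrm{P}\Gamma\mathrm{L}_3(q_t)$ act on the $q_t^2+q_t+1$ points of the projective plane over $\mathbb{F}_{q_t}$, with point stabilizer $F_t(\omega)$. A group is \emph{prosoluble} if it is profinite and all its quotients by open normal subgroups are soluble, and \emph{locally prosoluble} if it has a prosoluble open subgroup. There is a closed subgroup $G\le\mathrm{Aut}(T)$, acting $2$-transitively on the set of ends $\partial T$, such that for $t\in\{0,1\}$ and every vertex $v$ of type $t$ the permutation group induced by the stabilizer $G(v)$ on the neighbours of $v$ (the local action) is permutationally isomorphic to $F_t$, and such that the following hold. 1. $G$ is locally prosoluble; indeed, for every path $(x,y,z)$ of length $2$, the stabilizer $G(x,y,z)$ is prosoluble. 2. The point stabilizers $F_0(\omega)$ and $F_1(\omega)$ are insoluble, and for every arc $(x,y)$ of $T$ the arc stabilizer $G(x,y)$ is not prosoluble. 3. Let $\xi$ be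 an end of $T$, let $x$ be a vertex of type $t$, and let $y$ be the neighbour of $x$ in the direction of $\xi$. Let $\Lambda_t$ be the permutation group induced by $G(x,\xi)$ on the neighbours of $x$; it is a subgroup of the stabilizer $F_t(\omega)$ of the point $\omega=y$ in the local action of $G$ at $x$. Then $\Lambda_t$ is soluble and $\Lambda_t=W_t\rtimes A_t$ for some subgroup $A_t$, where $W_t$ is the socle of $F_t(\omega)$; here $A_0$ is isomorphic to a semidirect product of the form $\mathrm{SL}_2(3)\rtimes C_4$ or $\mathrm{SL}_2(3)\rtimes C_2$, and $A_1\cong\Gamma\mathrm{L}_1(16)$. 4. Let $(x,y)$ be an arc with $y$ of type $t$, and let $\Theta_t$ be the permutation group induced on the neighbours of $y$ by the subgroup of $G$ fixing pointwise every vertex that is not closer to $y$ than to $x$ (the rigid stabilizer of the half-tree of the arc $(x,y)$). Then $\Theta_t$ equals the soluble radical $O_\infty(F_t(\omega))$ (the largest soluble normal subgroup) of the stabilizer $F_t(\omega)$ of the point $\omega=x$ in the local action of $G$ at $y$. -/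

import Mathlib

open scoped LinearAlgebra.Projectivization

namespace BoundaryTree

/-! ## Finite group theory -/

/-- A minimal normal subgroup: minimal among the nontrivial normal subgroups. -/
def IsMinimalNormal {X : Type*} [Group X] (N : Subgroup X) : Prop :=
  Minimal (fun M : Subgroup X => M.Normal ∧ M ≠ ⊥) N

/-- The socle: the subgroup generated by all minimal normal subgroups. -/
def socle (X : Type*) [Group X] : Subgroup X :=
  sSup {N : Subgroup X | IsMinimalNormal N}

/-- The soluble radical `O_∞(X)` of a finite group, i.e. its largest soluble normal subgroup,
given as the join of all soluble normal subgroups. -/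
def solubleRadical (X : Type*) [Group X] : Subgroup X :=
  sSup {N : Subgroup X | N.Normal ∧ Group.IsSolvable N}

/-- `L = W ⋊ A` as an internal semidirect product of subgroups of an ambient group. -/
structure IsInternalSemidirect {X : Type*} [Group X] (L W A : Subgroup X) : Prop where
  sup_eq : W ⊔ A = L
  inf_eq : W ⊓ A = ⊥
  normalizes : ∀ a ∈ A, ∀ w ∈ W, a * w * a⁻¹ ∈ W

/-- The group `A` is isomorphic to a semidirect product `SL₂(3) ⋊ C_n`. -/
def IsSL23ByCyclic (A : Type*) [Group A] (n : ℕ) : Prop :=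
  ∃ φ : Multiplicative (ZMod n) →* MulAut (Matrix.SpecialLinearGroup (Fin 2) (ZMod 3)),
    Nonempty (A ≃* Matrix.SpecialLinearGroup (Fin 2) (ZMod 3) ⋊[φ] Multiplicative (ZMod n))

/-! ## Permutation groups -/

/-- Permutational isomorphism of two permutation groups. -/
def PermIso {α β : Type*} (F : Subgroup (Equiv.Perm α)) (F' : Subgroup (Equiv.Perm β)) : Prop :=
  ∃ e : α ≃ β, F.map e.permCongrHom.toMonoidHom = F'

/-- The point stabilizer `F(ω)`, as a subgroup of the symmetric group. -/
def pointStab {α : Type*} (F : Subgroup (Equiv.Perm α)) (ω : α) : Subgroup (Equiv.Perm α) :=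
  F ⊓ MulAction.stabilizer (Equiv.Perm α) ω

/-- The general semilinear group `ΓL(V)`, as a group of permutations of `V`: all additive
bijections `g` with `g (a v) = σ(a) g(v)` for some field automorphism `σ`. -/
def GammaL (K V : Type*) [Field K] [AddCommGroup V] [Module K V] : Subgroup (Equiv.Perm V) where
  carrier := {g | (∀ u v, g (u + v) = g u + g v) ∧
    ∃ σ : K ≃+* K, ∀ (a : K) (v : V), g (a • v) = σ a • g v}
  one_mem' := ⟨fun _ _ => rfl, RingEquiv.refl K, fun _ _ => rfl⟩
  mul_mem' := by
    rintro g h ⟨hg, σ, hσ⟩ ⟨hh, τ, hτ⟩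
    exact ⟨fun u v => by simp [hg, hh], τ.trans σ, fun a v => by simp [hσ, hτ]⟩
  inv_mem' := by
    rintro g ⟨hg, σ, hσ⟩
    refine ⟨fun u v => ?_, σ.symm, fun a v => ?_⟩
    · rw [Equiv.Perm.inv_eq_iff_eq, hg]
      simp
    · rw [Equiv.Perm.inv_eq_iff_eq, hσ]
      simp

/-- The projective semilinear group `PΓL(V)`, as a group of permutations of the projective space
`P(V)`: all permutations of the set of lines of `V` that are induced by elements of `ΓL(V)`. -/
def PGammaL (K V : Type*) [Field K] [AddCommGroup V] [Module K V] :
    Subgroup (Equiv.Perm (ℙ K V)) where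
  carrier := {p | ∃ g ∈ GammaL K V, ∀ x : ℙ K V, ((p x).submodule : Set V) = g '' x.submodule}
  one_mem' := ⟨1, one_mem _, fun x => by simp⟩
  mul_mem' := by
    rintro p q ⟨g, hg, hp⟩ ⟨h, hh, hq⟩
    refine ⟨g * h, mul_mem hg hh, fun x => ?_⟩
    rw [Equiv.Perm.mul_apply, hp, hq, Equiv.Perm.coe_mul, Set.image_comp]
  inv_mem' := by
    rintro p ⟨g, hg, hp⟩
    refine ⟨g⁻¹, inv_mem hg, fun x => ?_⟩
    have h := hp (p⁻¹ x)
    rw [show p (p⁻¹ x) = x from p.apply_symm_apply x] at h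
    rw [h, ← Set.image_comp, ← Equiv.Perm.coe_mul, inv_mul_cancel]
    simp

/-- `PΓL₃(K)` acting on the projective plane over `K`. -/
abbrev PGammaL3 (K : Type*) [Field K] : Subgroup (Equiv.Perm (ℙ K (Fin 3 → K))) :=
  PGammaL K (Fin 3 → K)

/-- `ΓL₁(K)`, acting on the one-dimensional space `K`. -/
abbrev GammaL1 (K : Type*) [Field K] : Subgroup (Equiv.Perm K) := GammaL K K

instance factPrimeFive : Fact (Nat.Prime 5) := ⟨by norm_num⟩

/-! ## Topological groups -/

/-- A prosoluble group: a profinite group all of whose quotients by open normal subgroups (which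
are finite) are soluble; equivalently, an inverse limit of finite soluble groups. -/
structure IsProsoluble (H : Type*) [Group H] [TopologicalSpace H] [IsTopologicalGroup H] :
    Prop where
  compact : CompactSpace H
  hausdorff : T2Space H
  totallyDisconnected : TotallyDisconnectedSpace H
  soluble_quotient : ∀ (N : Subgroup H) [N.Normal], IsOpen (N : Set H) → Group.IsSolvable (H ⧸ N)

/-- A locally prosoluble group: one with a prosoluble open subgroup. -/
def IsLocallyProsoluble (H : Type*) [Group H] [TopologicalSpace H] [IsTopologicalGroup H] :
    Prop :=
  ∃ U : Subgroup H, IsOpen (U : Set H) ∧ IsProsoluble U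

/-! ## Trees and their automorphism groups -/

variable {V : Type*} {T : SimpleGraph V}

/-- `T` is the `(d₀,d₁)`-semiregular tree, with partition of the vertices into types `0` and `1`
given by `ty`: neighbours have different types, and vertices of type `t` have degree `d_t`. -/
structure IsSemiregularTree (T : SimpleGraph V) (ty : V → Fin 2) (d : Fin 2 → ℕ) : Prop where
  isTree : T.IsTree
  type_ne : ∀ v w, T.Adj v w → ty v ≠ ty w
  degree : ∀ v, (T.neighborSet v).Finite ∧ (T.neighborSet v).ncard = d (ty v)

/-- The permutation topology on `Aut(T)`: pointwise convergence on the discrete set of vertices. -/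
instance autTopology : TopologicalSpace (T ≃g T) :=
  TopologicalSpace.induced (fun g v => g v) (@Pi.topologicalSpace V (fun _ => V) (fun _ => ⊥))

theorem isOpen_aut_apply (v w : V) : IsOpen {g : T ≃g T | g v = w} := by
  let _ : TopologicalSpace V := ⊥
  have _ : DiscreteTopology V := ⟨rfl⟩
  have hc : Continuous (fun g : T ≃g T => g v) :=
    (continuous_apply v).comp (continuous_induced_dom (f := fun (g : T ≃g T) (v : V) => g v))
  exact (isOpen_discrete {w}).preimage hc

theorem continuous_to_aut {Y : Type*} [TopologicalSpace Y] (f : Y → (T ≃g T))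
    (h : ∀ v w, IsOpen {y | f y v = w}) : Continuous f := by
  let _ : TopologicalSpace V := ⊥
  have _ : DiscreteTopology V := ⟨rfl⟩
  refine continuous_induced_rng.2 (continuous_pi fun v => ?_)
  refine continuous_def.2 fun s _ => ?_
  have : (fun y => f y v) ⁻¹' s = ⋃ w ∈ s, {y | f y v = w} := by
    ext y; simp
  exact this ▸ isOpen_biUnion fun w _ => h v w

instance autTopologicalGroup : IsTopologicalGroup (T ≃g T) where
  continuous_mul := by
    refine continuous_to_aut _ fun v w => ?_
    have : {y : (T ≃g T) × (T ≃g T) | (y.1 * y.2) v = w} =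
        ⋃ u, {g : T ≃g T | g u = w} ×ˢ {h : T ≃g T | h v = u} := by
      ext y; simp
    exact this ▸ isOpen_iUnion fun u => (isOpen_aut_apply u w).prod (isOpen_aut_apply v u)
  continuous_inv := by
    refine continuous_to_aut _ fun v w => ?_
    have : {g : T ≃g T | g⁻¹ v = w} = {g : T ≃g T | g w = v} := by
      ext g
      constructor
      · rintro rfl
        exact RelIso.apply_inv_self g v
      · rintro rfl
        exact RelIso.inv_apply_self g w
    exact this ▸ isOpen_aut_apply w v

/-- A ray of `T`: a one-way infinite path of distinct vertices. -/
@[ext] structure Ray (T : SimpleGraph V) where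
  vert : ℕ → V
  injective : Function.Injective vert
  adj : ∀ i, T.Adj (vert i) (vert (i + 1))

/-- Two rays are equivalent if they agree after deleting initial segments and shifting. -/
instance rayEquiv (T : SimpleGraph V) : Setoid (Ray T) where
  r ρ ρ' := ∃ m n, ∀ i, ρ.vert (m + i) = ρ'.vert (n + i)
  iseqv := by
    refine ⟨fun ρ => ⟨0, 0, fun _ => rfl⟩, fun ⟨m, n, h⟩ => ⟨n, m, fun i => (h i).symm⟩, ?_⟩
    rintro ρ ρ' ρ'' ⟨m, n, h⟩ ⟨m', n', h'⟩
    refine ⟨m + m', n' + n, fun i => ?_⟩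
    have h1 := h (m' + i)
    have h2 := h' (n + i)
    rw [add_assoc, h1, add_assoc n', ← h2]
    congr 1
    omega

/-- The image of a ray under an automorphism. -/
instance raySMul : SMul (T ≃g T) (Ray T) where
  smul g ρ := ⟨fun i => g (ρ.vert i), g.injective.comp ρ.injective,
    fun i => g.map_adj_iff.2 (ρ.adj i)⟩

/-- The boundary `∂T`: the set of ends of `T`. -/
def Boundary (T : SimpleGraph V) : Type _ := Quotient (rayEquiv T)

/-- The end represented by a ray. -/
def Ray.toEnd (ρ : Ray T) : Boundary T := Quotient.mk (rayEquiv T) ρ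

/-- The action of `Aut(T)` on the boundary. -/
instance boundaryAction : MulAction (T ≃g T) (Boundary T) where
  smul g := Quotient.map (fun ρ => g • ρ)
    fun _ _ ⟨m, n, h⟩ => ⟨m, n, fun i => congrArg g (h i)⟩
  one_smul ξ := Quotient.inductionOn ξ fun _ => rfl
  mul_smul _ _ ξ := Quotient.inductionOn ξ fun _ => rfl

/-- `G` acts `2`-transitively on the boundary. -/
def IsBoundary2Transitive (G : Subgroup (T ≃g T)) : Prop :=
  ∀ ξ₁ ξ₂ η₁ η₂ : Boundary T, ξ₁ ≠ ξ₂ → η₁ ≠ η₂ → ∃ g ∈ G, g • ξ₁ = η₁ ∧ g • ξ₂ = η₂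

/-- The pointwise stabilizer in `G` of a set of vertices. -/
def fixer (G : Subgroup (T ≃g T)) (S : Set V) : Subgroup (T ≃g T) :=
  G ⊓ fixingSubgroup (T ≃g T) S

/-- The stabilizer `G(ξ)` of an end. -/
def endStab (G : Subgroup (T ≃g T)) (ξ : Boundary T) : Subgroup (T ≃g T) :=
  G ⊓ MulAction.stabilizer (T ≃g T) ξ

/-- The half-tree `T_a` of the arc `a = (x, y)`: the vertices closer to the terminus `y` than to
the origin `x`. The terminus `y` is its root. -/
def halfTree (T : SimpleGraph V) (x y : V) : Set V := {v | T.dist v y < T.dist v x}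

/-- The rigid stabilizer in `G` of the half-tree of the arc `(x, y)`: the pointwise stabilizer of
its complement. -/
def rist (G : Subgroup (T ≃g T)) (x y : V) : Subgroup (T ≃g T) := fixer G (halfTree T x y)ᶜ

/-- The local action of `H` at the vertex `v`: the permutation group induced on the set of
neighbours of `v` by the stabilizer of `v` in `H`. -/
def localAction (H : Subgroup (T ≃g T)) (v : V) : Subgroup (Equiv.Perm (T.neighborSet v)) where
  carrier := {p | ∃ g ∈ H, g v = v ∧ ∀ w : T.neighborSet v, g (w : V) = (p w : V)}
  one_mem' := ⟨1, one_mem _, rfl, fun _ => rfl⟩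
  mul_mem' := by
    rintro p q ⟨g, hg, hgv, hp⟩ ⟨h, hh, hhv, hq⟩
    refine ⟨g * h, mul_mem hg hh, ?_, fun w => ?_⟩
    · rw [RelIso.mul_apply, hhv, hgv]
    · rw [RelIso.mul_apply, hq, hp, Equiv.Perm.mul_apply]
  inv_mem' := by
    rintro p ⟨g, hg, hgv, hp⟩
    refine ⟨g⁻¹, inv_mem hg, ?_, fun w => ?_⟩
    · conv_lhs => rw [← hgv]
      exact RelIso.inv_apply_self g v
    · have h := hp (p⁻¹ w)
      rw [show p (p⁻¹ w) = w from p.apply_symm_apply w] at h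
      rw [← h]
      exact RelIso.inv_apply_self g _

/-- `G` belongs to the class `𝓗_{F₀,F₁}`: it is a closed boundary-`2`-transitive subgroup of
`Aut(T)`, with local action `F_t` at each vertex of type `t`. -/
structure IsInClassH (ty : V → Fin 2) (G : Subgroup (T ≃g T)) {Ω₀ Ω₁ : Type*}
    (F₀ : Subgroup (Equiv.Perm Ω₀)) (F₁ : Subgroup (Equiv.Perm Ω₁)) : Prop where
  isClosed : IsClosed (G : Set (T ≃g T))
  boundary2Transitive : IsBoundary2Transitive G
  local_zero : ∀ v, ty v = 0 → PermIso (localAction G v) F₀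
  local_one : ∀ v, ty v = 1 → PermIso (localAction G v) F₁

/-- The group `Λ`: the local action of the end stabilizer `G(ξ)` at the vertex `x`, where the ray
`ρ` starts at `x` and represents `ξ`. -/
def Lambda (G : Subgroup (T ≃g T)) (ρ : Ray T) :
    Subgroup (Equiv.Perm (T.neighborSet (ρ.vert 0))) :=
  localAction (endStab G ρ.toEnd) (ρ.vert 0)

/-- The group `Θ`: the local action of the rigid stabilizer of the half-tree of the arc `(x, y)` at
its root `y`. -/
def Theta (G : Subgroup (T ≃g T)) (x y : V) : Subgroup (Equiv.Perm (T.neighborSet y)) :=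
  localAction (rist G x y) y

/-- The point stabilizer `F_t(ω)` of the local action of `G` at `y`, where `ω` is the neighbour
`x` of `y`. -/
def localPointStab (G : Subgroup (T ≃g T)) {x y : V} (h : T.Adj y x) :
    Subgroup (Equiv.Perm (T.neighborSet y)) :=
  pointStab (localAction G y) ⟨x, h⟩

end BoundaryTree

open BoundaryTree

namespace BoundaryTree

open SimpleGraph

variable {V : Type*} {T : SimpleGraph V}

/-! ## Distances in trees -/

/-! The construction rests on one coincidence: both `PGL₂(5)` and `PΓL₂(4)` are isomorphic to `S =
Sym(5)`. The stabilizer of a point in `PΓL₃(q)` is an elementary abelian group `W` extended by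
`ΓL₂(q)`, and `ΓL₂(q)` acts on the lines through that point modulo scalars. For `q = 5` and for `q =
4` every point stabilizer therefore maps onto the same group `S` with soluble kernel. After choosing
a collineation from a base point to every other point, this becomes an `S`-valued cocycle `θ` on
collineations and points.

Identify the neighbours of each vertex with the points of the plane of its type. The group `G`
consists of all tree automorphisms that act by collineations around every vertex and for which the
cocycles read off at the two ends of every edge agree (`LocalSystem.univGroup`). Since `θ` takes all
values, a local choice at a vertex extends across each edge, and so over the whole tree
(`LocalSystem.exists_aut_extending`). Hence the local actions are all of `PΓL₃(q)`, while an arc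
stabilizer still sees the insoluble group `S`.

The rest depends on two-point stabilizers. A collineation fixing two points fixes their joining
line, so its cocycle at each of them lies in a conjugate of a Borel image in `S`. The semilinear
Borel gives `AGL₁(5)` for `q = 5` and a point stabilizer `Sym(4)` for `q = 4`; both are soluble.
Pairs of elements of the linear Borels, whose images are `AGL₁(5)` and a group containing `Alt(4)`,
can be prescribed independently at the two points (`exists_vecStab_two_point`). As `S = AGL₁(5) · x
· Alt(4)` for every `x` (`exists_mul_mul_eq`), cocycle mismatches along a line can be removed edge
by edge, which gives boundary-2-transitivity (`Factorizes.isBoundary2Transitive`).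

The local invariants follow. `Λ` at a vertex is the preimage in the point stabilizer of a conjugate
of the Borel image of the other type (`Gluing.lambda_eq`). It contains `W`, and its complement is
the preimage of `Sym(4)` in `GL₂(5)`, namely `SL₂(3) ⋊ C₄`, or the preimage of `AGL₁(5)` in
`ΓL₂(4)`, namely `ΓL₁(16)`. `Θ` is the kernel of the map onto `S`, hence the soluble radical,
because `S` has no nontrivial soluble normal subgroup. Fixing a path of length 2 forces a Borel at
the middle vertex and only `Θ` further out, so every layer is soluble (`isProsoluble_of_local`). -/

theorem exists_adj_dist_succ (hT : T.IsTree) {u v : V} (h : v ≠ u) :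
    ∃ w, T.Adj v w ∧ T.dist u v = T.dist u w + 1 := by
  obtain ⟨p, hp⟩ := hT.connected.exists_walk_length_eq_dist v u
  cases p with
  | nil => exact absurd rfl h
  | @cons _ w _ hvw q =>
    refine ⟨w, hvw, ?_⟩
    have h1 : T.dist w u ≤ q.length := dist_le q
    rw [Walk.length_cons] at hp
    rw [dist_comm] at h1 hp
    rcases hT.dist_eq_dist_add_one_of_adj u hvw with h2 | h2 <;> omega

theorem eq_of_adj_of_dist_succ (hT : T.IsTree) {u v w w' : V} (h : T.Adj v w) (h' : T.Adj v w')
    (hd : T.dist u v = T.dist u w + 1) (hd' : T.dist u v = T.dist u w' + 1) : w = w' := by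
  obtain ⟨p, hp⟩ := hT.connected.exists_walk_length_eq_dist u w
  obtain ⟨p', hp'⟩ := hT.connected.exists_walk_length_eq_dist u w'
  have h1 : (p.concat h.symm).IsPath :=
    Walk.isPath_of_length_eq_dist _ (by rw [Walk.length_concat]; omega)
  have h2 : (p'.concat h'.symm).IsPath :=
    Walk.isPath_of_length_eq_dist _ (by rw [Walk.length_concat]; omega)
  have h3 := (hT.isAcyclic.subsingleton_path u v).elim ⟨_, h1⟩ ⟨_, h2⟩
  have h4 := congrArg (fun q : T.Path u v => q.1.penultimate) h3
  simpa using h4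

/-- The neighbour of `v` on the path from `v` to the root `u`. -/
noncomputable def parent (hT : T.IsTree) (u v : V) : V := by
  classical
  exact if h : v ≠ u then (exists_adj_dist_succ hT h).choose else u

theorem adj_parent (hT : T.IsTree) {u v : V} (h : v ≠ u) : T.Adj v (parent hT u v) := by
  rw [parent, dif_pos h]
  exact (exists_adj_dist_succ hT h).choose_spec.1

theorem dist_parent (hT : T.IsTree) {u v : V} (h : v ≠ u) :
    T.dist u v = T.dist u (parent hT u v) + 1 := by
  rw [parent, dif_pos h]
  exact (exists_adj_dist_succ hT h).choose_spec.2

theorem eq_parent (hT : T.IsTree) {u v w : V} (h : T.Adj v w)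
    (hd : T.dist u v = T.dist u w + 1) : w = parent hT u v := by
  have hne : v ≠ u := by
    rintro rfl
    simp at hd
  exact eq_of_adj_of_dist_succ hT h (adj_parent hT hne) hd (dist_parent hT hne)

theorem parent_cases (hT : T.IsTree) (u : V) {v w : V} (h : T.Adj v w) :
    (w ≠ u ∧ v = parent hT u w) ∨ (v ≠ u ∧ w = parent hT u v) := by
  rcases hT.dist_eq_dist_add_one_of_adj u h with h1 | h1
  · refine Or.inr ⟨?_, eq_parent hT h h1⟩
    rintro rfl
    simp at h1
  · refine Or.inl ⟨?_, eq_parent hT h.symm h1⟩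
    rintro rfl
    simp at h1

/-- A step that came closer to `f 0` would lead to the unique neighbour nearer to `f 0`, which is
the vertex just left. -/
theorem dist_of_nonbacktracking (hT : T.IsTree) (f : ℕ → V) (hadj : ∀ i, T.Adj (f i) (f (i + 1)))
    (hnb : ∀ i, f i ≠ f (i + 2)) (n : ℕ) : T.dist (f 0) (f n) = n := by
  suffices h : T.dist (f 0) (f n) = n ∧ T.dist (f 0) (f (n + 1)) = n + 1 from h.1
  induction n with
  | zero => exact ⟨by simp, by simpa using dist_eq_one_iff_adj.2 (hadj 0)⟩
  | succ n ih =>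
    refine ⟨ih.2, ?_⟩
    rcases hT.dist_eq_dist_add_one_of_adj (f 0) (hadj (n + 1)) with h1 | h1
    · exact absurd (eq_of_adj_of_dist_succ hT (hadj n).symm (hadj (n + 1))
        (by omega) h1) (hnb n)
    · omega

theorem injective_of_nonbacktracking (hT : T.IsTree) (f : ℕ → V)
    (hadj : ∀ i, T.Adj (f i) (f (i + 1))) (hnb : ∀ i, f i ≠ f (i + 2)) :
    Function.Injective f := by
  have key : ∀ m k, f m = f (m + k) → k = 0 := by
    intro m k h
    have := dist_of_nonbacktracking hT (fun i => f (m + i)) (fun i => hadj (m + i))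
      (fun i => hnb (m + i)) k
    simp only [add_zero] at this
    rw [← this, h, dist_self]
  intro m n h
  rcases le_total m n with hmn | hmn
  · obtain ⟨k, rfl⟩ := Nat.exists_eq_add_of_le hmn
    rw [key m k h, add_zero]
  · obtain ⟨k, rfl⟩ := Nat.exists_eq_add_of_le hmn
    rw [key n k h.symm, add_zero]

/-! ## Rays and lines -/

theorem Ray.ne_add_two (ρ : Ray T) (i : ℕ) : ρ.vert i ≠ ρ.vert (i + 2) := fun h => by
  have := ρ.injective h
  omega

theorem Ray.dist_vert (hT : T.IsTree) (ρ : Ray T) (n : ℕ) :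
    T.dist (ρ.vert 0) (ρ.vert n) = n :=
  dist_of_nonbacktracking hT ρ.vert ρ.adj ρ.ne_add_two n

/-- The ray given by a non-backtracking sequence in a tree. -/
def Ray.ofSeq (hT : T.IsTree) (f : ℕ → V) (hadj : ∀ i, T.Adj (f i) (f (i + 1)))
    (hnb : ∀ i, f i ≠ f (i + 2)) : Ray T :=
  ⟨f, injective_of_nonbacktracking hT f hadj hnb, hadj⟩

theorem Ray.toEnd_eq_iff {ρ ρ' : Ray T} :
    ρ.toEnd = ρ'.toEnd ↔ ∃ m n, ∀ i, ρ.vert (m + i) = ρ'.vert (n + i) :=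
  Quotient.eq (r := rayEquiv T)

theorem smul_toEnd (g : T ≃g T) (ρ : Ray T) : g • ρ.toEnd = (g • ρ).toEnd := rfl

/-- Indices along a ray are distances from its origin, so a common origin forces the two shifts to
be equal. Below the shift the rays agree by uniqueness of the neighbour nearer to the origin. -/
theorem Ray.eq_of_toEnd_eq (hT : T.IsTree) {ρ ρ' : Ray T} (h0 : ρ.vert 0 = ρ'.vert 0)
    (h : ρ.toEnd = ρ'.toEnd) (i : ℕ) : ρ.vert i = ρ'.vert i := by
  obtain ⟨m, n, hmn⟩ := Ray.toEnd_eq_iff.1 h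
  have hmn' : m = n := by
    have h1 := ρ.dist_vert hT m
    have h2 := ρ'.dist_vert hT n
    have h3 := hmn 0
    simp only [add_zero] at h3
    rw [h3, h0, h2] at h1
    exact h1.symm
  subst hmn'
  have hdown : ∀ j, ρ.vert (j + 1) = ρ'.vert (j + 1) → ρ.vert j = ρ'.vert j := by
    intro j hj
    refine eq_of_adj_of_dist_succ hT (u := ρ.vert 0) (ρ.adj j).symm (hj ▸ (ρ'.adj j).symm) ?_ ?_
    · rw [ρ.dist_vert hT, ρ.dist_vert hT]
    · rw [ρ.dist_vert hT, h0, ρ'.dist_vert hT]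
  rcases le_total m i with hi | hi
  · obtain ⟨k, rfl⟩ := Nat.exists_eq_add_of_le hi
    exact hmn k
  · obtain ⟨k, hk⟩ := Nat.exists_eq_add_of_le hi
    have hm : ρ.vert (i + k) = ρ'.vert (i + k) := hk ▸ hmn 0
    clear hk
    induction k with
    | zero => exact hm
    | succ k ih => exact ih (hdown _ hm)

/-- The origin is moved along a walk. At each step the new vertex is either already the second
vertex of the ray, whose first vertex is then dropped, or it can be put in front without
backtracking. -/
theorem exists_ray_from (hT : T.IsTree) (v : V) (ξ : Boundary T) :
    ∃ ρ : Ray T, ρ.vert 0 = v ∧ ρ.toEnd = ξ := by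
  obtain ⟨ρ₀, rfl⟩ := Quotient.exists_rep ξ
  obtain ⟨p⟩ := hT.connected v (ρ₀.vert 0)
  have key : ∀ (u w : V) (p : T.Walk u w) (ρ : Ray T), ρ.vert 0 = w →
      ∃ ρ' : Ray T, ρ'.vert 0 = u ∧ ρ'.toEnd = ρ.toEnd := by
    intro u w p
    induction p with
    | nil => exact fun ρ h => ⟨ρ, h, rfl⟩
    | @cons a b c hab q ih =>
      intro ρ hρ
      obtain ⟨σ, hσ, hσ'⟩ := ih ρ hρ
      by_cases h1 : σ.vert 1 = a
      · refine ⟨⟨fun i => σ.vert (1 + i), fun i j hij => ?_, fun i => σ.adj (1 + i)⟩, h1, ?_⟩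
        · have := σ.injective hij
          omega
        · rw [← hσ']
          exact Ray.toEnd_eq_iff.2 ⟨0, 1, fun i => by simp⟩
      · refine ⟨Ray.ofSeq hT (fun i => Nat.casesOn i a σ.vert) ?_ ?_, rfl, ?_⟩
        · rintro (_ | i)
          · simpa [hσ] using hab
          · exact σ.adj i
        · rintro (_ | i)
          · exact Ne.symm h1
          · exact σ.ne_add_two i
        · rw [← hσ']
          exact Ray.toEnd_eq_iff.2 ⟨1, 0, fun i => by simp [Ray.ofSeq, add_comm 1 i]⟩
  exact key _ _ p ρ₀ rfl

/-- A two-way infinite geodesic. -/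
structure IsLine (T : SimpleGraph V) (f : ℤ → V) : Prop where
  adj : ∀ i, T.Adj (f i) (f (i + 1))
  ne_add_two : ∀ i, f i ≠ f (i + 2)

theorem IsLine.shift {f : ℤ → V} (h : IsLine T f) (k : ℤ) : IsLine T (fun i => f (i + k)) where
  adj i := by simpa [add_right_comm] using h.adj (i + k)
  ne_add_two i := by simpa [add_right_comm] using h.ne_add_two (i + k)

theorem IsLine.neg {f : ℤ → V} (h : IsLine T f) : IsLine T (fun i => f (-i)) where
  adj i := by
    have := (h.adj (-i - 1)).symm
    rwa [sub_add_cancel, show -i - 1 = -(i + 1) by ring] at this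
  ne_add_two i := by
    have := (h.ne_add_two (-i - 2)).symm
    rwa [sub_add_cancel, show -i - 2 = -(i + 2) by ring] at this

/-- The positive half of a line. -/
def IsLine.ray (hT : T.IsTree) {f : ℤ → V} (h : IsLine T f) : Ray T :=
  Ray.ofSeq hT (fun i => f i) (fun i => by simpa using h.adj i)
    (fun i => by simpa using h.ne_add_two i)

theorem IsLine.ray_shift (hT : T.IsTree) {f : ℤ → V} (h : IsLine T f) :
    ((h.shift 1).ray hT).toEnd = (h.ray hT).toEnd :=
  Ray.toEnd_eq_iff.2 ⟨0, 1, fun i => by simp [IsLine.ray, Ray.ofSeq, add_comm]⟩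

theorem IsLine.ray_shift_neg (hT : T.IsTree) {f : ℤ → V} (h : IsLine T f) :
    ((h.shift 1).neg.ray hT).toEnd = (h.neg.ray hT).toEnd :=
  Ray.toEnd_eq_iff.2 ⟨1, 0, fun i => by simp [IsLine.ray, Ray.ofSeq]⟩

theorem IsLine.injective (hT : T.IsTree) {f : ℤ → V} (h : IsLine T f) : Function.Injective f := by
  have key : ∀ (a : ℤ) (k : ℕ), f a = f (a + k) → k = 0 := by
    intro a k hk
    have := ((h.shift a).ray hT).injective (a₁ := 0) (a₂ := k)
    simp only [IsLine.ray, Ray.ofSeq] at this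
    refine (this ?_).symm
    simpa [add_comm] using hk
  intro a b hab
  rcases le_total a b with hle | hle
  · obtain ⟨k, rfl⟩ := Int.le.dest hle
    simp [key a k hab]
  · obtain ⟨k, rfl⟩ := Int.le.dest hle
    simp [key b k hab.symm]

/-- Two rays from a common vertex are followed to their last common vertex before they first differ;
reversing one of the remaining halves yields the line. -/
theorem exists_line (hT : T.IsTree) {ξ η : Boundary T} (hne : ξ ≠ η) :
    ∃ (f : ℤ → V) (h : IsLine T f), (h.ray hT).toEnd = ξ ∧ (h.neg.ray hT).toEnd = η := by
  classical
  obtain ⟨v⟩ := hT.connected.nonempty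
  obtain ⟨ρ, hρ, rfl⟩ := exists_ray_from hT v ξ
  obtain ⟨σ, hσ, rfl⟩ := exists_ray_from hT v η
  have hex : ∃ n, ρ.vert n ≠ σ.vert n := by
    by_contra hcon
    push Not at hcon
    exact hne (Ray.toEnd_eq_iff.2 ⟨0, 0, fun i => by simpa using hcon i⟩)
  obtain ⟨n, hn, hn'⟩ : ∃ n, ρ.vert n = σ.vert n ∧ ρ.vert (n + 1) ≠ σ.vert (n + 1) := by
    have h1 := Nat.find_spec hex
    have h0 : Nat.find hex ≠ 0 := fun h => by
      rw [h] at h1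
      exact h1 (hρ.trans hσ.symm)
    obtain ⟨n, hn⟩ := Nat.exists_eq_succ_of_ne_zero h0
    refine ⟨n, ?_, by rwa [hn] at h1⟩
    have := Nat.find_min hex (m := n) (by omega)
    simpa using this
  set f : ℤ → V := fun k => if 0 ≤ k then ρ.vert (n + k.toNat) else σ.vert (n + (-k).toNat)
    with hf
  have fpos : ∀ k : ℕ, f k = ρ.vert (n + k) := fun k => by simp [hf]
  have fneg : ∀ k : ℕ, f (-k) = σ.vert (n + k) := fun k => by
    rcases Nat.eq_zero_or_pos k with rfl | hk
    · simp [hf, hn]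
    · simp [hf, hk.ne']
  have hline : IsLine T f := by
    constructor
    · intro i
      obtain ⟨k, rfl | rfl⟩ := i.eq_nat_or_neg
      · rw [show (k : ℤ) + 1 = ((k + 1 : ℕ) : ℤ) by simp, fpos, fpos]
        exact ρ.adj _
      · rcases k with _ | k
        · have := fpos 1
          have h0 := fpos 0
          simp only [Nat.cast_one, Nat.cast_zero, add_zero] at this h0
          simpa [this, h0] using ρ.adj n
        · rw [show -((k + 1 : ℕ) : ℤ) + 1 = -(k : ℤ) by push_cast; ring, fneg, fneg]
          exact (σ.adj _).symm
    · intro i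
      obtain ⟨k, rfl | rfl⟩ := i.eq_nat_or_neg
      · rw [show (k : ℤ) + 2 = ((k + 2 : ℕ) : ℤ) by simp, fpos, fpos]
        exact ρ.ne_add_two _
      · rcases k with _ | _ | k
        · have := fpos 2
          have h0 := fpos 0
          simp only [Nat.cast_ofNat, Nat.cast_zero, add_zero] at this h0
          simpa [this, h0] using ρ.ne_add_two n
        · have := fpos 1
          simp only [Nat.cast_one] at this
          rw [fneg, show -((0 + 1 : ℕ) : ℤ) + 2 = 1 by norm_num, this]
          -- The only turn occurs at `0`; it is not a backtrack because the two rays separate there.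
          exact hn'.symm
        · rw [show -((k + 1 + 1 : ℕ) : ℤ) + 2 = -(k : ℤ) by push_cast; ring, fneg, fneg]
          exact (σ.ne_add_two _).symm
  refine ⟨f, hline, ?_, ?_⟩
  · exact Ray.toEnd_eq_iff.2 ⟨0, n, fun i => by simp [IsLine.ray, Ray.ofSeq, fpos]⟩
  · exact Ray.toEnd_eq_iff.2 ⟨0, n, fun i => by simp [IsLine.ray, Ray.ofSeq, fneg]⟩

/-! ## Existence of semiregular trees -/

/-- A graph with a depth function such that every vertex of positive depth has exactly one
neighbour of no larger depth, and only one vertex of depth zero, is a tree. -/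
theorem isTree_of_depth (depth : V → ℕ) (r : V) (hr : ∀ v, depth v = 0 → v = r)
    (hex : ∀ v, depth v ≠ 0 → ∃ w, T.Adj v w ∧ depth w < depth v)
    (huniq : ∀ v w w', T.Adj v w → T.Adj v w' → depth w ≤ depth v → depth w' ≤ depth v → w = w') :
    T.IsTree := by
  have : Nonempty V := ⟨r⟩
  have hreach : ∀ n v, depth v = n → T.Reachable v r := by
    intro n
    induction n using Nat.strong_induction_on with
    | _ n ih =>
      intro v hv
      by_cases h0 : depth v = 0
      · rw [hr v h0]
      · obtain ⟨w, hw, hlt⟩ := hex v h0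
        exact hw.reachable.trans (ih _ (hv ▸ hlt) w rfl)
  refine ⟨⟨fun u v => (hreach _ u rfl).trans (hreach _ v rfl).symm⟩, fun v c hc => ?_⟩
  classical
  -- At a vertex of maximal depth on a cycle both cycle neighbours are no deeper, so uniqueness
  -- identifies them, which is impossible in a cycle.
  obtain ⟨u, hu, hmax⟩ := c.support.toFinset.exists_max_image depth ⟨v, by simp⟩
  simp only [List.mem_toFinset] at hu hmax
  have hc' := hc.rotate hu
  refine hc'.snd_ne_penultimate (huniq u _ _ (Walk.adj_snd hc'.not_nil)
    (Walk.adj_penultimate hc'.not_nil).symm ?_ ?_)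
  · refine hmax _ ?_
    rw [← c.mem_support_rotate_iff u hu]
    exact Walk.getVert_mem_support _ _
  · refine hmax _ ?_
    rw [← c.mem_support_rotate_iff u hu]
    exact Walk.getVert_mem_support _ _

/-- The number of children of a vertex of the tree of lists. -/
def numChildren (d : Fin 2 → ℕ) (l : List ℕ) : ℕ :=
  if l = [] then d 0 else d (Fin.ofNat 2 l.length) - 1

/-- The lists which are the vertices of the semiregular tree. -/
def IsAddress (d : Fin 2 → ℕ) : List ℕ → Prop
  | [] => True
  | a :: l => IsAddress d l ∧ a < numChildren d l

/-- The tree of lists. -/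
def addressTree (d : Fin 2 → ℕ) : SimpleGraph {l : List ℕ // IsAddress d l} where
  Adj l l' := (∃ a, l.1 = a :: l'.1) ∨ ∃ a, l'.1 = a :: l.1
  symm := ⟨fun _ _ h => h.symm⟩
  loopless := ⟨fun l h => by
    rcases h with ⟨a, h⟩ | ⟨a, h⟩ <;> simpa using congrArg List.length h⟩

theorem isSemiregularTree_addressTree (d : Fin 2 → ℕ) (hd : ∀ t, 0 < d t) :
    IsSemiregularTree (addressTree d) (fun l => Fin.ofNat 2 l.1.length) d where
  isTree := by
    refine isTree_of_depth (fun l => l.1.length) ⟨[], trivial⟩ ?_ ?_ ?_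
    · rintro ⟨l, hl⟩ h
      exact Subtype.ext (by simpa using h)
    · rintro ⟨_ | ⟨a, l⟩, hl⟩ h
      · simp at h
      · exact ⟨⟨l, hl.1⟩, Or.inl ⟨a, rfl⟩, by simp⟩
    · rintro ⟨l, hl⟩ ⟨l₁, h₁⟩ ⟨l₂, h₂⟩ (⟨a, h⟩ | ⟨a, h⟩) (⟨b, h'⟩ | ⟨b, h'⟩) k k'
      · simp only at h h' k k'
        rw [h] at h'
        simpa using (List.cons.inj h').2
      all_goals
        simp only at h h' k k'
        simp [h, h'] at k k'
  type_ne := by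
    have key : ∀ n : ℕ, Fin.ofNat 2 (n + 1) ≠ Fin.ofNat 2 n := by
      intro n h
      have := congrArg Fin.val h
      simp only [Fin.ofNat] at this
      omega
    rintro ⟨l, hl⟩ ⟨l', hl'⟩ (⟨a, h⟩ | ⟨a, h⟩)
    · simp only at h
      subst h
      exact key _
    · simp only at h
      subst h
      exact (key _).symm
  degree := by
    rintro ⟨l, hl⟩
    set child : Fin (numChildren d l) → {l : List ℕ // IsAddress d l} :=
      fun a => ⟨a.1 :: l, hl, a.2⟩ with hchild
    have hinj : Function.Injective child := fun a b h => by
      simpa [hchild, Fin.ext_iff] using congrArg Subtype.val h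
    have hcard : (Set.range child).ncard = numChildren d l := by
      rw [← Set.image_univ, Set.ncard_image_of_injective _ hinj, Set.ncard_univ, Nat.card_fin]
    rcases l with _ | ⟨a, l⟩
    · have : (addressTree d).neighborSet ⟨[], hl⟩ = Set.range child := by
        ext ⟨l', hl'⟩
        constructor
        · rintro (⟨b, h⟩ | ⟨b, h⟩)
          · simp at h
          · simp only at h
            subst h
            exact ⟨⟨b, hl'.2⟩, rfl⟩
        · rintro ⟨b, h⟩
          exact Or.inr ⟨b.1, (congrArg Subtype.val h).symm⟩
      rw [this]
      exact ⟨Set.finite_range _, by rw [hcard]; simp [numChildren]⟩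
    · have : (addressTree d).neighborSet ⟨a :: l, hl⟩ = insert ⟨l, hl.1⟩ (Set.range child) := by
        ext ⟨l', hl'⟩
        constructor
        · rintro (⟨b, h⟩ | ⟨b, h⟩)
          · left
            simp only [List.cons.injEq] at h
            exact Subtype.ext h.2.symm
          · simp only at h
            subst h
            exact Or.inr ⟨⟨b, hl'.2⟩, rfl⟩
        · rintro (h | ⟨b, h⟩)
          · left
            exact ⟨a, by rw [Subtype.ext_iff.1 h]⟩
          · exact Or.inr ⟨b.1, (congrArg Subtype.val h).symm⟩
      rw [this]
      refine ⟨(Set.finite_range _).insert _, ?_⟩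
      rw [Set.ncard_insert_of_notMem _ (Set.finite_range _), hcard]
      · have := hd (Fin.ofNat 2 (a :: l).length)
        simp only [numChildren, if_neg (List.cons_ne_nil a l)]
        omega
      · rintro ⟨b, h⟩
        have := congrArg (fun x => x.1.length) h
        simp [hchild] at this
        omega

end BoundaryTree

namespace BoundaryTree

open SimpleGraph

variable {V : Type*} {T : SimpleGraph V}

/-! ## Local actions -/

/-- The bijection between the neighbours of `v` and of `g v` induced by `g`. -/
def loc (g : T ≃g T) {v v' : V} (h : g v = v') : T.neighborSet v ≃ T.neighborSet v' where
  toFun w := ⟨g w, h ▸ g.map_adj_iff.2 w.2⟩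
  invFun w := ⟨g.symm w, by
    have h1 : v = g.symm v' := by rw [← h, RelIso.symm_apply_apply]
    exact h1 ▸ g.symm.map_adj_iff.2 w.2⟩
  left_inv w := Subtype.ext (g.symm_apply_apply _)
  right_inv w := Subtype.ext (g.apply_symm_apply _)

theorem coe_loc_apply (g : T ≃g T) {v v' : V} (h : g v = v') (w : T.neighborSet v) :
    (loc g h w : V) = g w := rfl

theorem mem_fixer {G : Subgroup (T ≃g T)} {A : Set V} {g : T ≃g T} :
    g ∈ fixer G A ↔ g ∈ G ∧ ∀ v ∈ A, g v = v :=
  and_congr_right fun _ => mem_fixingSubgroup_iff (T ≃g T)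

/-- A system of admissible bijections between the sets of neighbours of vertices, closed under
composition and inverses, with a cocycle `θ` on it, such that every admissible bijection at a
vertex can be continued at each neighbour. -/
structure LocalSystem (T : SimpleGraph V) (S : Type*) [Group S] where
  /-- the admissible bijections -/
  L : ∀ v v' : V, Set (T.neighborSet v ≃ T.neighborSet v')
  /-- the cocycle -/
  θ : ∀ {v v' : V}, (T.neighborSet v ≃ T.neighborSet v') → T.neighborSet v → S
  refl_mem : ∀ v, Equiv.refl _ ∈ L v v
  symm_mem : ∀ {v v'} {φ : T.neighborSet v ≃ T.neighborSet v'}, φ ∈ L v v' → φ.symm ∈ L v' v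
  trans_mem : ∀ {v v' v''} {φ : T.neighborSet v ≃ T.neighborSet v'}
    {ψ : T.neighborSet v' ≃ T.neighborSet v''}, φ ∈ L v v' → ψ ∈ L v' v'' → φ.trans ψ ∈ L v v''
  θ_trans : ∀ {v v' v''} {φ : T.neighborSet v ≃ T.neighborSet v'}
    {ψ : T.neighborSet v' ≃ T.neighborSet v''}, φ ∈ L v v' → ψ ∈ L v' v'' →
    ∀ w, θ (φ.trans ψ) w = θ ψ (φ w) * θ φ w
  extend : ∀ {v v'} {φ : T.neighborSet v ≃ T.neighborSet v'}, φ ∈ L v v' →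
    ∀ w : T.neighborSet v, ∃ ψ ∈ L w (φ w),
      (ψ ⟨v, w.2.symm⟩ : V) = v' ∧ θ ψ ⟨v, w.2.symm⟩ = θ φ w

/-! ### The universal group of a local system and extension of partial automorphisms -/

namespace LocalSystem

variable {S : Type*} [Group S] (Λ : LocalSystem T S)

theorem θ_refl {v : V} (w : T.neighborSet v) : Λ.θ (Equiv.refl _) w = 1 := by
  have := Λ.θ_trans (Λ.refl_mem v) (Λ.refl_mem v) w
  simpa using this

theorem θ_symm {v v' : V} {φ : T.neighborSet v ≃ T.neighborSet v'} (h : φ ∈ Λ.L v v')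
    (w : T.neighborSet v) : Λ.θ φ.symm (φ w) = (Λ.θ φ w)⁻¹ := by
  have := Λ.θ_trans h (Λ.symm_mem h) w
  rw [Equiv.self_trans_symm, θ_refl] at this
  exact eq_inv_of_mul_eq_one_left this.symm

/-- The universal group of a local system. -/
def univGroup : Subgroup (T ≃g T) where
  carrier := {g | (∀ v v' (h : g v = v'), loc g h ∈ Λ.L v v') ∧
    ∀ v w v' w' (hv : g v = v') (hw : g w = w') (hvw : T.Adj v w),
      Λ.θ (loc g hv) ⟨w, hvw⟩ = Λ.θ (loc g hw) ⟨v, hvw.symm⟩}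
  one_mem' := by
    have h1 : ∀ v v' (h : (1 : T ≃g T) v = v') (e : v = v'),
        loc 1 h = e ▸ Equiv.refl (T.neighborSet v) := by
      rintro v v' h rfl
      rfl
    refine ⟨fun v v' h => ?_, fun v w v' w' hv hw hvw => ?_⟩
    · obtain rfl : v = v' := h
      exact Λ.refl_mem v
    · obtain rfl : v = v' := hv
      obtain rfl : w = w' := hw
      exact (Λ.θ_refl _).trans (Λ.θ_refl _).symm
  mul_mem' := by
    rintro g k ⟨hg, hg'⟩ ⟨hk, hk'⟩
    refine ⟨fun v v' h => Λ.trans_mem (hk v _ rfl) (hg (k v) v' h),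
      fun v w v' w' hv hw hvw => ?_⟩
    have h1 := Λ.θ_trans (hk v _ rfl) (hg (k v) v' hv) ⟨w, hvw⟩
    have h2 := Λ.θ_trans (hk w _ rfl) (hg (k w) w' hw) ⟨v, hvw.symm⟩
    have h3 := hk' v w _ _ rfl rfl hvw
    have h4 := hg' (k v) (k w) v' w' hv hw (k.map_adj_iff.2 hvw)
    refine h1.trans (Eq.trans ?_ h2.symm)
    rw [h3]
    exact congrArg (· * _) h4
  inv_mem' := by
    rintro g ⟨hg, hg'⟩
    have hinv : ∀ {v v' : V}, g⁻¹ v = v' → g v' = v := by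
      rintro v _ rfl
      exact RelIso.apply_inv_self g v
    refine ⟨fun v v' h => Λ.symm_mem (hg v' v (hinv h)), fun v w v' w' hv hw hvw => ?_⟩
    have hvw' : T.Adj v' w' := by
      rw [← g.map_adj_iff, hinv hv, hinv hw]
      exact hvw
    have h1 := Λ.θ_symm (hg v' v (hinv hv)) ⟨w', hvw'⟩
    have h2 := Λ.θ_symm (hg w' w (hinv hw)) ⟨v', hvw'.symm⟩
    have e1 : loc g (hinv hv) ⟨w', hvw'⟩ = ⟨w, hvw⟩ := Subtype.ext (hinv hw)
    have e2 : loc g (hinv hw) ⟨v', hvw'.symm⟩ = ⟨v, hvw.symm⟩ := Subtype.ext (hinv hv)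
    rw [e1] at h1
    rw [e2] at h2
    refine h1.trans (Eq.trans ?_ h2.symm)
    rw [hg' v' w' v w (hinv hv) (hinv hw) hvw']

theorem loc_mem {g : T ≃g T} (hg : g ∈ Λ.univGroup) {v v' : V} (h : g v = v') :
    loc g h ∈ Λ.L v v' := hg.1 v v' h

theorem θ_loc {g : T ≃g T} (hg : g ∈ Λ.univGroup) {v w v' w' : V} (hv : g v = v') (hw : g w = w')
    (hvw : T.Adj v w) : Λ.θ (loc g hv) ⟨w, hvw⟩ = Λ.θ (loc g hw) ⟨v, hvw.symm⟩ :=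
  hg.2 v w v' w' hv hw hvw

/-- An image of the vertex `v` together with an admissible bijection of neighbours. -/
def State (v : V) : Type _ :=
  {x : (v' : V) × (T.neighborSet v ≃ T.neighborSet v') // x.2 ∈ Λ.L v x.1}

/-- Compatibility of states at two adjacent vertices. -/
structure Compat {v w : V} (h : T.Adj v w) (x : Λ.State v) (y : Λ.State w) : Prop where
  apply_left : (x.1.2 ⟨w, h⟩ : V) = y.1.1
  apply_right : (y.1.2 ⟨v, h.symm⟩ : V) = x.1.1
  θ_eq : Λ.θ x.1.2 ⟨w, h⟩ = Λ.θ y.1.2 ⟨v, h.symm⟩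

theorem Compat.symm {v w : V} {h : T.Adj v w} {x : Λ.State v} {y : Λ.State w}
    (hxy : Λ.Compat h x y) : Λ.Compat h.symm y x :=
  ⟨hxy.apply_right, hxy.apply_left, hxy.θ_eq.symm⟩

theorem exists_compat {v w : V} (h : T.Adj v w) (x : Λ.State v) :
    ∃ y : Λ.State w, Λ.Compat h x y := by
  obtain ⟨ψ, hψ, h1, h2⟩ := Λ.extend x.2 ⟨w, h⟩
  exact ⟨⟨⟨_, ψ⟩, hψ⟩, rfl, h1, h2.symm⟩

/-- The images of the vertices form a graph map that is bijective on neighbourhoods. Such a self-map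
of a tree is an automorphism: it preserves distances from every vertex, hence is injective, and it
lifts walks, hence is surjective. -/
theorem exists_aut_of_section (hT : T.IsTree) (D : ∀ v, Λ.State v)
    (hD : ∀ v w (h : T.Adj v w), Λ.Compat h (D v) (D w)) :
    ∃ g ∈ Λ.univGroup, ∀ v, g v = (D v).1.1 ∧ ∀ w : T.neighborSet v, g w = (D v).1.2 w := by
  set f : V → V := fun v => (D v).1.1 with hf
  have hfD : ∀ v (w : T.neighborSet v), f w = (D v).1.2 w := fun v w =>
    ((hD v w w.2).apply_left).symm
  have hadj : ∀ v w, T.Adj v w → T.Adj (f v) (f w) := fun v w h => by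
    rw [hfD v ⟨w, h⟩]
    exact ((D v).1.2 ⟨w, h⟩).2
  have hloc : ∀ u v w, T.Adj u v → T.Adj u w → f v = f w → v = w := fun u v w h h' he => by
    rw [hfD u ⟨v, h⟩, hfD u ⟨w, h'⟩] at he
    exact congrArg Subtype.val ((D u).1.2.injective (Subtype.ext he))
  have hdist : ∀ r n v, T.dist r v = n → T.dist (f r) (f v) = n ∧
      (v ≠ r → f v ≠ f r ∧ parent hT (f r) (f v) = f (parent hT r v)) := by
    intro r n
    induction n with
    | zero =>
      intro v hv
      rw [hT.connected.dist_eq_zero_iff] at hv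
      subst hv
      exact ⟨by simp, fun h => absurd rfl h⟩
    | succ n ih =>
      intro v hv
      have hvr : v ≠ r := by
        rintro rfl
        simp at hv
      have h1 := adj_parent hT hvr
      have h2 := dist_parent hT hvr
      set u := parent hT r v with hu
      have h3 := ih u (by omega)
      -- Otherwise `f v` would be the parent of `f u`, which by induction is the image of the parent
      -- of `u`. Local injectivity at `u` would then make `v` that parent, although it lies further
      -- from `r`.
      have h4 : f v ≠ f r ∧ f u = parent hT (f r) (f v) := by
        rcases parent_cases hT (f r) (hadj _ _ h1.symm) with h4 | ⟨h4, h5⟩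
        · exact h4
        · have hur : u ≠ r := by
            rintro h
            exact h4 (congrArg f h)
          rw [(h3.2 hur).2] at h5
          have h6 := hloc _ _ _ h1.symm (adj_parent hT hur) h5
          have h7 := dist_parent hT hur
          rw [← h6] at h7
          omega
      refine ⟨?_, fun _ => ⟨h4.1, h4.2.symm⟩⟩
      rw [dist_parent hT h4.1, ← h4.2, h3.1]
  have hinj : Function.Injective f := fun a b h => by
    have := (hdist a _ b rfl).1
    rw [h, SimpleGraph.dist_self] at this
    exact hT.connected.dist_eq_zero_iff.1 this.symm
  have hsurj : Function.Surjective f := by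
    obtain ⟨r⟩ := hT.connected.nonempty
    have key : ∀ a b (p : T.Walk a b), a ∈ Set.range f → b ∈ Set.range f := by
      intro a b p
      induction p with
      | nil => exact id
      | @cons a c b hac q ih =>
        rintro ⟨v, rfl⟩
        refine ih ⟨(D v).1.2.symm ⟨c, hac⟩, ?_⟩
        rw [hfD, Equiv.apply_symm_apply]
    intro b
    obtain ⟨p⟩ := hT.connected (f r) b
    exact key _ _ p ⟨r, rfl⟩
  have hiff : ∀ {v w}, T.Adj (f v) (f w) ↔ T.Adj v w := by
    refine ⟨fun h => ?_, hadj _ _⟩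
    have h1 := hfD _ ((D _).1.2.symm ⟨f _, h⟩)
    rw [Equiv.apply_symm_apply] at h1
    rw [← hinj h1]
    exact ((D _).1.2.symm ⟨f _, h⟩).2
  let g : T ≃g T := ⟨Equiv.ofBijective f ⟨hinj, hsurj⟩, hiff⟩
  have hg : ∀ v v' (h : g v = v'), ∃ e : (D v).1.1 = v', loc g h = e ▸ (D v).1.2 := by
    rintro v _ rfl
    exact ⟨rfl, Equiv.ext fun w => Subtype.ext (hfD v w)⟩
  refine ⟨g, ⟨fun v v' h => ?_, fun v w v' w' hv hw hvw => ?_⟩, fun v => ⟨rfl, hfD v⟩⟩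
  · obtain ⟨e, he⟩ := hg v v' h
    subst e
    rw [he]
    exact (D v).2
  · obtain ⟨e, he⟩ := hg v v' hv
    obtain ⟨e', he'⟩ := hg w w' hw
    subst e e'
    rw [he, he']
    exact (hD v w hvw).θ_eq

/-- States outside the parent-closed set `A` are chosen outwards from the root, one edge at a time.
In a tree no further compatibility condition can arise. -/
theorem exists_aut_extending (hT : T.IsTree) (r : V) (A : Set V) (D₀ : ∀ v, Λ.State v)
    (hA : ∀ v ∈ A, v ≠ r → parent hT r v ∈ A)
    (hD₀ : ∀ v ∈ A, v ≠ r → ∀ h, Λ.Compat (w := v) h (D₀ (parent hT r v)) (D₀ v)) :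
    ∃ g ∈ Λ.univGroup, ∀ v ∈ A, g v = (D₀ v).1.1 ∧ ∀ w : T.neighborSet v, g w = (D₀ v).1.2 w := by
  classical
  let next : ∀ {v w : V}, T.Adj v w → Λ.State v → Λ.State w :=
    fun h x => (Λ.exists_compat h x).choose
  have hnext : ∀ {v w : V} (h : T.Adj v w) (x : Λ.State v), Λ.Compat h x (next h x) :=
    fun h x => (Λ.exists_compat h x).choose_spec
  -- The recursion on the parent is replaced by recursion on a number of rounds. Taking one more
  -- than the distance from `r` makes the definition unfold at every vertex, and the count for the
  -- parent is exactly one less.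
  let E : ℕ → ∀ v, Λ.State v := fun n => Nat.rec D₀ (fun _ E' v =>
    if v ∈ A then D₀ v else
      if h : v ≠ r then next (adj_parent hT h).symm (E' (parent hT r v)) else D₀ v) n
  have hE : ∀ n v, E (n + 1) v = if v ∈ A then D₀ v else
      if h : v ≠ r then next (adj_parent hT h).symm (E n (parent hT r v)) else D₀ v :=
    fun _ _ => rfl
  let D : ∀ v, Λ.State v := fun v => E (T.dist r v + 1) v
  have hDA : ∀ v ∈ A, D v = D₀ v := fun v hv => by
    simp only [D, hE, if_pos hv]
  have hpar : ∀ v (_ : v ≠ r) (h' : T.Adj (parent hT r v) v),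
      Λ.Compat h' (D (parent hT r v)) (D v) := by
    intro v h h'
    by_cases hv : v ∈ A
    · rw [hDA v hv, hDA _ (hA v hv h)]
      exact hD₀ v hv h h'
    · have : D v = next (adj_parent hT h).symm (D (parent hT r v)) := by
        simp only [D]
        rw [hE, if_neg hv, dif_pos h, ← dist_parent hT h]
      rw [this]
      exact hnext _ _
  obtain ⟨g, hg, hgD⟩ := Λ.exists_aut_of_section hT D (by
    intro v w h
    rcases parent_cases hT r h with ⟨h1, h2⟩ | ⟨h1, h2⟩
    · subst h2
      exact hpar w h1 h
    · subst h2
      exact (hpar v h1 h.symm).symm)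
  exact ⟨g, hg, fun v hv => hDA v hv ▸ hgD v⟩

/-- Lets states be prescribed along a line, a ray or at one vertex: the type of a state depends on
its vertex, so the prescribed values have to be transported. -/
theorem exists_dependent_extension {ι α : Type*} {P : α → Sort*} {f : ι → α}
    (hf : Function.Injective f) (s : ∀ i, P (f i)) (d : ∀ a, P a) :
    ∃ D : ∀ a, P a, ∀ i, D (f i) = s i := by
  classical
  refine ⟨fun a => if h : ∃ i, f i = a then h.choose_spec ▸ s h.choose else d a, fun i => ?_⟩
  have h : ∃ j, f j = f i := ⟨i, rfl⟩
  beta_reduce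
  rw [dif_pos h]
  have key : ∀ (j : ι) (e : f j = f i), e ▸ s j = s i := by
    intro j e
    obtain rfl := hf e
    rfl
  exact key _ _

/-- The identity state. -/
def idState (v : V) : Λ.State v := ⟨⟨v, Equiv.refl _⟩, Λ.refl_mem v⟩

theorem mem_localAction_univGroup (hT : T.IsTree) {v : V} {p : Equiv.Perm (T.neighborSet v)} :
    p ∈ localAction Λ.univGroup v ↔ p ∈ Λ.L v v := by
  classical
  constructor
  · rintro ⟨g, hg, hgv, hp⟩
    have : loc g hgv = p := Equiv.ext fun w => Subtype.ext (hp w)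
    exact this ▸ Λ.loc_mem hg hgv
  · intro hp
    obtain ⟨D, hD⟩ := exists_dependent_extension (P := Λ.State) (f := fun _ : Unit => v)
      (fun _ _ _ => rfl) (fun _ => ⟨⟨v, p⟩, hp⟩) Λ.idState
    obtain ⟨g, hg, h⟩ := Λ.exists_aut_extending hT v {v} D
      (fun w hw hw' => absurd hw hw') (fun w hw hw' => absurd hw hw')
    refine ⟨g, hg, ?_, ?_⟩
    · rw [(h v rfl).1, hD ()]
    · intro w
      rw [(h v rfl).2, hD ()]

theorem exists_aut_line (hT : T.IsTree) {f f' : ℤ → V} (hf : IsLine T f)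
    (φ : ∀ i, T.neighborSet (f i) ≃ T.neighborSet (f' i)) (hφ : ∀ i, φ i ∈ Λ.L _ _)
    -- Keeping `j` as a variable with `j = i + 1` lets the condition also be applied at the indices
    -- `-(i + 1)` and `-i`, where the equality is not definitional.
    (hc : ∀ i j (_ : j = i + 1) (hij : T.Adj (f i) (f j)), (φ i ⟨f j, hij⟩ : V) = f' j ∧
      (φ j ⟨f i, hij.symm⟩ : V) = f' i ∧ Λ.θ (φ i) ⟨f j, hij⟩ = Λ.θ (φ j) ⟨f i, hij.symm⟩) :
    ∃ g ∈ Λ.univGroup, ∀ i, g (f i) = f' i := by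
  obtain ⟨D, hD⟩ := exists_dependent_extension (P := Λ.State) (hf.injective hT)
    (fun i => ⟨⟨f' i, φ i⟩, hφ i⟩) Λ.idState
  -- Rooting the tree at `f 0` makes the line closed under parents, on both of its halves.
  have hpos : ∀ i : ℕ, parent hT (f 0) (f (i + 1)) = f i := fun i => by
    refine (eq_parent hT (hf.adj i).symm ?_).symm
    have h1 := (hf.ray hT).dist_vert hT i
    have h2 := (hf.ray hT).dist_vert hT (i + 1)
    simp only [IsLine.ray, Ray.ofSeq, Nat.cast_add, Nat.cast_one, Nat.cast_zero] at h1 h2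
    rw [h1, h2]
  have hneg : ∀ i : ℕ, parent hT (f 0) (f (-(i + 1))) = f (-i) := fun i => by
    have hadj := hf.neg.adj i
    refine (eq_parent hT hadj.symm ?_).symm
    have h1 := (hf.neg.ray hT).dist_vert hT i
    have h2 := (hf.neg.ray hT).dist_vert hT (i + 1)
    simp only [IsLine.ray, Ray.ofSeq, Nat.cast_add, Nat.cast_one, Nat.cast_zero, neg_zero]
      at h1 h2
    rw [h1, h2]
  have hcase : ∀ j, f j ≠ f 0 → (∃ i : ℕ, j = i + 1) ∨ ∃ i : ℕ, j = -(i + 1) := by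
    intro j hj
    obtain ⟨k, rfl | rfl⟩ := j.eq_nat_or_neg <;> rcases k with _ | k
    · exact absurd rfl hj
    · exact Or.inl ⟨k, by simp⟩
    · exact absurd (by simp) hj
    · exact Or.inr ⟨k, by simp⟩
  obtain ⟨g, hg, h⟩ := Λ.exists_aut_extending hT (f 0) (Set.range f) D (by
    rintro _ ⟨j, rfl⟩ hj
    rcases hcase j hj with ⟨i, rfl⟩ | ⟨i, rfl⟩
    · exact hpos i ▸ ⟨_, rfl⟩
    · exact hneg i ▸ ⟨_, rfl⟩) (by
    rintro _ ⟨j, rfl⟩ hj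
    rcases hcase j hj with ⟨i, rfl⟩ | ⟨i, rfl⟩
    · rw [hpos i]
      intro hij
      rw [hD, hD]
      have := hc i (i + 1) rfl hij
      exact ⟨this.1, this.2.1, this.2.2⟩
    · rw [hneg i]
      intro hij
      rw [hD, hD]
      have := hc (-(i + 1)) (-i) (by ring) hij.symm
      exact ⟨this.2.1, this.1, this.2.2.symm⟩)
  refine ⟨g, hg, fun i => ?_⟩
  rw [(h _ ⟨i, rfl⟩).1, hD]

theorem exists_aut_ray (hT : T.IsTree) (ρ : Ray T)
    (φ : ∀ i, Equiv.Perm (T.neighborSet (ρ.vert i))) (hφ : ∀ i, φ i ∈ Λ.L _ _)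
    (hc : ∀ i, φ i ⟨ρ.vert (i + 1), ρ.adj i⟩ = ⟨ρ.vert (i + 1), ρ.adj i⟩ ∧
      φ (i + 1) ⟨ρ.vert i, (ρ.adj i).symm⟩ = ⟨ρ.vert i, (ρ.adj i).symm⟩ ∧
      Λ.θ (φ i) ⟨ρ.vert (i + 1), ρ.adj i⟩ = Λ.θ (φ (i + 1)) ⟨ρ.vert i, (ρ.adj i).symm⟩) :
    ∃ g ∈ Λ.univGroup, ∀ i, g (ρ.vert i) = ρ.vert i ∧
      ∀ w : T.neighborSet (ρ.vert i), g w = φ i w := by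
  obtain ⟨D, hD⟩ := exists_dependent_extension (P := Λ.State) ρ.injective
    (fun i => ⟨⟨ρ.vert i, φ i⟩, hφ i⟩) Λ.idState
  have hpos : ∀ i : ℕ, parent hT (ρ.vert 0) (ρ.vert (i + 1)) = ρ.vert i := fun i =>
    (eq_parent hT (ρ.adj i).symm (by rw [ρ.dist_vert hT, ρ.dist_vert hT])).symm
  obtain ⟨g, hg, h⟩ := Λ.exists_aut_extending hT (ρ.vert 0) (Set.range ρ.vert) D (by
    rintro _ ⟨_ | j, rfl⟩ hj
    · exact absurd rfl hj
    · exact hpos j ▸ ⟨_, rfl⟩) (by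
    rintro _ ⟨_ | j, rfl⟩ hj
    · exact absurd rfl hj
    · rw [hpos j]
      intro hij
      rw [hD, hD]
      have := hc j
      exact ⟨congrArg Subtype.val this.1, congrArg Subtype.val this.2.1, this.2.2⟩)
  refine ⟨g, hg, fun i => ?_⟩
  have := h _ ⟨i, rfl⟩
  rw [hD] at this
  exact this

/-! ## Rigid stabilizers of half-trees -/

/-- An element of the rigid stabilizer fixes `x` and all its neighbours, so its cocycle on the edge
is trivial when read at `x`, hence also when read at `y`. Conversely such a `p` is compatible with
the identity on the complement of the half-tree, and both extend. -/
theorem mem_Theta_univGroup (hT : T.IsTree) {x y : V} (hyx : T.Adj y x)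
    {p : Equiv.Perm (T.neighborSet y)} :
    p ∈ Theta Λ.univGroup x y ↔
      p ∈ Λ.L y y ∧ p ⟨x, hyx⟩ = ⟨x, hyx⟩ ∧ Λ.θ p ⟨x, hyx⟩ = 1 := by
  classical
  have hxy : T.Adj x y := hyx.symm
  have hx : x ∈ (halfTree T x y)ᶜ := by simp [halfTree]
  constructor
  · rintro ⟨g, hgf, hgy, hp⟩
    obtain ⟨hg, hfix⟩ := mem_fixer.1 hgf
    have hgx : g x = x := hfix x hx
    have hp' : loc g hgy = p := Equiv.ext fun w => Subtype.ext (hp w)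
    have hid : loc g hgx = Equiv.refl _ := by
      refine Equiv.ext fun w => Subtype.ext ?_
      rw [coe_loc_apply]
      by_cases hw : (w : V) = y
      · simp [hw, hgy]
      · refine hfix w ?_
        have h1 : T.dist x w = 1 := dist_eq_one_iff_adj.2 w.2
        have h2 : T.dist (w : V) y ≠ 0 := fun h => hw (hT.connected.dist_eq_zero_iff.1 h)
        simp only [halfTree, Set.mem_compl_iff, Set.mem_ofPred_eq, not_lt]
        rw [SimpleGraph.dist_comm, h1]
        omega
    refine ⟨hp' ▸ Λ.loc_mem hg hgy, ?_, ?_⟩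
    · rw [← hp']
      exact Subtype.ext hgx
    · rw [← hp', Λ.θ_loc hg hgy hgx hyx, hid, Λ.θ_refl]
  · rintro ⟨hp, hpx, hθ⟩
    have hyH : y ∈ halfTree T x y := by
      simp only [halfTree, Set.mem_ofPred_eq, SimpleGraph.dist_self]
      rw [dist_eq_one_iff_adj.2 hyx]
      exact one_pos
    obtain ⟨D, hD⟩ := exists_dependent_extension (P := Λ.State) (f := fun _ : Unit => y)
      (fun _ _ _ => rfl) (fun _ => ⟨⟨y, p⟩, hp⟩) Λ.idState
    let D' : ∀ v, Λ.State v := fun v => if v = y then D v else Λ.idState v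
    have hDy : D' y = ⟨⟨y, p⟩, hp⟩ := (if_pos rfl).trans (hD ())
    have hDne : ∀ v, v ≠ y → D' v = Λ.idState v := fun v hv => by simp [D', hv]
    have hpar : ∀ v ∈ (halfTree T x y)ᶜ, v ≠ x → parent hT x v ∈ (halfTree T x y)ᶜ := by
      intro v hv hvx
      have h1 := dist_parent hT hvx
      have h2 := hT.dist_eq_dist_add_one_of_adj y (adj_parent hT hvx)
      simp only [halfTree, Set.mem_compl_iff, Set.mem_ofPred_eq, not_lt] at hv ⊢
      rw [SimpleGraph.dist_comm, SimpleGraph.dist_comm (u := v) (v := y)] at hv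
      rw [SimpleGraph.dist_comm, SimpleGraph.dist_comm (v := y)]
      omega
    have hpary : parent hT x y = x :=
      (eq_parent hT hyx (by simp [dist_eq_one_iff_adj.2 hxy])).symm
    -- With root `x` the complement of the half-tree is closed under parents, and adding `y` adds
    -- only the edge between `x` and `y`.
    obtain ⟨g, hg, h⟩ := Λ.exists_aut_extending hT x (insert y (halfTree T x y)ᶜ) D' (by
        rintro v (rfl | hv) hvx
        · rw [hpary]
          exact Or.inr hx
        · exact Or.inr (hpar v hv hvx)) (by
        rintro v (rfl | hv) hvx
        · rw [hpary]
          intro hh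
          rw [hDy, hDne x hxy.ne]
          refine ⟨rfl, congrArg Subtype.val hpx, ?_⟩
          exact (Λ.θ_refl _).trans hθ.symm
        · intro hh
          have h1 := hpar v hv hvx
          have hne : v ≠ y := fun e => hv (e ▸ hyH)
          have hne' : parent hT x v ≠ y := fun e => h1 (e ▸ hyH)
          rw [hDne _ hne, hDne _ hne']
          exact ⟨rfl, rfl, (Λ.θ_refl _).trans (Λ.θ_refl _).symm⟩)
    refine ⟨g, mem_fixer.2 ⟨hg, ?_⟩, ?_, ?_⟩
    · intro v hv
      have := (h v (Or.inr hv)).1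
      rwa [hDne v (fun e => hv (e ▸ hyH))] at this
    · rw [(h y (Or.inl rfl)).1, hDy]
    · intro w
      rw [(h y (Or.inl rfl)).2, hDy]

end LocalSystem

end BoundaryTree

/-! ### Boundary-2-transitivity and end stabilizers from a factorization -/

namespace BoundaryTree

open SimpleGraph

variable {V : Type*} {T : SimpleGraph V}

namespace LocalSystem

variable {S : Type*} [Group S] (Λ : LocalSystem T S)

/-- Factorization data for a local system: subgroups `E v w u` of the cocycle group, realized
independently at two neighbours of a vertex, which factorize the cocycle group along edges. -/
structure Factorizes (ty : V → Fin 2)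
    (E : ∀ v : V, T.neighborSet v → T.neighborSet v → Subgroup S) : Prop where
  two_transitive : ∀ {v v'}, ty v = ty v' → ∀ {w u : T.neighborSet v} {w' u' : T.neighborSet v'},
    w ≠ u → w' ≠ u' → ∃ φ ∈ Λ.L v v', φ w = w' ∧ φ u = u'
  two_point : ∀ {v} {w u : T.neighborSet v}, w ≠ u → ∀ a ∈ E v w u, ∀ b ∈ E v u w,
    ∃ φ ∈ Λ.L v v, φ w = w ∧ φ u = u ∧ Λ.θ φ w = a ∧ Λ.θ φ u = b
  factor : ∀ {v} {w u : T.neighborSet v} (p : T.neighborSet w), w ≠ u → (p : V) ≠ v →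
    ∀ s, ∃ a ∈ E v w u, ∃ b ∈ E w ⟨v, w.2.symm⟩ p, a * b = s

variable {Λ} {ty : V → Fin 2} {E : ∀ v : V, T.neighborSet v → T.neighborSet v → Subgroup S}

/-- Admissible bijections along the line exist by 2-transitivity, but their cocycles may disagree on
edges. The mismatch on each edge is split into a factor absorbed at either end; since the
corrections toward the two line neighbours of a vertex are independent, all edges are repaired at
once. -/
theorem Factorizes.exists_line_map (hE : Λ.Factorizes ty E) (hT : T.IsTree) {f f' : ℤ → V}
    (hf : IsLine T f) (hf' : IsLine T f') (hty : ∀ i, ty (f i) = ty (f' i)) :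
    ∃ g ∈ Λ.univGroup, ∀ i, g (f i) = f' i := by
  have adjl : ∀ {f : ℤ → V}, IsLine T f → ∀ i, T.Adj (f i) (f (i - 1)) := fun hf i => by
    simpa using (hf.adj (i - 1)).symm
  have nel : ∀ {f : ℤ → V}, IsLine T f → ∀ i, f (i + 1) ≠ f (i - 1) := fun hf i => by
    have := (hf.ne_add_two (i - 1)).symm
    rwa [show i - 1 + 2 = i + 1 by ring] at this
  have hφ : ∀ i, ∃ φ ∈ Λ.L (f i) (f' i),
      φ ⟨f (i + 1), hf.adj i⟩ = ⟨f' (i + 1), hf'.adj i⟩ ∧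
      φ ⟨f (i - 1), adjl hf i⟩ = ⟨f' (i - 1), adjl hf' i⟩ := fun i =>
    hE.two_transitive (hty i) (fun h => nel hf i (congrArg Subtype.val h))
      (fun h => nel hf' i (congrArg Subtype.val h))
  choose φ hφL hφr hφl using hφ
  have hab : ∀ i j (_ : j = i + 1) (hij : T.Adj (f i) (f j)),
      ∃ c : S × S, c.1 ∈ E (f i) ⟨f (i + 1), hf.adj i⟩ ⟨f (i - 1), adjl hf i⟩ ∧
        c.2 ∈ E (f j) ⟨f (j - 1), adjl hf j⟩ ⟨f (j + 1), hf.adj j⟩ ∧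
        c.1 * c.2 = (Λ.θ (φ i) ⟨f j, hij⟩)⁻¹ * Λ.θ (φ j) ⟨f i, hij.symm⟩ := by
    rintro i _ rfl hij
    obtain ⟨a, ha, b, hb, h⟩ := hE.factor (v := f i) (w := ⟨f (i + 1), hf.adj i⟩)
      (u := ⟨f (i - 1), adjl hf i⟩) ⟨f (i + 1 + 1), hf.adj (i + 1)⟩
      (fun h => nel hf i (congrArg Subtype.val h))
      (by simpa [add_assoc] using (hf.ne_add_two i).symm)
      ((Λ.θ (φ i) ⟨f (i + 1), hij⟩)⁻¹ * Λ.θ (φ (i + 1)) ⟨f i, hij.symm⟩)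
    refine ⟨⟨a, b⟩, ha, ?_, h⟩
    have e : (⟨f (i + 1 - 1), adjl hf (i + 1)⟩ : T.neighborSet (f (i + 1))) =
      ⟨f i, (hf.adj i).symm⟩ := Subtype.ext (by simp)
    rw [e]
    exact hb
  choose c hc1 hc2 hc using hab
  have hψ : ∀ i, ∃ ψ ∈ Λ.L (f i) (f i), ψ ⟨f (i + 1), hf.adj i⟩ = ⟨f (i + 1), hf.adj i⟩ ∧
      ψ ⟨f (i - 1), adjl hf i⟩ = ⟨f (i - 1), adjl hf i⟩ ∧
      Λ.θ ψ ⟨f (i + 1), hf.adj i⟩ = (c i (i + 1) rfl (hf.adj i)).1 ∧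
      Λ.θ ψ ⟨f (i - 1), adjl hf i⟩ = (c (i - 1) i (by ring) (adjl hf i).symm).2⁻¹ := fun i =>
    hE.two_point (fun h => nel hf i (congrArg Subtype.val h)) _ (hc1 _ _ _ _) _
      (inv_mem (hc2 _ _ _ _))
  choose ψ hψL hψr hψl hψrθ hψlθ using hψ
  refine Λ.exists_aut_line hT hf (fun i => (ψ i).trans (φ i))
    (fun i => Λ.trans_mem (hψL i) (hφL i)) ?_
  rintro i _ rfl hij
  have e : (⟨f i, hij.symm⟩ : T.neighborSet (f (i + 1))) = ⟨f (i + 1 - 1), adjl hf (i + 1)⟩ :=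
    Subtype.ext (by simp)
  have hc3 : ∀ k (_ : k = i) (h1 : i + 1 = k + 1) (h2 : T.Adj (f k) (f (i + 1))),
      c k (i + 1) h1 h2 = c i (i + 1) rfl hij := by
    rintro k rfl _ _
    rfl
  refine ⟨?_, ?_, ?_⟩
  · rw [Equiv.trans_apply, hψr, hφr]
  · rw [Equiv.trans_apply, e, hψl, hφl]
    simp
  · rw [Λ.θ_trans (hψL _) (hφL _), Λ.θ_trans (hψL _) (hφL _), hψr, hψrθ, e, hψl, hψlθ, ← e,
      -- Agreement on the edge reads `θ(φ i) * a = θ(φ (i + 1)) * b⁻¹`, which is the chosen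
      -- factorization `a * b` of the mismatch; this is why the second factor is inverted in `hψ`.
      hc3 (i + 1 - 1) (by ring) _ _, eq_mul_inv_iff_mul_eq, mul_assoc, hc, mul_inv_cancel_left]

theorem Factorizes.isBoundary2Transitive (hE : Λ.Factorizes ty E) (hT : T.IsTree)
    (hty : ∀ v w, T.Adj v w → ty v ≠ ty w) : IsBoundary2Transitive Λ.univGroup := by
  intro ξ₁ ξ₂ η₁ η₂ hξ hη
  obtain ⟨f, hf, rfl, rfl⟩ := exists_line hT hξ
  have hstep : ∀ {f : ℤ → V}, IsLine T f → ∀ i, ty (f (i + 1)) = ty (f i) + 1 := by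
    intro f hf i
    have := hty _ _ (hf.adj i)
    revert this
    generalize ty (f i) = a, ty (f (i + 1)) = b
    revert a b
    decide
  have hall : ∀ {f f' : ℤ → V}, IsLine T f → IsLine T f' → ty (f 0) = ty (f' 0) →
      ∀ i, ty (f i) = ty (f' i) := by
    intro f f' hf hf' h0 i
    induction i with
    | zero => exact h0
    | succ i ih => rw [hstep hf, hstep hf', ih]
    | pred i ih =>
      have h1 := hstep hf (-i - 1)
      have h2 := hstep hf' (-i - 1)
      rw [sub_add_cancel] at h1 h2
      rw [h1, h2] at ih
      exact add_right_cancel ih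
  obtain ⟨f', hf', h1, h2, h0⟩ : ∃ (f' : ℤ → V) (h : IsLine T f'), (h.ray hT).toEnd = η₁ ∧
      (h.neg.ray hT).toEnd = η₂ ∧ ty (f 0) = ty (f' 0) := by
    obtain ⟨f', hf', rfl, rfl⟩ := exists_line hT hη
    by_cases h0 : ty (f 0) = ty (f' 0)
    · exact ⟨f', hf', rfl, rfl, h0⟩
    -- Types alternate along a line, so moving the origin by one vertex aligns them without changing
    -- the ends.
    · refine ⟨_, hf'.shift 1, hf'.ray_shift hT, hf'.ray_shift_neg hT, ?_⟩
      rw [hstep hf' 0]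
      revert h0
      generalize ty (f 0) = a, ty (f' 0) = b
      revert a b
      decide
  obtain ⟨g, hg, hgf⟩ := hE.exists_line_map hT hf hf' (hall hf hf' h0)
  refine ⟨g, hg, ?_, ?_⟩
  · rw [← h1, smul_toEnd]
    exact congrArg Ray.toEnd (Ray.ext (funext fun i => hgf i))
  · rw [← h2, smul_toEnd]
    exact congrArg Ray.toEnd (Ray.ext (funext fun i => hgf _))

/-- Fixing the end and the origin means fixing the ray pointwise. Such an automorphism with local
action `p` at the origin exists as soon as the next vertex can match the cocycle of `p`, because any
discrepancy this causes further along can be cancelled at once. -/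
theorem Factorizes.mem_Lambda (hE : Λ.Factorizes ty E) (hT : T.IsTree) (ρ : Ray T)
    {p : Equiv.Perm (T.neighborSet (ρ.vert 0))} :
    p ∈ Lambda Λ.univGroup ρ ↔ p ∈ Λ.L _ _ ∧
      p ⟨ρ.vert 1, ρ.adj 0⟩ = ⟨ρ.vert 1, ρ.adj 0⟩ ∧
      ∃ ψ ∈ Λ.L (ρ.vert 1) (ρ.vert 1),
        ψ ⟨ρ.vert 0, (ρ.adj 0).symm⟩ = ⟨ρ.vert 0, (ρ.adj 0).symm⟩ ∧
        ψ ⟨ρ.vert 2, ρ.adj 1⟩ = ⟨ρ.vert 2, ρ.adj 1⟩ ∧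
        Λ.θ ψ ⟨ρ.vert 0, (ρ.adj 0).symm⟩ = Λ.θ p ⟨ρ.vert 1, ρ.adj 0⟩ := by
  constructor
  · rintro ⟨g, ⟨hg, hξ⟩, h0, hp⟩
    have hfix : ∀ i, g (ρ.vert i) = ρ.vert i := fun i =>
      Ray.eq_of_toEnd_eq hT (ρ := g • ρ) (ρ' := ρ) h0 hξ i
    have hp' : loc g h0 = p := Equiv.ext fun w => Subtype.ext (hp w)
    refine ⟨hp' ▸ Λ.loc_mem hg h0, hp' ▸ Subtype.ext (hfix 1), loc g (hfix 1),
      Λ.loc_mem hg _, Subtype.ext (hfix 0), Subtype.ext (hfix 2), ?_⟩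
    rw [← hp']
    exact (Λ.θ_loc hg h0 (hfix 1) (ρ.adj 0)).symm
  · rintro ⟨hp, hp1, ψ, hψ, hψ0, hψ2, hθ⟩
    have ne02 : (⟨ρ.vert 2, ρ.adj 1⟩ : T.neighborSet (ρ.vert 1)) ≠
        ⟨ρ.vert 0, (ρ.adj 0).symm⟩ := fun h =>
      ρ.ne_add_two 0 (congrArg Subtype.val h).symm
    have ne13 : (⟨ρ.vert 1, (ρ.adj 1).symm⟩ : T.neighborSet (ρ.vert 2)) ≠
        ⟨ρ.vert 3, ρ.adj 2⟩ := fun h => ρ.ne_add_two 1 (congrArg Subtype.val h)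
    -- The cocycle of `ψ` toward the third vertex is killed by corrections at the second and third
    -- vertices that are trivial toward the first and fourth. From the fourth vertex on the identity
    -- will do.
    obtain ⟨a, ha, b, hb, hab⟩ := hE.factor (v := ρ.vert 1) (w := ⟨ρ.vert 2, ρ.adj 1⟩)
      (u := ⟨ρ.vert 0, (ρ.adj 0).symm⟩) ⟨ρ.vert 3, ρ.adj 2⟩ ne02
      (fun h => ρ.ne_add_two 1 h.symm) (Λ.θ ψ ⟨ρ.vert 2, ρ.adj 1⟩)⁻¹
    obtain ⟨χ, hχ, hχ2, hχ0, hχ2θ, hχ0θ⟩ := hE.two_point ne02 a ha 1 (one_mem _)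
    obtain ⟨σ, hσ, hσ1, hσ3, hσ1θ, hσ3θ⟩ := hE.two_point ne13 b⁻¹ (inv_mem hb) 1 (one_mem _)
    let φ : ∀ i, Equiv.Perm (T.neighborSet (ρ.vert i)) := fun i => match i with
      | 0 => p
      | 1 => χ.trans ψ
      | 2 => σ
      | n + 3 => Equiv.refl (T.neighborSet (ρ.vert (n + 3)))
    obtain ⟨g, hg, hgφ⟩ := Λ.exists_aut_ray hT ρ φ (by
      rintro (_ | _ | _ | i)
      · exact hp
      · exact Λ.trans_mem hχ hψ
      · exact hσ
      · exact Λ.refl_mem _) (by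
      rintro (_ | _ | _ | i)
      · refine ⟨hp1, ?_, ?_⟩
        · change ψ (χ _) = _
          rw [hχ0, hψ0]
        · refine Eq.trans ?_ (Λ.θ_trans hχ hψ _).symm
          rw [hχ0, hχ0θ, mul_one]
          exact hθ.symm
      · refine ⟨?_, hσ1, ?_⟩
        · change ψ (χ _) = _
          rw [hχ2, hψ2]
        · refine (Λ.θ_trans hχ hψ _).trans (Eq.trans ?_ hσ1θ.symm)
          rw [hχ2, hχ2θ, eq_inv_iff_mul_eq_one, mul_assoc, hab, mul_inv_cancel]
      · exact ⟨hσ3, rfl, hσ3θ.trans (Λ.θ_refl _).symm⟩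
      · exact ⟨rfl, rfl, (Λ.θ_refl _).trans (Λ.θ_refl _).symm⟩)
    refine ⟨g, ⟨hg, ?_⟩, (hgφ 0).1, (hgφ 0).2⟩
    exact congrArg Ray.toEnd (Ray.ext (funext fun i => (hgφ i).1) : g • ρ = ρ)

end LocalSystem

end BoundaryTree

namespace BoundaryTree

open SimpleGraph

variable {V : Type*} {T : SimpleGraph V}

/-! ## The permutation topology -/

theorem continuous_aut_apply (v : V) :
    @Continuous (T ≃g T) V _ ⊥ (fun g => g v) := by
  let _ : TopologicalSpace V := ⊥
  have _ : DiscreteTopology V := ⟨rfl⟩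
  exact (continuous_apply v).comp
    (continuous_induced_dom (f := fun (g : T ≃g T) (v : V) => g v))

instance : T2Space (T ≃g T) := by
  let _ : TopologicalSpace V := ⊥
  have _ : DiscreteTopology V := ⟨rfl⟩
  exact T2Space.of_injective_continuous (f := fun (g : T ≃g T) (v : V) => g v)
    DFunLike.coe_injective continuous_induced_dom

instance : TotallyDisconnectedSpace (T ≃g T) := by
  let _ : TopologicalSpace V := ⊥
  have _ : DiscreteTopology V := ⟨rfl⟩
  refine ⟨isTotallyDisconnected_of_image (f := fun (g : T ≃g T) (v : V) => g v)
    continuous_induced_dom.continuousOn DFunLike.coe_injective ?_⟩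
  exact isTotallyDisconnected_of_totallyDisconnectedSpace _

theorem exists_finite_fixer_subset {U : Set (T ≃g T)} (hU : IsOpen U) (h1 : 1 ∈ U) :
    ∃ A : Set V, A.Finite ∧ ∀ g : T ≃g T, (∀ v ∈ A, g v = v) → g ∈ U := by
  let _ : TopologicalSpace V := ⊥
  have _ : DiscreteTopology V := ⟨rfl⟩
  obtain ⟨W, hW, rfl⟩ := isOpen_induced_iff.1 hU
  obtain ⟨I, u, hu, hI⟩ := isOpen_pi_iff.1 hW _ h1
  exact ⟨I, I.finite_toSet, fun g hg => hI fun v hv => by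
    simpa [hg v hv] using (hu v hv).2⟩

theorem finite_sphere (hT : T.IsTree) (hfin : ∀ v, (T.neighborSet v).Finite) (y : V) (n : ℕ) :
    {v | T.dist y v = n}.Finite := by
  induction n with
  | zero =>
    refine (Set.finite_singleton y).subset fun v hv => ?_
    exact (hT.connected.dist_eq_zero_iff.1 hv).symm
  | succ n ih =>
    refine (ih.biUnion fun v _ => hfin v).subset fun v hv => ?_
    simp only [Set.mem_ofPred_eq] at hv
    have hvy : v ≠ y := by
      rintro rfl
      simp at hv
    have := dist_parent hT hvy
    exact Set.mem_biUnion (x := parent hT y v) (by simp only [Set.mem_ofPred_eq]; omega)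
      (adj_parent hT hvy).symm

theorem dist_aut (g : T ≃g T) (v w : V) : T.dist (g v) (g w) = T.dist v w := by
  have key : ∀ (g : T ≃g T) (v w : V), T.Reachable v w → T.dist (g v) (g w) ≤ T.dist v w := by
    intro g v w h
    obtain ⟨p, hp⟩ := h.exists_walk_length_eq_dist
    rw [← hp, ← Walk.length_map g.toHom p]
    exact dist_le _
  by_cases h : T.Reachable v w
  · refine le_antisymm (key g v w h) ?_
    have := key g.symm (g v) (g w) (h.map g.toHom)
    simpa using this
  · rw [dist_eq_zero_of_not_reachable h, dist_eq_zero_of_not_reachable]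
    intro h'
    exact h (by simpa using h'.map g.symm.toHom)

/-- An automorphism fixing `y` and its inverse both preserve the finite spheres around `y`, so the
pairs `(g, g⁻¹)` form a closed subset of a product of finite sets. Recording the inverse makes
bijectivity a closed condition. -/
theorem isCompact_stabilizer (hT : T.IsTree) (hfin : ∀ v, (T.neighborSet v).Finite) (y : V) :
    IsCompact {g : T ≃g T | g y = y} := by
  let _ : TopologicalSpace V := ⊥
  have _ : DiscreteTopology V := ⟨rfl⟩
  let B : Set (V → V) := Set.univ.pi fun v => {w | T.dist y w = T.dist y v}
  have hB : IsCompact B :=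
    isCompact_univ_pi fun v => (finite_sphere hT hfin y _).isCompact
  let C : Set ((V → V) × (V → V)) := {c | (∀ v, c.1 (c.2 v) = v) ∧ (∀ v, c.2 (c.1 v) = v) ∧
    ∀ v w, T.Adj (c.1 v) (c.1 w) ↔ T.Adj v w}
  have hcont1 : ∀ v, Continuous fun c : (V → V) × (V → V) => c.1 v := fun v =>
    (continuous_apply v).comp continuous_fst
  have hcont2 : ∀ v, Continuous fun c : (V → V) × (V → V) => c.2 v := fun v =>
    (continuous_apply v).comp continuous_snd
  have hopen : ∀ (p q : V → (V → V) × (V → V) → V), (∀ v, Continuous (p v)) →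
      (∀ v, Continuous (q v)) → ∀ v, Continuous fun c => p (q v c) c := by
    intro p q hp hq v
    refine continuous_def.2 fun s _ => ?_
    have : (fun c => p (q v c) c) ⁻¹' s = ⋃ u, (q v ⁻¹' {u}) ∩ (p u ⁻¹' s) := by
      ext c
      simp
    rw [this]
    exact isOpen_iUnion fun u => ((isOpen_discrete _).preimage (hq v)).inter
      ((isOpen_discrete _).preimage (hp u))
  have hC : IsClosed C := by
    have h1 : IsClosed {c : (V → V) × (V → V) | ∀ v, c.1 (c.2 v) = v} := by
      simp only [Set.ofPred_forall]
      exact isClosed_iInter fun v => isClosed_eq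
        (hopen (fun u c => c.1 u) (fun u c => c.2 u) hcont1 hcont2 v) continuous_const
    have h2 : IsClosed {c : (V → V) × (V → V) | ∀ v, c.2 (c.1 v) = v} := by
      simp only [Set.ofPred_forall]
      exact isClosed_iInter fun v => isClosed_eq
        (hopen (fun u c => c.2 u) (fun u c => c.1 u) hcont2 hcont1 v) continuous_const
    have h3 : IsClosed {c : (V → V) × (V → V) | ∀ v w, T.Adj (c.1 v) (c.1 w) ↔ T.Adj v w} := by
      simp only [Set.ofPred_forall]
      exact isClosed_iInter fun v => isClosed_iInter fun w =>
        (isClosed_discrete {z : V × V | T.Adj z.1 z.2 ↔ T.Adj v w}).preimage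
          ((hcont1 v).prodMk (hcont1 w))
    exact h1.inter (h2.inter h3)
  let F : C → (T ≃g T) := fun c =>
    ⟨⟨c.1.1, c.1.2, c.2.2.1, c.2.1⟩, fun {v w} => c.2.2.2 v w⟩
  have hF : Continuous F := by
    refine continuous_to_aut _ fun v w => ?_
    exact (isOpen_discrete {w}).preimage ((hcont1 v).comp continuous_subtype_val)
  have hK : IsCompact (Subtype.val ⁻¹' (B ×ˢ B) : Set C) :=
    (hC.isClosedEmbedding_subtypeVal).isCompact_preimage (hB.prod hB)
  refine (hK.image hF).of_isClosed_subset ?_ ?_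
  · exact (isClosed_discrete {y}).preimage (continuous_aut_apply y)
  · intro g hg
    simp only [Set.mem_ofPred_eq] at hg
    have hd : ∀ g : T ≃g T, g y = y → ∀ v, T.dist y (g v) = T.dist y v := fun g hg v => by
      conv_lhs => rw [← hg]
      exact dist_aut g y v
    have hg' : g.symm y = y := by rw [← hg, RelIso.symm_apply_apply, hg]
    refine ⟨⟨⟨g, g.symm⟩, fun v => g.apply_symm_apply v, fun v => g.symm_apply_apply v,
      fun v w => g.map_adj_iff⟩, ⟨?_, ?_⟩, ?_⟩
    · exact fun v _ => hd g hg v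
    · exact fun v _ => hd g.symm hg' v
    · rfl

/-- A violation of the defining conditions is visible on the neighbours of one vertex or of two
adjacent ones, which form a finite set, so it persists in a neighbourhood. -/
theorem LocalSystem.isClosed_univGroup {S : Type*} [Group S] (Λ : LocalSystem T S)
    (hfin : ∀ v, (T.neighborSet v).Finite) : IsClosed (Λ.univGroup : Set (T ≃g T)) := by
  have hN : ∀ (g : T ≃g T) v, IsOpen {k : T ≃g T | k v = g v ∧ ∀ w ∈ T.neighborSet v, k w = g w} :=
    fun g v => by
      have : {k : T ≃g T | k v = g v ∧ ∀ w ∈ T.neighborSet v, k w = g w} =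
        {k | k v = g v} ∩ ⋂ w ∈ T.neighborSet v, {k | k w = g w} := by
        ext k
        simp
      rw [this]
      exact (isOpen_aut_apply _ _).inter ((hfin v).isOpen_biInter fun w _ => isOpen_aut_apply _ _)
  have hloc : ∀ {g k : T ≃g T} {v v' : V}, (k v = g v ∧ ∀ w ∈ T.neighborSet v, k w = g w) →
      ∀ (hk : k v = v') (hg : g v = v'), loc k hk = loc g hg := fun h _ _ =>
    Equiv.ext fun w => Subtype.ext (h.2 w w.2)
  rw [← isOpen_compl_iff, isOpen_iff_mem_nhds]
  intro g hg
  simp only [Set.mem_compl_iff, SetLike.mem_coe] at hg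
  have hg' : (∃ v, loc g (rfl : g v = g v) ∉ Λ.L v (g v)) ∨
      ∃ v w, ∃ h : T.Adj v w, Λ.θ (loc g (rfl : g v = g v)) ⟨w, h⟩ ≠
        Λ.θ (loc g (rfl : g w = g w)) ⟨v, h.symm⟩ := by
    by_contra hcon
    push Not at hcon
    refine hg ⟨?_, ?_⟩
    · rintro v _ rfl
      exact hcon.1 v
    · rintro v w _ _ rfl rfl h
      exact hcon.2 v w h
  rcases hg' with ⟨v, h⟩ | ⟨v, w, hvw, h⟩
  · refine Filter.mem_of_superset ((hN g v).mem_nhds ⟨rfl, fun _ _ => rfl⟩) ?_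
    rintro k hk (hkG : k ∈ Λ.univGroup)
    exact h (hloc hk hk.1 rfl ▸ Λ.loc_mem hkG hk.1)
  · refine Filter.mem_of_superset (((hN g v).inter (hN g w)).mem_nhds
      ⟨⟨rfl, fun _ _ => rfl⟩, ⟨rfl, fun _ _ => rfl⟩⟩) ?_
    rintro k ⟨hk, hk'⟩ (hkG : k ∈ Λ.univGroup)
    refine h ?_
    rw [← hloc hk hk.1 rfl, ← hloc hk' hk'.1 rfl]
    exact Λ.θ_loc hkG hk.1 hk'.1 hvw

/-! ## Prosolubility -/

theorem derivedSeries_add_le {H : Type*} [Group H] {K : Subgroup H} {j : ℕ}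
    (h : derivedSeries H j ≤ K) (k : ℕ) :
    derivedSeries H (j + k) ≤ (derivedSeries K k).map K.subtype := by
  induction k with
  | zero => simpa [← MonoidHom.range_eq_map] using h
  | succ k ih =>
    rw [← add_assoc, derivedSeries_succ, derivedSeries_succ, Subgroup.map_commutator]
    exact Subgroup.commutator_mono ih ih

theorem exists_derivedSeries_le_ker {H P : Type*} [Group H] [Group P] {K : Subgroup H} {j : ℕ}
    (h : derivedSeries H j ≤ K) (f : K →* P) (hf : Group.IsSolvable f.range) :
    ∃ k, derivedSeries H k ≤ f.ker.map K.subtype := by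
  obtain ⟨k, hk⟩ := hf.1
  refine ⟨j + k, (derivedSeries_add_le h k).trans (Subgroup.map_mono ?_)⟩
  rw [← f.ker_rangeRestrict, ← Subgroup.map_eq_bot_iff, eq_bot_iff, ← hk]
  exact map_derivedSeries_le_derivedSeries _ _

theorem isSolvable_quotient_of_derivedSeries_le {H : Type*} [Group H] {N : Subgroup H} [N.Normal]
    {k : ℕ} (h : derivedSeries H k ≤ N) : Group.IsSolvable (H ⧸ N) := by
  refine ⟨k, ?_⟩
  rw [← map_derivedSeries_eq (f := QuotientGroup.mk' N) (QuotientGroup.mk'_surjective N),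
    Subgroup.map_eq_bot_iff, QuotientGroup.ker_mk']
  exact h

/-- The action on the neighbours of a fixed vertex. -/
def locHom (H : Subgroup (T ≃g T)) (v : V) (K : Subgroup H) (hK : ∀ g ∈ K, g.1 v = v) :
    K →* Equiv.Perm (T.neighborSet v) where
  toFun g := loc g.1.1 (hK g.1 g.2)
  map_one' := rfl
  map_mul' _ _ := rfl

/-- Some term of the derived series fixes the ball of radius `n` pointwise, by induction on `n`: an
element fixing the ball acts around each vertex of the sphere through a soluble group `P v`, and the
sphere is finite. Every open subgroup contains the fixer of a ball, so its quotient, when it is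
normal, is soluble. -/
theorem isProsoluble_of_local (hT : T.IsTree) (hfin : ∀ v, (T.neighborSet v).Finite)
    (H : Subgroup (T ≃g T)) (hH : IsClosed (H : Set (T ≃g T))) (y : V) (hy : ∀ g ∈ H, g y = y)
    (P : ∀ v, Subgroup (Equiv.Perm (T.neighborSet v))) (hP : ∀ v, Group.IsSolvable (P v))
    (hPy : ∀ g ∈ H, ∀ h : g y = y, loc g h ∈ P y)
    (hPv : ∀ v, v ≠ y → ∀ g ∈ H, (∀ u, T.Adj (parent hT y v) u → g u = u) →
      ∀ h : g v = v, g (parent hT y v) = parent hT y v → loc g h ∈ P v) : IsProsoluble H := by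
  have hball : ∀ n, ∃ k, ∀ g ∈ derivedSeries H k, ∀ v, T.dist y v ≤ n → g.1 v = v := by
    intro n
    induction n with
    | zero =>
      refine ⟨0, fun g _ v hv => ?_⟩
      have : y = v := hT.connected.dist_eq_zero_iff.1 (by omega)
      exact this ▸ hy g.1 g.2
    | succ n ih =>
      obtain ⟨j, hj⟩ := ih
      let K : Subgroup H := (fixer ⊤ {v | T.dist y v ≤ n}).subgroupOf H
      have hK : ∀ g : H, g ∈ K ↔ ∀ v, T.dist y v ≤ n → g.1 v = v := fun g => by
        simp only [K, Subgroup.mem_subgroupOf, mem_fixer]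
        simp
      have hjK : derivedSeries H j ≤ K := fun g hg => (hK g).2 (hj g hg)
      have hsph : ∀ v ∈ {v | T.dist y v = n}, ∃ k, ∀ g ∈ derivedSeries H k,
          ∀ w, T.Adj v w → g.1 w = w := by
        intro v hv
        simp only [Set.mem_ofPred_eq] at hv
        have hKv : ∀ g ∈ K, g.1 v = v := fun g hg => (hK g).1 hg v hv.le
        have hrange : (locHom H v K hKv).range ≤ P v := by
          rintro _ ⟨g, rfl⟩
          by_cases hvy : v = y
          · subst hvy
            exact hPy _ g.1.2 (hKv _ g.2)
          · refine hPv v hvy _ g.1.2 ?_ (hKv _ g.2) ?_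
            · intro u hu
              refine (hK _).1 g.2 u ?_
              have h1 := dist_parent hT hvy
              rcases hT.dist_eq_dist_add_one_of_adj y hu with h2 | h2 <;> omega
            · refine (hK _).1 g.2 _ ?_
              have h1 := dist_parent hT hvy
              omega
        have := hP v
        have hsol : Group.IsSolvable (locHom H v K hKv).range :=
          Group.isSolvable_of_isSolvable_injective (Subgroup.inclusion_injective hrange)
        obtain ⟨k, hk⟩ := exists_derivedSeries_le_ker hjK _ hsol
        refine ⟨k, fun g hg w hw => ?_⟩
        obtain ⟨g', hg', rfl⟩ := hk hg
        have h1 := DFunLike.congr_fun (MonoidHom.mem_ker.1 hg') (⟨w, hw⟩ : T.neighborSet v)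
        exact congrArg Subtype.val h1
      choose! k hk using hsph
      -- A single derived length serves all the finitely many vertices of the sphere.
      obtain ⟨m, hm⟩ := ((finite_sphere hT hfin y n).image k).bddAbove
      refine ⟨max m j, fun g hg v hv => ?_⟩
      by_cases hvn : T.dist y v ≤ n
      · exact hj g (derivedSeries_antitone H (le_max_right _ _) hg) v hvn
      · have hvy : v ≠ y := by
          rintro rfl
          simp at hvn
        have h1 := dist_parent hT hvy
        have h2 : parent hT y v ∈ {v | T.dist y v = n} := by
          simp only [Set.mem_ofPred_eq]
          omega
        exact hk _ h2 g (derivedSeries_antitone H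
          ((hm ⟨_, h2, rfl⟩).trans (le_max_left _ _)) hg) v (adj_parent hT hvy).symm
  refine ⟨?_, inferInstance, inferInstance, fun N _ hN => ?_⟩
  · exact isCompact_iff_compactSpace.1
      ((isCompact_stabilizer hT hfin y).of_isClosed_subset hH fun g hg => hy g hg)
  · obtain ⟨U, hU, hUN⟩ := isOpen_induced_iff.1 hN
    have h1 : (1 : T ≃g T) ∈ U := by
      have : (1 : H) ∈ Subtype.val ⁻¹' U := hUN ▸ one_mem N
      exact this
    obtain ⟨A, hA, hAU⟩ := exists_finite_fixer_subset hU h1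
    obtain ⟨n, hn⟩ := (hA.image (T.dist y)).bddAbove
    obtain ⟨k, hk⟩ := hball n
    refine isSolvable_quotient_of_derivedSeries_le (k := k) fun g hg => ?_
    have : g ∈ Subtype.val ⁻¹' U := hAU g.1 fun v hv => hk g hg v (hn ⟨v, hv, rfl⟩)
    rw [hUN] at this
    exact this

theorem IsProsoluble.of_continuousMulEquiv {H H' : Type*} [Group H] [TopologicalSpace H]
    [IsTopologicalGroup H] [Group H'] [TopologicalSpace H'] [IsTopologicalGroup H']
    (e : H ≃ₜ* H') (h : IsProsoluble H) : IsProsoluble H' where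
  compact := by
    have := h.compact
    exact e.toHomeomorph.compactSpace
  hausdorff := by
    have := h.hausdorff
    exact e.toHomeomorph.t2Space
  totallyDisconnected := by
    have := h.totallyDisconnected
    exact ⟨isTotallyDisconnected_of_image e.symm.continuous.continuousOn e.symm.injective
      (isTotallyDisconnected_of_totallyDisconnectedSpace _)⟩
  soluble_quotient N _ hN := by
    have h1 := h.soluble_quotient (N.comap e.toMulEquiv.toMonoidHom) (hN.preimage e.continuous)
    exact Group.isSolvable_of_surjective (f := QuotientGroup.map _ N e.toMulEquiv.toMonoidHom le_rfl)
      (QuotientGroup.map_surjective_of_surjective _ _ _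
        ((QuotientGroup.mk'_surjective N).comp e.surjective) _)

theorem isOpen_fixer {G : Subgroup (T ≃g T)} {A : Set V} (hA : A.Finite) :
    IsOpen ((fixer G A).subgroupOf G : Set G) := by
  have : ((fixer G A).subgroupOf G : Set G) =
      Subtype.val ⁻¹' ⋂ v ∈ A, {g : T ≃g T | g v = v} := by
    ext g
    simp [Subgroup.mem_subgroupOf, mem_fixer]
  rw [this]
  exact (hA.isOpen_biInter fun v _ => isOpen_aut_apply v v).preimage continuous_subtype_val

theorem isClosed_fixer {G : Subgroup (T ≃g T)} (hG : IsClosed (G : Set (T ≃g T))) (A : Set V) :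
    IsClosed (fixer G A : Set (T ≃g T)) := by
  have : (fixer G A : Set (T ≃g T)) = (G : Set (T ≃g T)) ∩ ⋂ v ∈ A, {g : T ≃g T | g v = v} := by
    ext g
    simp [mem_fixer]
  rw [this]
  let _ : TopologicalSpace V := ⊥
  have _ : DiscreteTopology V := ⟨rfl⟩
  exact hG.inter (isClosed_biInter fun v _ =>
    (isClosed_discrete {v}).preimage (continuous_aut_apply v))

theorem isLocallyProsoluble_of_fixer {G : Subgroup (T ≃g T)} {A : Set V} (hA : A.Finite)
    (h : IsProsoluble (fixer G A)) : IsLocallyProsoluble G := by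
  refine ⟨(fixer G A).subgroupOf G, isOpen_fixer hA, h.of_continuousMulEquiv ?_⟩
  have hle : fixer G A ≤ G := inf_le_left
  refine ⟨(Subgroup.subgroupOfEquivOfLe hle).symm, ?_, ?_⟩
  · exact Continuous.subtype_mk (Continuous.subtype_mk continuous_subtype_val _) _
  · exact Continuous.subtype_mk (continuous_subtype_val.comp continuous_subtype_val) _

/-- The action on the neighbours of `y` has open kernel, and its image contains the insoluble point
stabilizer. -/
theorem not_isProsoluble_fixer {G : Subgroup (T ≃g T)} {x y : V} (h : T.Adj y x)
    (hfin : (T.neighborSet y).Finite) (hsol : ¬ Group.IsSolvable (localPointStab G h)) :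
    ¬ IsProsoluble (fixer G {x, y}) := by
  intro hpro
  have hy : ∀ g ∈ fixer G {x, y}, g y = y := fun g hg => (mem_fixer.1 hg).2 y (by simp)
  let f : fixer G {x, y} →* Equiv.Perm (T.neighborSet y) :=
    { toFun := fun g => loc g.1 (hy g.1 g.2)
      map_one' := rfl
      map_mul' := fun _ _ => rfl }
  have hker : IsOpen (f.ker : Set (fixer G {x, y})) := by
    have : (f.ker : Set (fixer G {x, y})) =
        Subtype.val ⁻¹' ⋂ w ∈ T.neighborSet y, {g : T ≃g T | g w = w} := by
      ext g
      simp only [SetLike.mem_coe, MonoidHom.mem_ker, Equiv.ext_iff, Set.mem_preimage,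
        Set.mem_iInter, Subtype.forall]
      exact forall₂_congr fun w hw => Subtype.ext_iff
    rw [this]
    exact (hfin.isOpen_biInter fun v _ => isOpen_aut_apply v v).preimage continuous_subtype_val
  have h1 := hpro.soluble_quotient f.ker hker
  have h2 : Group.IsSolvable f.range :=
    Group.isSolvable_of_surjective (QuotientGroup.quotientKerEquivRange f).surjective
  refine hsol (Group.isSolvable_of_isSolvable_injective (f := Subgroup.inclusion ?_)
    (Subgroup.inclusion_injective _) (G' := f.range))
  rintro p ⟨⟨g, hg, hgy, hp⟩, hpx⟩
  have hgx : g x = x := (hp ⟨x, h⟩).trans (congrArg Subtype.val hpx)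
  refine ⟨⟨g, mem_fixer.2 ⟨hg, ?_⟩⟩, Equiv.ext fun w => Subtype.ext (hp w)⟩
  rintro v (rfl | rfl)
  · exact hgx
  · exact hgy

end BoundaryTree

namespace BoundaryTree

/-! ## Semilinear and projective semilinear groups -/

section Semilinear

variable {K V : Type*} [Field K] [AddCommGroup V] [Module K V]

theorem GammaL.map_add (g : GammaL K V) (u v : V) : g.1 (u + v) = g.1 u + g.1 v := g.2.1 u v

theorem GammaL.map_zero (g : GammaL K V) : g.1 0 = 0 := by
  have := GammaL.map_add g 0 0
  simpa using this

theorem GammaL.map_ne_zero (g : GammaL K V) {v : V} (hv : v ≠ 0) : g.1 v ≠ 0 := fun h =>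
  hv (g.1.injective (h.trans (GammaL.map_zero g).symm))

theorem GammaL.exists_map_smul (g : GammaL K V) :
    ∃ σ : K ≃+* K, ∀ (a : K) (v : V), g.1 (a • v) = σ a • g.1 v := g.2.2

theorem GammaL.coe_mul_apply (g h : GammaL K V) (v : V) : (g * h).1 v = g.1 (h.1 v) := rfl

theorem GammaL.inv_apply_apply (g : GammaL K V) (v : V) : (g⁻¹).1 (g.1 v) = v :=
  g.1.symm_apply_apply v

theorem GammaL.apply_inv_apply (g : GammaL K V) (v : V) : g.1 ((g⁻¹).1 v) = v :=
  g.1.apply_symm_apply v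

theorem GammaL.ext_iff {g h : GammaL K V} : g = h ↔ ∀ v, g.1 v = h.1 v :=
  Subtype.ext_iff.trans Equiv.ext_iff

/-- The homomorphism from semilinear maps to field automorphisms. -/
noncomputable def fieldAut (K V : Type*) [Field K] [AddCommGroup V] [Module K V] [Nontrivial V] :
    GammaL K V →* RingAut K where
  toFun g := (GammaL.exists_map_smul g).choose
  map_one' := by
    obtain ⟨v, hv⟩ := exists_ne (0 : V)
    have h := (GammaL.exists_map_smul (1 : GammaL K V)).choose_spec
    exact RingEquiv.ext fun a => (smul_left_injective K hv (h a v)).symm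
  map_mul' g g' := by
    obtain ⟨v, hv⟩ := exists_ne (0 : V)
    have h := (GammaL.exists_map_smul (g * g')).choose_spec
    have h1 := (GammaL.exists_map_smul g).choose_spec
    have h2 := (GammaL.exists_map_smul g').choose_spec
    refine RingEquiv.ext fun a => smul_left_injective K (GammaL.map_ne_zero (g * g') hv) ?_
    refine (h a v).symm.trans ?_
    rw [GammaL.coe_mul_apply, GammaL.coe_mul_apply, h2, h1]
    rfl

theorem map_smul_fieldAut [Nontrivial V] (g : GammaL K V) (a : K) (v : V) :
    g.1 (a • v) = fieldAut K V g a • g.1 v := (GammaL.exists_map_smul g).choose_spec a v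

theorem fieldAut_eq [Nontrivial V] {g : GammaL K V} {σ : RingAut K}
    (h : ∀ (a : K) (v : V), g.1 (a • v) = σ a • g.1 v) : fieldAut K V g = σ := by
  obtain ⟨v, hv⟩ := exists_ne (0 : V)
  refine RingEquiv.ext fun a => smul_left_injective K (GammaL.map_ne_zero g hv) ?_
  exact (map_smul_fieldAut g a v).symm.trans (h a v)

/-- Linear automorphisms are semilinear. -/
def linGamma (K V : Type*) [Field K] [AddCommGroup V] [Module K V] :
    (V ≃ₗ[K] V) →* GammaL K V where
  toFun e := ⟨e.toEquiv, e.map_add, RingEquiv.refl K, e.map_smul⟩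
  map_one' := rfl
  map_mul' _ _ := rfl

theorem fieldAut_linGamma [Nontrivial V] (e : V ≃ₗ[K] V) : fieldAut K V (linGamma K V e) = 1 :=
  fieldAut_eq fun a v => e.map_smul a v

theorem mk_map_eq (g : GammaL K V) {v w : V} (hv : v ≠ 0) (hw : w ≠ 0)
    (h : Projectivization.mk K v hv = Projectivization.mk K w hw) :
    Projectivization.mk K (g.1 v) (GammaL.map_ne_zero g hv) =
      Projectivization.mk K (g.1 w) (GammaL.map_ne_zero g hw) := by
  obtain ⟨a, rfl⟩ := (Projectivization.mk_eq_mk_iff' K _ _ hv hw).1 h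
  obtain ⟨σ, hσ⟩ := GammaL.exists_map_smul g
  exact (Projectivization.mk_eq_mk_iff' K _ _ _ _).2 ⟨σ a, (hσ a w).symm⟩

/-- The map of the projective space induced by a semilinear map. -/
noncomputable def projMap (g : GammaL K V) (x : ℙ K V) : ℙ K V :=
  Projectivization.mk K (g.1 x.rep) (GammaL.map_ne_zero g x.rep_nonzero)

theorem projMap_mk (g : GammaL K V) {v : V} (hv : v ≠ 0) :
    projMap g (Projectivization.mk K v hv) =
      Projectivization.mk K (g.1 v) (GammaL.map_ne_zero g hv) :=
  mk_map_eq g _ _ (Projectivization.mk_rep _)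

theorem projMap_one (x : ℙ K V) : projMap 1 x = x := Projectivization.mk_rep x

theorem projMap_mul (g h : GammaL K V) (x : ℙ K V) :
    projMap (g * h) x = projMap g (projMap h x) := by
  exact (projMap_mk g (GammaL.map_ne_zero h x.rep_nonzero)).symm

/-- The action of the semilinear group on the projective space. -/
noncomputable def projHom (K V : Type*) [Field K] [AddCommGroup V] [Module K V] :
    GammaL K V →* Equiv.Perm (ℙ K V) where
  toFun g := ⟨projMap g, projMap g⁻¹, fun x => by rw [← projMap_mul, inv_mul_cancel, projMap_one],
    fun x => by rw [← projMap_mul, mul_inv_cancel, projMap_one]⟩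
  map_one' := Equiv.ext projMap_one
  map_mul' g h := Equiv.ext (projMap_mul g h)

theorem projHom_mk (g : GammaL K V) {v : V} (hv : v ≠ 0) :
    projHom K V g (Projectivization.mk K v hv) =
      Projectivization.mk K (g.1 v) (GammaL.map_ne_zero g hv) := projMap_mk g hv

theorem projHom_mk_eq_iff (g : GammaL K V) {v w : V} (hv : v ≠ 0) (hw : w ≠ 0) :
    projHom K V g (Projectivization.mk K v hv) = Projectivization.mk K w hw ↔
      ∃ a : K, a • w = g.1 v := by
  rw [projHom_mk, Projectivization.mk_eq_mk_iff']

theorem range_projHom : (projHom K V).range = PGammaL K V := by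
  have key : ∀ (p : Equiv.Perm (ℙ K V)) (g : GammaL K V),
      p = projHom K V g ↔ ∀ x, ((p x).submodule : Set V) = g.1 '' x.submodule := by
    intro p g
    rw [Equiv.ext_iff]
    refine forall_congr' fun x => ?_
    induction x using Projectivization.ind with
    | _ v hv =>
      rw [projHom_mk, ← Projectivization.submodule_injective.eq_iff, ← SetLike.coe_set_eq,
        Projectivization.submodule_mk, Projectivization.submodule_mk]
      have : g.1 '' (Submodule.span K {v} : Submodule K V) =
          (Submodule.span K {g.1 v} : Submodule K V) := by
        obtain ⟨σ, hσ⟩ := GammaL.exists_map_smul g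
        ext w
        simp only [Set.mem_image, SetLike.mem_coe, Submodule.mem_span_singleton]
        constructor
        · rintro ⟨_, ⟨a, rfl⟩, rfl⟩
          exact ⟨σ a, (hσ a v).symm⟩
        · rintro ⟨a, rfl⟩
          exact ⟨_, ⟨σ.symm a, rfl⟩, by rw [hσ, RingEquiv.apply_symm_apply]⟩
      rw [this]
  ext p
  constructor
  · rintro ⟨g, rfl⟩
    exact ⟨g.1, g.2, (key _ g).1 rfl⟩
  · rintro ⟨g, hg, h⟩
    exact ⟨⟨g, hg⟩, ((key p ⟨g, hg⟩).2 h).symm⟩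

/-- Every vector is an eigenvector, and additivity forces equal eigenvalues on independent vectors.
Proportional vectors are compared through a third one outside their line, whose existence is what
`hV` (dimension at least two) provides. -/
theorem projHom_eq_one_iff (hV : ∀ w : V, ∃ u : V, ∀ c : K, u ≠ c • w) {g : GammaL K V} :
    projHom K V g = 1 ↔ ∃ c : K, ∀ v, g.1 v = c • v := by
  constructor
  · intro h
    have h1 : ∀ v : V, v ≠ 0 → ∃ a : K, a • v = g.1 v := fun v hv => by
      rw [← projHom_mk_eq_iff g hv hv, h, Equiv.Perm.one_apply]
    choose! a ha using h1
    have h2 : ∀ v w : V, v ≠ 0 → w ≠ 0 → (∀ c : K, v ≠ c • w) → a v = a w := by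
      intro v w hv hw hvw
      have hvw' : v + w ≠ 0 := fun h => hvw (-1) (by
        rw [neg_smul, one_smul]
        exact eq_neg_of_add_eq_zero_left h)
      have h3 : (a (v + w) - a v) • v = (a w - a (v + w)) • w := by
        have := ha _ hvw'
        rw [GammaL.map_add g, ← ha v hv, ← ha w hw, smul_add] at this
        rw [sub_smul, sub_smul, sub_eq_sub_iff_add_eq_add, this, add_comm]
      have h4 : a (v + w) - a v = 0 := by
        by_contra hne
        refine hvw ((a (v + w) - a v)⁻¹ * (a w - a (v + w))) ?_
        rw [mul_smul, ← h3, smul_smul, inv_mul_cancel₀ hne, one_smul]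
      rw [h4, zero_smul] at h3
      have h5 := (smul_eq_zero.1 h3.symm).resolve_right hw
      rw [← sub_eq_zero.1 h4, sub_eq_zero.1 h5]
    obtain ⟨v₀, hv₀⟩ := hV 0
    have hv₀' : v₀ ≠ 0 := fun h => hv₀ 0 (by simp [h])
    refine ⟨a v₀, fun v => ?_⟩
    by_cases hv : v = 0
    · rw [hv, GammaL.map_zero g, smul_zero]
    rw [← ha v hv]
    congr 1
    by_cases hind : ∀ c : K, v ≠ c • v₀
    · exact h2 v v₀ hv hv₀' hind
    · push Not at hind
      obtain ⟨c, hc⟩ := hind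
      obtain ⟨u, hu⟩ := hV v₀
      have hu0 : u ≠ 0 := fun h => hu 0 (by simp [h])
      have huv : ∀ d : K, u ≠ d • v := fun d h => hu (d * c) (by rw [h, hc, smul_smul])
      rw [← h2 u v hu0 hv huv, h2 u v₀ hu0 hv₀' hu]
  · rintro ⟨c, hc⟩
    refine Equiv.ext fun x => ?_
    induction x using Projectivization.ind with
    | _ v hv => exact (projHom_mk_eq_iff g hv hv).2 ⟨c, (hc v).symm⟩

theorem exists_ne_smul_pi {n : ℕ} (w : Fin (n + 2) → K) :
    ∃ u : Fin (n + 2) → K, ∀ c : K, u ≠ c • w := by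
  by_cases h : w 0 = 0
  · refine ⟨Pi.single 0 1, fun c hc => ?_⟩
    have := congrFun hc 0
    simp [h] at this
  · refine ⟨Pi.single 1 1, fun c hc => ?_⟩
    have h0 := congrFun hc 0
    have h1 := congrFun hc 1
    simp only [Pi.smul_apply, smul_eq_mul] at h0 h1
    rw [Pi.single_eq_of_ne (by simp), eq_comm, mul_eq_zero] at h0
    rw [h0.resolve_right h] at h1
    simp at h1

theorem exists_projHom_two_transitive {a b c d : ℙ K V} (hab : a ≠ b) (hcd : c ≠ d) :
    ∃ e : V ≃ₗ[K] V, projHom K V (linGamma K V e) a = c ∧ projHom K V (linGamma K V e) b = d := by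
  obtain ⟨e, h1, h2⟩ := MulAction.is_two_pretransitive_iff.1
    (Projectivization.linearEquiv_is_two_pretransitive K V) hab hcd
  have key : ∀ x : ℙ K V, projHom K V (linGamma K V e) x = e • x := by
    intro x
    induction x using Projectivization.ind with
    | _ v hv => exact projHom_mk _ hv
  exact ⟨e, by rw [key, h1], by rw [key, h2]⟩

/-- Restriction of scalars for semilinear groups, along an extension `L` of `K` with all
automorphisms of `L` preserving `K`. -/
theorem GammaL_le_of_algebra {L : Type*} [Field L] [Algebra K L] [Module L V]
    [IsScalarTower K L V]
    (h : ∀ σ : L ≃+* L, ∃ τ : K ≃+* K, ∀ a, σ (algebraMap K L a) = algebraMap K L (τ a)) :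
    GammaL L V ≤ GammaL K V := by
  rintro g ⟨hadd, σ, hσ⟩
  obtain ⟨τ, hτ⟩ := h σ
  refine ⟨hadd, τ, fun a v => ?_⟩
  rw [← algebraMap_smul L a v, hσ, hτ, algebraMap_smul]

end Semilinear

end BoundaryTree

namespace BoundaryTree

/-! ## Socle and soluble radical -/

theorem normal_map_equiv {X Y : Type*} [Group X] [Group Y] (e : X ≃* Y) (N : Subgroup X) :
    (N.map e.toMonoidHom).Normal ↔ N.Normal := by
  constructor
  · intro h
    have : N = (N.map e.toMonoidHom).comap e.toMonoidHom :=
      (Subgroup.comap_map_eq_self_of_injective e.injective N).symm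
    rw [this]
    infer_instance
  · exact fun h => h.map _ e.surjective

theorem isMinimalNormal_map_equiv {X Y : Type*} [Group X] [Group Y] (e : X ≃* Y)
    {N : Subgroup X} (h : IsMinimalNormal N) : IsMinimalNormal (N.map e.toMonoidHom) := by
  obtain ⟨⟨h1, h2⟩, h3⟩ := h
  refine ⟨⟨(normal_map_equiv e N).2 h1, fun h => h2 ?_⟩, fun M hM hMN => ?_⟩
  · rwa [Subgroup.map_eq_bot_iff_of_injective _ e.injective] at h
  · have hM' : (M.comap e.toMonoidHom).map e.toMonoidHom = M :=
      Subgroup.map_comap_eq_self_of_surjective e.surjective M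
    have h4 := @h3 (M.comap e.toMonoidHom) ⟨hM.1.comap _, fun h => hM.2 (by
      rw [← hM', h, Subgroup.map_bot])⟩ (by
        rintro x hx
        obtain ⟨y, hy, hyx⟩ := hMN hx
        rwa [← e.injective hyx])
    rw [Subgroup.map_le_iff_le_comap]
    exact h4

theorem socle_map_equiv {X Y : Type*} [Group X] [Group Y] (e : X ≃* Y) :
    (socle X).map e.toMonoidHom = socle Y := by
  have key : ∀ {X Y : Type _} [Group X] [Group Y] (e : X ≃* Y),
      (socle X).map e.toMonoidHom ≤ socle Y := by
    intro X Y _ _ e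
    rw [socle, Subgroup.map_le_iff_le_comap]
    refine sSup_le fun N hN => ?_
    rw [← Subgroup.map_le_iff_le_comap]
    exact le_sSup (isMinimalNormal_map_equiv e hN)
  refine le_antisymm (key e) ?_
  rw [socle]
  refine sSup_le fun N hN => ?_
  have h1 := isMinimalNormal_map_equiv e.symm hN
  intro y hy
  exact ⟨e.symm y, le_sSup (a := N.map e.symm.toMonoidHom) h1 ⟨y, hy, rfl⟩, e.apply_symm_apply y⟩

/-- A minimal normal subgroup that meets `W` trivially commutes with `W`, hence lies in `W` by
`hcent`; one that meets `W` nontrivially lies in `W` by its own minimality. -/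
theorem socle_eq {X : Type*} [Group X] {W : Subgroup X} [hW : W.Normal] (hne : W ≠ ⊥)
    (hmin : ∀ N : Subgroup X, N.Normal → N ≠ ⊥ → N ≤ W → W ≤ N)
    (hcent : ∀ g : X, (∀ w ∈ W, g * w = w * g) → g ∈ W) : socle X = W := by
  refine le_antisymm (sSup_le ?_) (le_sSup ⟨⟨hW, hne⟩, fun N hN hNW => hmin N hN.1 hN.2 hNW⟩)
  rintro N ⟨⟨hN, hN0⟩, hNmin⟩
  by_cases h : N ⊓ W = ⊥
  · intro n hn
    refine hcent n fun w hw => ?_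
    have h1 : n * w * n⁻¹ * w⁻¹ ∈ N ⊓ W := by
      refine ⟨?_, W.mul_mem (hW.conj_mem w hw n) (W.inv_mem hw)⟩
      rw [mul_assoc, mul_assoc, ← mul_assoc w]
      exact N.mul_mem hn (hN.conj_mem _ (N.inv_mem hn) w)
    rw [h, Subgroup.mem_bot, mul_inv_eq_one, mul_inv_eq_iff_eq_mul] at h1
    exact h1
  · exact (hNmin ⟨inferInstance, h⟩ inf_le_left).trans inf_le_right

/-- A soluble normal subgroup has soluble normal image in `S`, which must be trivial. -/
theorem solubleRadical_eq_ker {X S : Type*} [Group X] [Group S] (π : X →* S)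
    (hπ : Function.Surjective π) (hker : Group.IsSolvable π.ker)
    (hS : ∀ N : Subgroup S, N.Normal → Group.IsSolvable N → N = ⊥) :
    solubleRadical X = π.ker := by
  refine le_antisymm (sSup_le ?_) (le_sSup ⟨inferInstance, hker⟩)
  rintro N ⟨hN, hNs⟩
  rw [← Subgroup.map_eq_bot_iff]
  refine hS _ (hN.map _ hπ) ?_
  exact Group.isSolvable_of_surjective (f := π.subgroupMap N) (π.subgroupMap_surjective N)

theorem isSolvable_of_le {X : Type*} [Group X] {H K : Subgroup X} (h : H ≤ K)
    (hK : Group.IsSolvable K) : Group.IsSolvable H :=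
  Group.isSolvable_of_isSolvable_injective (Subgroup.inclusion_injective h)

theorem isSolvable_comap {X S : Type*} [Group X] [Group S] (π : X →* S)
    (hker : Group.IsSolvable π.ker) (H : Subgroup S) (hH : Group.IsSolvable H) :
    Group.IsSolvable (H.comap π) := by
  refine Group.isSolvable_of_ker_le_range (Subgroup.inclusion (H := π.ker) (K := H.comap π) ?_)
    (π.subgroupComap H) ?_
  · intro x hx
    rw [Subgroup.mem_comap, MonoidHom.mem_ker.1 hx]
    exact one_mem H
  · rintro ⟨x, hx⟩ hx'
    exact ⟨⟨x, congrArg Subtype.val hx'⟩, rfl⟩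

/-! ## The stabilizer of a vector in the semilinear group of a three-dimensional space -/

section Plane

variable {K : Type*} [Field K]

/-- The semilinear action of the general linear group. -/
noncomputable def glGamma (n : Type*) [Fintype n] [DecidableEq n] (K : Type*) [Field K] :
    GL n K →* GammaL K (n → K) :=
  (linGamma K (n → K)).comp
    ((LinearMap.GeneralLinearGroup.generalLinearEquiv K (n → K)).toMonoidHom.comp
      Matrix.GeneralLinearGroup.toLin.toMonoidHom)

theorem glGamma_apply {n : Type*} [Fintype n] [DecidableEq n] (A : GL n K) (v : n → K) :
    (glGamma n K A).1 v = A.1.mulVec v := rfl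

theorem fieldAut_glGamma {n : Type*} [Fintype n] [DecidableEq n] [Nonempty n] (A : GL n K) :
    fieldAut K (n → K) (glGamma n K A) = 1 := fieldAut_linGamma _

/-- The vector with first coordinate `a` and remaining coordinates `u`. -/
def vec3 {K : Type*} (a : K) (u : Fin 2 → K) : Fin 3 → K := ![a, u 0, u 1]

/-- The last two coordinates of a vector. -/
def tail3 {K : Type*} (v : Fin 3 → K) : Fin 2 → K := ![v 1, v 2]

@[simp] theorem vec3_zero {K : Type*} (a : K) (u : Fin 2 → K) : vec3 a u 0 = a := rfl

@[simp] theorem tail3_vec3 {K : Type*} (a : K) (u : Fin 2 → K) : tail3 (vec3 a u) = u := by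
  ext i
  fin_cases i <;> rfl

@[simp] theorem vec3_eta {K : Type*} (v : Fin 3 → K) : vec3 (v 0) (tail3 v) = v := by
  ext i
  fin_cases i <;> rfl

theorem vec3_add (a b : K) (u v : Fin 2 → K) : vec3 (a + b) (u + v) = vec3 a u + vec3 b v := by
  ext i
  fin_cases i <;> rfl

theorem vec3_smul (c a : K) (u : Fin 2 → K) : vec3 (c * a) (c • u) = c • vec3 a u := by
  ext i
  fin_cases i <;> rfl

theorem tail3_add (v w : Fin 3 → K) : tail3 (v + w) = tail3 v + tail3 w := by
  ext i
  fin_cases i <;> rfl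

theorem tail3_smul (c : K) (v : Fin 3 → K) : tail3 (c • v) = c • tail3 v := by
  ext i
  fin_cases i <;> rfl

theorem vec3_inj {K : Type*} {a b : K} {u v : Fin 2 → K} : vec3 a u = vec3 b v ↔ a = b ∧ u = v := by
  constructor
  · intro h
    exact ⟨congrFun h 0, by simpa using congrArg tail3 h⟩
  · rintro ⟨rfl, rfl⟩
    rfl

theorem vec3_eq_smul_add (a : K) (u : Fin 2 → K) : vec3 a u = a • vec3 1 0 + vec3 0 u := by
  rw [← vec3_smul, ← vec3_add]
  simp

/-- The stabilizer of the first basis vector in the semilinear group. -/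
def vecStab (K : Type*) [Field K] : Subgroup (GammaL K (Fin 3 → K)) where
  carrier := {g | g.1 (vec3 1 0) = vec3 1 0}
  one_mem' := rfl
  mul_mem' {g h} hg hh := by
    have hg' : g.1 _ = _ := hg
    have hh' : h.1 _ = _ := hh
    change g.1 (h.1 _) = _
    rw [hh', hg']
  inv_mem' {g} hg := by
    have hg' : g.1 _ = _ := hg
    change (g⁻¹).1 _ = _
    conv_lhs => rw [← hg']
    exact GammaL.inv_apply_apply g _

theorem vecStab_apply_vec3 (g : vecStab K) (a : K) (u : Fin 2 → K) :
    g.1.1 (vec3 a u) =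
      vec3 (fieldAut K _ g.1 a + g.1.1 (vec3 0 u) 0) (tail3 (g.1.1 (vec3 0 u))) := by
  have h : g.1.1 (vec3 1 0) = vec3 1 0 := g.2
  rw [vec3_eq_smul_add, GammaL.map_add, map_smul_fieldAut, h, ← vec3_smul]
  nth_rewrite 1 [← vec3_eta (g.1.1 (vec3 0 u))]
  rw [← vec3_add]
  simp

theorem tail3_vecStab_apply (g : vecStab K) (v : Fin 3 → K) :
    tail3 (g.1.1 v) = tail3 (g.1.1 (vec3 0 (tail3 v))) := by
  conv_lhs => rw [← vec3_eta v, vecStab_apply_vec3, tail3_vec3]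

/-- The action of the stabilizer of a vector on the quotient space. -/
def quotHom (K : Type*) [Field K] : vecStab K →* GammaL K (Fin 2 → K) where
  toFun g := ⟨⟨fun u => tail3 (g.1.1 (vec3 0 u)), fun u => tail3 ((g⁻¹).1.1 (vec3 0 u)),
    fun u => by
      beta_reduce
      rw [← tail3_vecStab_apply]
      exact (congrArg tail3 (GammaL.inv_apply_apply g.1 _)).trans (tail3_vec3 _ _),
    fun u => by
      beta_reduce
      rw [← tail3_vecStab_apply]
      exact (congrArg tail3 (GammaL.apply_inv_apply g.1 _)).trans (tail3_vec3 _ _)⟩,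
    fun u v => by
      change tail3 (g.1.1 (vec3 0 (u + v))) = tail3 (g.1.1 (vec3 0 u)) + tail3 (g.1.1 (vec3 0 v))
      rw [← tail3_add, ← GammaL.map_add, ← vec3_add, add_zero],
    fieldAut K _ g.1, fun a u => by
      change tail3 (g.1.1 (vec3 0 (a • u))) = _ • tail3 (g.1.1 (vec3 0 u))
      rw [← tail3_smul, ← map_smul_fieldAut, ← vec3_smul, mul_zero]⟩
  map_one' := Subtype.ext (Equiv.ext fun u => tail3_vec3 0 u)
  map_mul' g h := Subtype.ext (Equiv.ext fun u => tail3_vecStab_apply g _)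

theorem quotHom_apply (g : vecStab K) (u : Fin 2 → K) :
    (quotHom K g).1 u = tail3 (g.1.1 (vec3 0 u)) := rfl

theorem vecStab_apply (g : vecStab K) (a : K) (u : Fin 2 → K) :
    g.1.1 (vec3 a u) =
      vec3 (fieldAut K _ g.1 a + g.1.1 (vec3 0 u) 0) ((quotHom K g).1 u) :=
  vecStab_apply_vec3 g a u

theorem fieldAut_quotHom (g : vecStab K) :
    fieldAut K _ (quotHom K g) = fieldAut K _ g.1 :=
  fieldAut_eq fun a u => by
    rw [quotHom_apply, quotHom_apply, ← tail3_smul, ← map_smul_fieldAut, ← vec3_smul, mul_zero]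

/-- The extension of a semilinear map of the plane to three-dimensional space fixing the first
basis vector. -/
noncomputable def sectHom (K : Type*) [Field K] : GammaL K (Fin 2 → K) →* vecStab K where
  toFun h := ⟨⟨⟨fun v => vec3 (fieldAut K _ h (v 0)) (h.1 (tail3 v)),
    fun v => vec3 (fieldAut K _ h⁻¹ (v 0)) ((h⁻¹).1 (tail3 v)),
    fun v => by
      beta_reduce
      rw [tail3_vec3, GammaL.inv_apply_apply, vec3_zero, map_inv]
      exact (congrArg (vec3 · _) ((fieldAut K _ h).symm_apply_apply _)).trans (vec3_eta v),
    fun v => by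
      beta_reduce
      rw [tail3_vec3, GammaL.apply_inv_apply, vec3_zero, map_inv]
      exact (congrArg (vec3 · _) ((fieldAut K _ h).apply_symm_apply _)).trans (vec3_eta v)⟩,
    fun u v => by
      change vec3 _ _ = vec3 _ _ + vec3 _ _
      rw [tail3_add, GammaL.map_add, ← vec3_add, Pi.add_apply, (fieldAut K _ h).map_add],
    fieldAut K _ h, fun a v => by
      change vec3 _ _ = _ • vec3 _ _
      rw [tail3_smul, map_smul_fieldAut, ← vec3_smul, Pi.smul_apply, smul_eq_mul,
        (fieldAut K _ h).map_mul]⟩, by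
      change vec3 _ _ = _
      rw [tail3_vec3, vec3_zero, map_one, GammaL.map_zero]⟩
  map_one' := by
    refine Subtype.ext (Subtype.ext (Equiv.ext fun v => ?_))
    change vec3 _ _ = _
    rw [map_one]
    exact vec3_eta v
  map_mul' g h := by
    refine Subtype.ext (Subtype.ext (Equiv.ext fun v => ?_))
    change vec3 _ _ = vec3 _ _
    rw [map_mul]
    simp only [Equiv.coe_fn_mk, vec3_zero, tail3_vec3]
    rfl

theorem sectHom_apply (h : GammaL K (Fin 2 → K)) (a : K) (u : Fin 2 → K) :
    (sectHom K h).1.1 (vec3 a u) = vec3 (fieldAut K _ h a) (h.1 u) := by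
  change vec3 _ _ = _
  rw [tail3_vec3, vec3_zero]

theorem quotHom_sectHom (h : GammaL K (Fin 2 → K)) : quotHom K (sectHom K h) = h :=
  GammaL.ext_iff.2 fun u => by rw [quotHom_apply, sectHom_apply, tail3_vec3]

theorem vecStab_ext {g h : vecStab K}
    (H : ∀ a u, g.1.1 (vec3 a u) = h.1.1 (vec3 a u)) : g = h :=
  Subtype.ext (GammaL.ext_iff.2 fun v => by rw [← vec3_eta v, H])

theorem mem_ker_quotHom_apply {g : vecStab K} (hg : g ∈ (quotHom K).ker) (a : K) (u : Fin 2 → K) :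
    g.1.1 (vec3 a u) = vec3 (a + g.1.1 (vec3 0 u) 0) u := by
  rw [MonoidHom.mem_ker] at hg
  rw [vecStab_apply, ← fieldAut_quotHom, hg, map_one]
  rfl

/-- The transvection with center the first basis vector. -/
noncomputable def shear (w : Fin 2 → K) : vecStab K :=
  ⟨glGamma (Fin 3) K (Matrix.GeneralLinearGroup.mkOfDetNeZero !![1, w 0, w 1; 0, 1, 0; 0, 0, 1]
    (by simp [Matrix.det_fin_three])), by
    change (_ : Fin 3 → K) = _
    ext i
    fin_cases i <;>
      simp [glGamma_apply, Matrix.GeneralLinearGroup.mkOfDetNeZero, vec3, Matrix.mulVec,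
        dotProduct, Fin.sum_univ_three]⟩

theorem shear_apply (w : Fin 2 → K) (a : K) (u : Fin 2 → K) :
    (shear w).1.1 (vec3 a u) = vec3 (a + (w 0 * u 0 + w 1 * u 1)) u := by
  ext i
  fin_cases i <;>
    simp [shear, glGamma_apply, Matrix.GeneralLinearGroup.mkOfDetNeZero, vec3, Matrix.mulVec,
      dotProduct, Fin.sum_univ_three, add_assoc]

theorem shear_mem_ker (w : Fin 2 → K) : shear w ∈ (quotHom K).ker :=
  MonoidHom.mem_ker.2 (GammaL.ext_iff.2 fun u => by
    rw [quotHom_apply, shear_apply, tail3_vec3]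
    rfl)

theorem exists_eq_shear {g : vecStab K} (hg : g ∈ (quotHom K).ker) : ∃ w, g = shear w := by
  refine ⟨![g.1.1 (vec3 0 ![1, 0]) 0, g.1.1 (vec3 0 ![0, 1]) 0], vecStab_ext fun a u => ?_⟩
  rw [mem_ker_quotHom_apply hg, shear_apply, vec3_inj]
  refine ⟨?_, rfl⟩
  have h1 : vec3 0 u = u 0 • vec3 (0 : K) ![1, 0] + u 1 • vec3 (0 : K) ![0, 1] := by
    ext i
    fin_cases i <;> simp [vec3]
  rw [h1, GammaL.map_add, map_smul_fieldAut, map_smul_fieldAut, ← fieldAut_quotHom,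
    MonoidHom.mem_ker.1 hg, map_one]
  simp [mul_comm]

theorem shear_zero : shear (0 : Fin 2 → K) = 1 :=
  vecStab_ext fun a u => by
    rw [shear_apply]
    simp

theorem shear_ne_one {w : Fin 2 → K} (hw : w ≠ 0) : shear w ≠ 1 := by
  intro h
  apply hw
  ext i
  have h1 := shear_apply w 0 (Pi.single i 1)
  rw [h] at h1
  have h2 := (congrFun h1 0).symm
  simp only [vec3_zero] at h2
  fin_cases i <;> simpa using h2

theorem ker_quotHom_comm {g h : vecStab K} (hg : g ∈ (quotHom K).ker) (hh : h ∈ (quotHom K).ker) :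
    g * h = h * g := by
  obtain ⟨w, rfl⟩ := exists_eq_shear hg
  obtain ⟨w', rfl⟩ := exists_eq_shear hh
  refine vecStab_ext fun a u => ?_
  change (shear w).1.1 ((shear w').1.1 _) = (shear w').1.1 ((shear w).1.1 _)
  simp only [shear_apply]
  rw [add_right_comm]

theorem exists_linear_apply_zero_eq {w : Fin 2 → K} (hw : w ≠ 0) :
    ∃ A : GL (Fin 2) K, ∀ u : Fin 2 → K, A.1.mulVec u 0 = w 0 * u 0 + w 1 * u 1 := by
  by_cases h0 : w 0 = 0
  · have h1 : w 1 ≠ 0 := fun h1 => hw (by ext i; fin_cases i <;> assumption)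
    refine ⟨Matrix.GeneralLinearGroup.mkOfDetNeZero !![w 0, w 1; 1, 0]
      (by simpa [Matrix.det_fin_two]), fun u => ?_⟩
    simp [Matrix.GeneralLinearGroup.mkOfDetNeZero, Matrix.mulVec, dotProduct, Fin.sum_univ_two]
  · refine ⟨Matrix.GeneralLinearGroup.mkOfDetNeZero !![w 0, w 1; 0, 1]
      (by simpa [Matrix.det_fin_two]), fun u => ?_⟩
    simp [Matrix.GeneralLinearGroup.mkOfDetNeZero, Matrix.mulVec, dotProduct, Fin.sum_univ_two]

/-- Shears correspond to linear functionals on the quotient plane, and `GL₂` is transitive on the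
nonzero ones. This makes the group of shears a minimal normal subgroup. -/
theorem exists_conj_shear {w w' : Fin 2 → K} (hw : w ≠ 0) (hw' : w' ≠ 0) :
    ∃ g : vecStab K, g * shear w * g⁻¹ = shear w' := by
  obtain ⟨A, hA⟩ := exists_linear_apply_zero_eq hw
  obtain ⟨A', hA'⟩ := exists_linear_apply_zero_eq hw'
  refine ⟨sectHom K (glGamma (Fin 2) K (A'⁻¹ * A)), mul_inv_eq_iff_eq_mul.2 ?_⟩
  refine vecStab_ext fun a u => ?_
  change (sectHom K _).1.1 ((shear w).1.1 _) = (shear w').1.1 ((sectHom K _).1.1 _)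
  rw [shear_apply, sectHom_apply, sectHom_apply, shear_apply, ← hA, ← hA', fieldAut_glGamma]
  rw [glGamma_apply, Matrix.mulVec_mulVec]
  have : (A'.1 * (A'⁻¹ * A).1) = A.1 := by
    rw [← Units.val_mul, mul_inv_cancel_left]
  rw [this]
  rfl

/-- The shears are permuted transitively, hence form a minimal normal subgroup, and they contain
their own centralizer. -/
theorem socle_vecStab : socle (vecStab K) = (quotHom K).ker := by
  have h1 : (1 : Fin 2 → K) ≠ 0 := one_ne_zero
  refine socle_eq ?_ ?_ ?_
  · intro h
    have := shear_mem_ker (1 : Fin 2 → K)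
    rw [h, Subgroup.mem_bot] at this
    exact shear_ne_one h1 this
  · intro N hN hne hle g hg
    obtain ⟨⟨x, hx⟩, hx0⟩ := Subgroup.ne_bot_iff_exists_ne_one.1 hne
    have hx1 : x ≠ 1 := fun h => hx0 (Subtype.ext h)
    obtain ⟨w, hw⟩ := exists_eq_shear (hle hx)
    obtain ⟨w', rfl⟩ := exists_eq_shear hg
    by_cases hw' : w' = 0
    · rw [hw', shear_zero]
      exact one_mem N
    · have hw0 : w ≠ 0 := by
        rintro rfl
        rw [shear_zero] at hw
        exact hx1 hw
      obtain ⟨k, hk⟩ := exists_conj_shear hw0 hw'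
      rw [← hk, ← hw]
      exact hN.conj_mem _ hx k
  · intro g hg
    -- Commuting with all shears means preserving every functional up to the field automorphism of
    -- `g`. Coordinate functionals and their multiples then show that this automorphism and the
    -- action on the quotient are trivial.
    have h2 : ∀ w u : Fin 2 → K, fieldAut K _ g.1 (w 0 * u 0 + w 1 * u 1) =
        w 0 * (quotHom K g).1 u 0 + w 1 * (quotHom K g).1 u 1 := by
      intro w u
      have h3 : g.1.1 ((shear w).1.1 (vec3 0 u)) = (shear w).1.1 (g.1.1 (vec3 0 u)) :=
        congrArg (fun k : vecStab K => k.1.1 (vec3 0 u)) (hg _ (shear_mem_ker w))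
      rw [shear_apply, vecStab_apply, vecStab_apply, shear_apply, vec3_inj] at h3
      simp only [map_zero, zero_add, vec3_zero] at h3
      have h4 := h3.1
      rw [add_comm] at h4
      exact add_left_cancel h4
    have h3 : ∀ c : K, fieldAut K _ g.1 c = c := by
      intro c
      have e1 := h2 ![1, 0] ![1, 0]
      have e2 := h2 ![c, 0] ![1, 0]
      simp only [Matrix.cons_val_zero, Matrix.cons_val_one, one_mul, zero_mul, add_zero, mul_one,
        map_one] at e1 e2
      rw [e2, ← e1, mul_one]
    refine MonoidHom.mem_ker.2 (GammaL.ext_iff.2 fun u => funext fun i => ?_)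
    have e1 := h2 ![1, 0] u
    have e2 := h2 ![0, 1] u
    rw [h3] at e1 e2
    fin_cases i
    · simpa using e1.symm
    · simpa using e2.symm

/-- The base points of the projective plane. -/
noncomputable def planePoint (K : Type*) [Field K] : ℙ K (Fin 3 → K) :=
  Projectivization.mk K (vec3 1 0) fun h => one_ne_zero (congrFun h 0)

/-- The action of the vector stabilizer on the projective plane. -/
noncomputable def planeHom (K : Type*) [Field K] : vecStab K →* Equiv.Perm (ℙ K (Fin 3 → K)) :=
  (projHom K (Fin 3 → K)).comp (vecStab K).subtype

theorem planeHom_injective : Function.Injective (planeHom K) := by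
  rw [injective_iff_map_eq_one]
  intro g hg
  obtain ⟨c, hc⟩ := (projHom_eq_one_iff exists_ne_smul_pi).1 hg
  have h0 : g.1.1 (vec3 1 0) = vec3 1 0 := g.2
  have h1 : vec3 (1 : K) 0 = c • vec3 1 0 := h0.symm.trans (hc (vec3 1 0))
  have h2 := congrFun h1 0
  simp only [vec3_zero, Pi.smul_apply, smul_eq_mul, mul_one] at h2
  exact Subtype.ext (GammaL.ext_iff.2 fun v => by
    refine (hc v).trans ?_
    rw [← h2, one_smul]
    rfl)

theorem homothety_exists {n : Type*} [Fintype n] [DecidableEq n] {c : K} (hc : c ≠ 0) :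
    ∃ A : GL n K, ∀ v, (glGamma n K A).1 v = c • v := by
  refine ⟨Units.map (Matrix.scalar n).toMonoidHom (Units.mk0 c hc), fun v => ?_⟩
  rw [glGamma_apply]
  simp [Matrix.scalar_apply]

theorem exists_homothety_mul {n : Type*} [Fintype n] [DecidableEq n] {c : K} (hc : c ≠ 0)
    (g : GammaL K (n → K)) : ∃ g' : GammaL K (n → K), ∀ v, g'.1 v = c • g.1 v := by
  obtain ⟨A, hA⟩ := homothety_exists (n := n) hc
  exact ⟨glGamma n K A * g, fun v => hA _⟩

/-- A semilinear map fixing the line of the first basis vector can be rescaled to fix that vector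
itself. With `planeHom_injective`, the point stabilizer is thereby identified with the vector
stabilizer, so no quotient by scalars is needed. -/
theorem range_planeHom : (planeHom K).range = pointStab (PGammaL3 K) (planePoint K) := by
  ext p
  constructor
  · rintro ⟨g, rfl⟩
    refine ⟨?_, ?_⟩
    · have : planeHom K g ∈ PGammaL K (Fin 3 → K) := range_projHom (K := K) (V := Fin 3 → K) ▸ ⟨g.1, rfl⟩
      exact this
    · have h0 : g.1.1 (vec3 1 0) = vec3 1 0 := g.2
      exact (projHom_mk_eq_iff g.1 _ _).2 ⟨1, by rw [one_smul, h0]⟩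
  · rintro ⟨hp, hp'⟩
    have hp1 : p ∈ (projHom K (Fin 3 → K)).range := range_projHom (K := K) (V := Fin 3 → K) ▸ hp
    obtain ⟨g, rfl⟩ := hp1
    obtain ⟨a, ha⟩ := (projHom_mk_eq_iff g _ _).1 hp'
    have ha0 : a ≠ 0 := by
      rintro rfl
      rw [zero_smul] at ha
      have hne : vec3 (1 : K) 0 ≠ 0 := fun h => one_ne_zero (congrFun h 0)
      exact GammaL.map_ne_zero g hne ha.symm
    obtain ⟨g', hg'⟩ := exists_homothety_mul (inv_ne_zero ha0) g
    refine ⟨⟨g', ?_⟩, ?_⟩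
    · change g'.1 _ = _
      rw [hg', ← ha, smul_smul, inv_mul_cancel₀ ha0, one_smul]
    · change projHom K _ g' = _
      refine Equiv.ext fun x => ?_
      induction x using Projectivization.ind with
      | _ v hv =>
        rw [projHom_mk, projHom_mk, Projectivization.mk_eq_mk_iff']
        exact ⟨a⁻¹, (hg' v).symm⟩

end Plane

end BoundaryTree

/-! ### Stabilizers of two points of the projective plane -/

namespace BoundaryTree

section PlaneStabilizer

variable {K : Type*} [Field K]

theorem projHom_eq_of_smul {V : Type*} [AddCommGroup V] [Module K V] {g h : GammaL K V} {c : K}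
    (H : ∀ v, g.1 v = c • h.1 v) : projHom K V g = projHom K V h := by
  refine Equiv.ext fun x => ?_
  induction x using Projectivization.ind with
  | _ v hv =>
    rw [projHom_mk, projHom_mk, Projectivization.mk_eq_mk_iff']
    exact ⟨c, (H v).symm⟩

/-- The second base point of the projective plane. -/
noncomputable def planePoint' (K : Type*) [Field K] : ℙ K (Fin 3 → K) :=
  Projectivization.mk K (vec3 0 ![1, 0]) fun h => one_ne_zero (congrFun h 1)

/-- The base point of the projective line. -/
noncomputable def linePoint (K : Type*) [Field K] : ℙ K (Fin 2 → K) :=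
  Projectivization.mk K ![1, 0] fun h => one_ne_zero (congrFun h 0)

theorem planePoint_ne : planePoint K ≠ planePoint' K := by
  intro h
  obtain ⟨a, ha⟩ := (Projectivization.mk_eq_mk_iff' K _ _ _ _).1 h
  have := congrFun ha 0
  simp at this

/-- The semilinear Borel subgroup. -/
noncomputable def semilinearBorel (K : Type*) [Field K] : Subgroup (GammaL K (Fin 2 → K)) :=
  (MulAction.stabilizer (Equiv.Perm (ℙ K (Fin 2 → K))) (linePoint K)).comap (projHom K _)

/-- The linear Borel subgroup. -/
noncomputable def linearBorel (K : Type*) [Field K] : Subgroup (GammaL K (Fin 2 → K)) :=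
  (fieldAut K (Fin 2 → K)).ker ⊓ semilinearBorel K

theorem mem_semilinearBorel {h : GammaL K (Fin 2 → K)} :
    h ∈ semilinearBorel K ↔ ∃ a : K, a • ![1, 0] = h.1 ![1, 0] :=
  projHom_mk_eq_iff h _ _

theorem exists_of_mem_linearBorel {h : GammaL K (Fin 2 → K)} (hh : h ∈ linearBorel K) :
    ∃ x y z : K, x ≠ 0 ∧ z ≠ 0 ∧ ∀ u, h.1 u = ![x * u 0 + y * u 1, z * u 1] := by
  obtain ⟨h1, h2⟩ := hh
  obtain ⟨x, hx⟩ := mem_semilinearBorel.1 h2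
  have hform : ∀ u, h.1 u = ![x * u 0 + h.1 ![0, 1] 0 * u 1, h.1 ![0, 1] 1 * u 1] := by
    intro u
    have e : u = u 0 • ![1, 0] + u 1 • ![0, 1] := by
      ext i
      fin_cases i <;> simp
    conv_lhs => rw [e]
    rw [GammaL.map_add, map_smul_fieldAut, map_smul_fieldAut, MonoidHom.mem_ker.1 h1, ← hx]
    ext i
    fin_cases i <;> simp [mul_comm]
  have hx0 : x ≠ 0 := by
    rintro rfl
    rw [zero_smul] at hx
    exact GammaL.map_ne_zero h (v := ![1, 0]) (fun e => one_ne_zero (congrFun e 0)) hx.symm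
  refine ⟨x, _, _, hx0, fun hz => ?_, hform⟩
  refine GammaL.map_ne_zero h (v := ![-(x⁻¹ * h.1 ![0, 1] 0), 1])
    (fun e => one_ne_zero (congrFun e 1)) ?_
  rw [hform]
  ext i
  fin_cases i
  · simp [hx0]
  · simp [hz]

/-- The linear maps fixing the first basis vector and the line of the second one. -/
noncomputable def triangular (b c d f : K) (hb : b ≠ 0) (hc : c ≠ 0) : vecStab K :=
  ⟨glGamma (Fin 3) K (Matrix.GeneralLinearGroup.mkOfDetNeZero !![1, 0, d; 0, b, f; 0, 0, c]
    (by simp [Matrix.det_fin_three, hb, hc])), by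
    change (_ : Fin 3 → K) = _
    ext i
    fin_cases i <;>
      simp [glGamma_apply, Matrix.GeneralLinearGroup.mkOfDetNeZero, vec3, Matrix.mulVec,
        dotProduct, Fin.sum_univ_three]⟩

theorem triangular_apply (b c d f : K) (hb : b ≠ 0) (hc : c ≠ 0) (v : Fin 3 → K) :
    (triangular b c d f hb hc).1.1 v = ![v 0 + d * v 2, b * v 1 + f * v 2, c * v 2] := by
  ext i
  fin_cases i <;>
    simp [triangular, glGamma_apply, Matrix.GeneralLinearGroup.mkOfDetNeZero, Matrix.mulVec,
      dotProduct, Fin.sum_univ_three]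

/-- The linear map exchanging the first two basis vectors. -/
noncomputable def swapMap (K : Type*) [Field K] : GammaL K (Fin 3 → K) :=
  glGamma (Fin 3) K (Matrix.GeneralLinearGroup.mkOfDetNeZero !![0, 1, 0; 1, 0, 0; 0, 0, 1]
    (by simp [Matrix.det_fin_three]))

theorem swapMap_apply (v : Fin 3 → K) : (swapMap K).1 v = ![v 1, v 0, v 2] := by
  ext i
  fin_cases i <;>
    simp [swapMap, glGamma_apply, Matrix.GeneralLinearGroup.mkOfDetNeZero, Matrix.mulVec,
      dotProduct, Fin.sum_univ_three]

theorem projHom_swapMap_planePoint :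
    projHom K _ (swapMap K) (planePoint K) = planePoint' K := by
  refine (projHom_mk_eq_iff _ _ _).2 ⟨1, ?_⟩
  rw [swapMap_apply, one_smul]
  rfl

theorem projHom_swapMap_planePoint' :
    projHom K _ (swapMap K) (planePoint' K) = planePoint K := by
  refine (projHom_mk_eq_iff _ _ _).2 ⟨1, ?_⟩
  rw [swapMap_apply, one_smul]
  rfl

/-- The linear maps fixing the first basis vector and the line of the second are `!![1, 0, d; 0, b,
f; 0, 0, c]`. Up to scalars they induce `!![b, f; 0, c]` and `!![1, d; 0, c]` on the two quotients,
and these can be prescribed independently. For semilinear maps the two field automorphisms would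
have to agree, which is why only the linear Borel enters. -/
theorem exists_vecStab_two_point {h h' : GammaL K (Fin 2 → K)} (hh : h ∈ linearBorel K)
    (hh' : h' ∈ linearBorel K) :
    ∃ g g' : vecStab K, planeHom K g (planePoint' K) = planePoint' K ∧
      projHom K _ (swapMap K) * planeHom K g' = planeHom K g * projHom K _ (swapMap K) ∧
      (∃ c : K, ∀ u, (quotHom K g).1 u = c • h.1 u) ∧
      ∃ c : K, ∀ u, (quotHom K g').1 u = c • h'.1 u := by
  obtain ⟨x, y, z, hx, hz, H⟩ := exists_of_mem_linearBorel hh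
  obtain ⟨x', y', z', hx', hz', H'⟩ := exists_of_mem_linearBorel hh'
  have hc : z' / x' ≠ 0 := div_ne_zero hz' hx'
  have hb : z' / x' / z * x ≠ 0 := mul_ne_zero (div_ne_zero hc hz) hx
  -- The parameters solve `1 : d : c = x' : y' : z'` and `b : f : c = x : y : z`.
  set c := z' / x' with hcdef
  set b := c / z * x with hbdef
  set f := c / z * y with hfdef
  set d := y' / x' with hddef
  -- The second matrix is the first with its two leading basis vectors exchanged, divided by `b` so
  -- that it fixes the first basis vector again.
  refine ⟨triangular b c d f hb hc,
    triangular b⁻¹ (c / b) (f / b) (d / b) (inv_ne_zero hb) (div_ne_zero hc hb), ?_, ?_, ?_, ?_⟩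
  · refine (projHom_mk_eq_iff _ _ _).2 ⟨b, ?_⟩
    refine Eq.trans ?_ (triangular_apply b c d f hb hc (vec3 0 ![1, 0])).symm
    ext i
    fin_cases i <;> simp [vec3]
  · have : projHom K _ (swapMap K *
        (triangular b⁻¹ (c / b) (f / b) (d / b) (inv_ne_zero hb) (div_ne_zero hc hb)).1) =
        projHom K _ ((triangular b c d f hb hc).1 * swapMap K) := by
      refine projHom_eq_of_smul (c := b⁻¹) fun v => ?_
      rw [GammaL.coe_mul_apply, GammaL.coe_mul_apply, swapMap_apply, triangular_apply,
        swapMap_apply, triangular_apply]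
      ext i
      fin_cases i
      · simp
        field_simp
      · simp
        field_simp
      · simp
        field_simp
    rw [map_mul, map_mul] at this
    exact this
  · refine ⟨c / z, fun u => ?_⟩
    rw [quotHom_apply, triangular_apply, H]
    ext i
    fin_cases i
    · simp [tail3, vec3, hbdef, hfdef]
      ring
    · simp [tail3, vec3]
      field_simp
  · refine ⟨b⁻¹ / x', fun u => ?_⟩
    rw [quotHom_apply, triangular_apply, H']
    ext i
    fin_cases i
    · simp [tail3, vec3, hddef]
      field_simp
    · simp [tail3, vec3, hcdef]
      field_simp

theorem quotHom_mem_semilinearBorel {g : vecStab K}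
    (hg : planeHom K g (planePoint' K) = planePoint' K) : quotHom K g ∈ semilinearBorel K := by
  obtain ⟨a, ha⟩ := (projHom_mk_eq_iff g.1 _ _).1 hg
  refine mem_semilinearBorel.2 ⟨a, ?_⟩
  rw [quotHom_apply, ← ha, tail3_smul, tail3_vec3]

theorem planeHom_sectHom_planePoint' {h : GammaL K (Fin 2 → K)} (hh : h ∈ semilinearBorel K) :
    planeHom K (sectHom K h) (planePoint' K) = planePoint' K := by
  obtain ⟨a, ha⟩ := mem_semilinearBorel.1 hh
  refine (projHom_mk_eq_iff (sectHom K h).1 _ _).2 ⟨a, ?_⟩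
  rw [sectHom_apply, ← ha, ← vec3_smul, map_zero, mul_zero]

end PlaneStabilizer

/-- A field `K` together with a homomorphism from `ΓL₂(K)` onto `S` whose kernel consists of
the scalars. -/
structure PlaneDatum (S : Type) [Group S] where
  /-- the field -/
  K : Type
  [field : Field K]
  /-- the homomorphism -/
  D : GammaL K (Fin 2 → K) →* S
  surjective : Function.Surjective D
  eq_one_iff : ∀ h, D h = 1 ↔ ∃ c : K, ∀ u, h.1 u = c • u

attribute [instance] PlaneDatum.field

/-! ### The cocycle of a plane datum -/

namespace PlaneDatum

variable {S : Type} [Group S] (X : PlaneDatum S)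

theorem D_eq_of_smul {h h' : GammaL X.K (Fin 2 → X.K)} {c : X.K} (H : ∀ u, h.1 u = c • h'.1 u) :
    X.D h = X.D h' := by
  rw [← mul_inv_eq_one, ← map_inv, ← map_mul, X.eq_one_iff]
  refine ⟨c, fun u => ?_⟩
  rw [GammaL.coe_mul_apply, H, GammaL.apply_inv_apply]

theorem isSolvable_ker_D : Group.IsSolvable X.D.ker := by
  refine Group.isSolvable_of_comm fun g h => ?_
  obtain ⟨c, hc⟩ := (X.eq_one_iff g.1).1 g.2
  obtain ⟨d, hd⟩ := (X.eq_one_iff h.1).1 h.2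
  refine Subtype.ext (GammaL.ext_iff.2 fun u => ?_)
  change g.1.1 (h.1.1 u) = h.1.1 (g.1.1 u)
  rw [hc, hd, hc, hd, smul_comm]

/-- The action on the lines through the base point. -/
def quot : vecStab X.K →* S := X.D.comp (quotHom X.K)

theorem quot_surjective : Function.Surjective X.quot := fun s => by
  obtain ⟨h, rfl⟩ := X.surjective s
  exact ⟨sectHom X.K h, congrArg X.D (quotHom_sectHom h)⟩

theorem isSolvable_ker_quot : Group.IsSolvable X.quot.ker := by
  have h1 : Group.IsSolvable (quotHom X.K).ker :=
    Group.isSolvable_of_comm fun g h => Subtype.ext (ker_quotHom_comm g.2 h.2)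
  exact isSolvable_comap (quotHom X.K) h1 X.D.ker X.isSolvable_ker_D

/-- The vector stabilizer splits as the shears by the image of `sectHom`. Preimages under `quot`
contain the shears, so they inherit the splitting. -/
theorem isInternalSemidirect {Y : Type*} [Group Y] {f : vecStab X.K →* Y}
    (hf : Function.Injective f) (H : Subgroup S) :
    IsInternalSemidirect ((H.comap X.quot).map f) ((quotHom X.K).ker.map f)
      (((H.comap X.D).map (sectHom X.K)).map f) where
  sup_eq := by
    rw [← Subgroup.map_sup]
    congr 1
    refine le_antisymm (sup_le ?_ ?_) fun g hg => ?_
    · intro g hg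
      rw [Subgroup.mem_comap, quot, MonoidHom.comp_apply, MonoidHom.mem_ker.1 hg, map_one]
      exact one_mem H
    · rintro _ ⟨h, hh, rfl⟩
      rw [Subgroup.mem_comap, quot, MonoidHom.comp_apply, quotHom_sectHom]
      exact hh
    · rw [← mul_inv_cancel_right g (sectHom X.K (quotHom X.K g)), mul_assoc]
      have h1 : g * (sectHom X.K (quotHom X.K g))⁻¹ ∈ (quotHom X.K).ker := by
        rw [MonoidHom.mem_ker, map_mul, map_inv, quotHom_sectHom, mul_inv_cancel]
      have h2 : sectHom X.K (quotHom X.K g) ∈ (H.comap X.D).map (sectHom X.K) :=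
        ⟨_, hg, rfl⟩
      have := Subgroup.mul_mem_sup h1 h2
      simpa [mul_assoc] using this
  inf_eq := by
    rw [← Subgroup.map_inf _ _ _ hf, Subgroup.map_eq_bot_iff_of_injective _ hf, eq_bot_iff]
    rintro _ ⟨h1, h, hh, rfl⟩
    have h2 : quotHom X.K (sectHom X.K h) = 1 := h1
    rw [quotHom_sectHom] at h2
    rw [h2, map_one]
    exact one_mem _
  normalizes := by
    rintro _ ⟨a, ha, rfl⟩ _ ⟨w, hw, rfl⟩
    refine ⟨a * w * a⁻¹, ?_, by simp⟩
    exact (MonoidHom.normal_ker (quotHom X.K)).conj_mem w hw a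

theorem nonempty_complement_equiv {Y : Type*} [Group Y] {f : vecStab X.K →* Y}
    (hf : Function.Injective f) (H : Subgroup S) :
    Nonempty (((H.comap X.D).map (sectHom X.K)).map f ≃* H.comap X.D) := by
  have h1 : Function.Injective (sectHom X.K) := fun g h hgh => by
    rw [← quotHom_sectHom g, hgh, quotHom_sectHom]
  exact ⟨(((H.comap X.D).equivMapOfInjective _ h1).trans
    (Subgroup.equivMapOfInjective _ f hf)).symm⟩

/-- The points of the projective plane. -/
abbrev Ω : Type := ℙ X.K (Fin 3 → X.K)

open Classical in
/-- The action of the stabilizer of the base point on the lines through it. -/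
noncomputable def π (p : Equiv.Perm X.Ω) : S :=
  if h : ∃ g, planeHom X.K g = p then X.quot h.choose else 1

theorem π_planeHom (g : vecStab X.K) : X.π (planeHom X.K g) = X.quot g := by
  have h : ∃ g', planeHom X.K g' = planeHom X.K g := ⟨g, rfl⟩
  rw [π, dif_pos h, planeHom_injective h.choose_spec]

theorem exists_planeHom_eq {p : Equiv.Perm X.Ω} (hp : p ∈ PGammaL3 X.K)
    (h : p (planePoint X.K) = planePoint X.K) : ∃ g, planeHom X.K g = p := by
  have : p ∈ pointStab (PGammaL3 X.K) (planePoint X.K) := ⟨hp, h⟩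
  rwa [← range_planeHom] at this

theorem planeHom_mem (g : vecStab X.K) : planeHom X.K g ∈ PGammaL3 X.K ∧
    planeHom X.K g (planePoint X.K) = planePoint X.K := by
  have : planeHom X.K g ∈ pointStab (PGammaL3 X.K) (planePoint X.K) := by
    rw [← range_planeHom]
    exact ⟨g, rfl⟩
  exact this

theorem π_mul {p q : Equiv.Perm X.Ω} (hp : p ∈ PGammaL3 X.K)
    (hp' : p (planePoint X.K) = planePoint X.K) (hq : q ∈ PGammaL3 X.K)
    (hq' : q (planePoint X.K) = planePoint X.K) : X.π (p * q) = X.π p * X.π q := by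
  obtain ⟨g, rfl⟩ := X.exists_planeHom_eq hp hp'
  obtain ⟨h, rfl⟩ := X.exists_planeHom_eq hq hq'
  rw [← map_mul, π_planeHom, π_planeHom, π_planeHom, map_mul]

theorem exists_two_transitive {a b c d : X.Ω} (hab : a ≠ b) (hcd : c ≠ d) :
    ∃ f ∈ PGammaL3 X.K, f a = c ∧ f b = d := by
  obtain ⟨e, h1, h2⟩ := exists_projHom_two_transitive hab hcd
  refine ⟨_, ?_, h1, h2⟩
  have : projHom X.K (Fin 3 → X.K) (linGamma _ _ e) ∈ PGammaL X.K (Fin 3 → X.K) := by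
    rw [← range_projHom]
    exact ⟨_, rfl⟩
  exact this

theorem exists_ne_point (a : X.Ω) : ∃ b, a ≠ b := by
  by_cases h : a = planePoint X.K
  · exact ⟨planePoint' X.K, h ▸ planePoint_ne⟩
  · exact ⟨_, h⟩

theorem exists_transport (a : X.Ω) : ∃ f ∈ PGammaL3 X.K, f (planePoint X.K) = a := by
  obtain ⟨b, hb⟩ := X.exists_ne_point a
  obtain ⟨f, hf, h, _⟩ := X.exists_two_transitive planePoint_ne hb
  exact ⟨f, hf, h⟩

/-- A collineation mapping the base point to `a`. -/
noncomputable def transport (a : X.Ω) : Equiv.Perm X.Ω := (X.exists_transport a).choose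

theorem transport_mem (a : X.Ω) : X.transport a ∈ PGammaL3 X.K :=
  (X.exists_transport a).choose_spec.1

theorem transport_apply (a : X.Ω) : X.transport a (planePoint X.K) = a :=
  (X.exists_transport a).choose_spec.2

theorem transport_inv_apply (a : X.Ω) : (X.transport a)⁻¹ a = planePoint X.K := by
  rw [Equiv.Perm.inv_eq_iff_eq, transport_apply]

/-- The cocycle describing the action of a collineation on the lines through a point. -/
noncomputable def cocycle (f : Equiv.Perm X.Ω) (a : X.Ω) : S :=
  X.π ((X.transport (f a))⁻¹ * f * X.transport a)

theorem cocycle_aux {f : Equiv.Perm X.Ω} (hf : f ∈ PGammaL3 X.K) {a b : X.Ω} (h : f a = b) :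
    (X.transport b)⁻¹ * f * X.transport a ∈ PGammaL3 X.K ∧
      ((X.transport b)⁻¹ * f * X.transport a) (planePoint X.K) = planePoint X.K := by
  refine ⟨mul_mem (mul_mem (inv_mem (X.transport_mem b)) hf) (X.transport_mem a), ?_⟩
  rw [Equiv.Perm.mul_apply, Equiv.Perm.mul_apply, transport_apply, h, transport_inv_apply]

theorem cocycle_mul {f g : Equiv.Perm X.Ω} (hf : f ∈ PGammaL3 X.K) (hg : g ∈ PGammaL3 X.K)
    (a : X.Ω) : X.cocycle (f * g) a = X.cocycle f (g a) * X.cocycle g a := by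
  have h1 := X.cocycle_aux hf (a := g a) rfl
  have h2 := X.cocycle_aux hg (a := a) rfl
  rw [cocycle, cocycle, cocycle, ← X.π_mul h1.1 h1.2 h2.1 h2.2, Equiv.Perm.mul_apply]
  congr 1
  group

theorem cocycle_one (a : X.Ω) : X.cocycle 1 a = 1 := by
  have := X.cocycle_mul (one_mem _) (one_mem _) a
  simpa using this

theorem cocycle_inv {f : Equiv.Perm X.Ω} (hf : f ∈ PGammaL3 X.K) (a : X.Ω) :
    X.cocycle f⁻¹ (f a) = (X.cocycle f a)⁻¹ := by
  have := X.cocycle_mul (inv_mem hf) hf a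
  rw [inv_mul_cancel, cocycle_one] at this
  exact eq_inv_of_mul_eq_one_left this.symm

/-- The embedding of the vector stabilizer as the stabilizer of the point `a`. -/
noncomputable def pointHom (a : X.Ω) : vecStab X.K →* Equiv.Perm X.Ω :=
  (MulAut.conj (X.transport a)).toMonoidHom.comp (planeHom X.K)

theorem pointHom_apply (a : X.Ω) (g : vecStab X.K) :
    X.pointHom a g = X.transport a * planeHom X.K g * (X.transport a)⁻¹ := rfl

theorem pointHom_injective (a : X.Ω) : Function.Injective (X.pointHom a) :=
  (MulAut.conj (X.transport a)).injective.comp planeHom_injective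

theorem pointHom_fix (a : X.Ω) (g : vecStab X.K) : X.pointHom a g a = a := by
  rw [pointHom_apply, Equiv.Perm.mul_apply, Equiv.Perm.mul_apply, transport_inv_apply,
    (X.planeHom_mem g).2, transport_apply]

theorem pointHom_mem (a : X.Ω) (g : vecStab X.K) : X.pointHom a g ∈ PGammaL3 X.K :=
  mul_mem (mul_mem (X.transport_mem a) (X.planeHom_mem g).1) (inv_mem (X.transport_mem a))

theorem exists_pointHom_eq {a : X.Ω} {p : Equiv.Perm X.Ω} (hp : p ∈ PGammaL3 X.K) (h : p a = a) :
    ∃ g, X.pointHom a g = p := by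
  obtain ⟨g, hg⟩ := X.exists_planeHom_eq (X.cocycle_aux hp h).1 (X.cocycle_aux hp h).2
  refine ⟨g, ?_⟩
  rw [pointHom_apply, hg]
  group

theorem cocycle_pointHom (a : X.Ω) (g : vecStab X.K) : X.cocycle (X.pointHom a g) a = X.quot g := by
  rw [cocycle, pointHom_fix, pointHom_apply, ← π_planeHom]
  congr 1
  group

theorem exists_cocycle_eq (a b : X.Ω) (s : S) :
    ∃ f ∈ PGammaL3 X.K, f a = b ∧ X.cocycle f a = s := by
  obtain ⟨b', hb⟩ := X.exists_ne_point b
  obtain ⟨a', ha⟩ := X.exists_ne_point a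
  obtain ⟨f, hf, hfa, _⟩ := X.exists_two_transitive ha hb
  obtain ⟨g, hg⟩ := X.quot_surjective ((X.cocycle f a)⁻¹ * s)
  refine ⟨f * X.pointHom a g, mul_mem hf (X.pointHom_mem a g), ?_, ?_⟩
  · rw [Equiv.Perm.mul_apply, pointHom_fix, hfa]
  · rw [X.cocycle_mul hf (X.pointHom_mem a g), pointHom_fix, cocycle_pointHom, hg,
      mul_inv_cancel_left]

/-- The image of the linear Borel subgroup. -/
noncomputable def B : Subgroup S := (linearBorel X.K).map X.D

/-- The image of the semilinear Borel subgroup. -/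
noncomputable def Bs : Subgroup S := (semilinearBorel X.K).map X.D

/-- The chosen collineation from the base point to itself need not be the identity, which accounts
for the conjugation here and for the second factor in `frame`. -/
theorem cocycle_planeHom (g : vecStab X.K) :
    X.cocycle (planeHom X.K g) (planePoint X.K) =
      (X.cocycle (X.transport (planePoint X.K)) (planePoint X.K))⁻¹ * X.quot g *
        X.cocycle (X.transport (planePoint X.K)) (planePoint X.K) := by
  have h1 := X.transport_mem (planePoint X.K)
  have h2 := X.transport_apply (planePoint X.K)
  have h3 := X.cocycle_inv h1 (planePoint X.K)
  rw [h2] at h3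
  have h4 : planeHom X.K g = (X.transport (planePoint X.K))⁻¹ * X.pointHom (planePoint X.K) g *
      X.transport (planePoint X.K) := by
    rw [pointHom_apply]
    group
  rw [h4, X.cocycle_mul (mul_mem (inv_mem h1) (X.pointHom_mem _ g)) h1, h2,
    X.cocycle_mul (inv_mem h1) (X.pointHom_mem _ g), pointHom_fix, h3, cocycle_pointHom]

theorem cocycle_conj {q f : Equiv.Perm X.Ω} (hq : q ∈ PGammaL3 X.K) (hf : f ∈ PGammaL3 X.K)
    {a : X.Ω} (ha : f a = a) :
    X.cocycle (q * f * q⁻¹) (q a) = X.cocycle q a * X.cocycle f a * (X.cocycle q a)⁻¹ := by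
  rw [X.cocycle_mul (mul_mem hq hf) (inv_mem hq), X.cocycle_inv hq,
    Equiv.Perm.inv_eq_iff_eq.2 rfl, X.cocycle_mul hq hf, ha]

theorem projHom_swapMap_mem : projHom X.K _ (swapMap X.K) ∈ PGammaL3 X.K := by
  have : projHom X.K _ (swapMap X.K) ∈ PGammaL X.K (Fin 3 → X.K) := by
    rw [← range_projHom]
    exact ⟨_, rfl⟩
  exact this

/-- The identification of the lines through `q ω` with those through the base point `ω`. -/
noncomputable def frame (q : Equiv.Perm X.Ω) : S :=
  X.cocycle q (planePoint X.K) * (X.cocycle (X.transport (planePoint X.K)) (planePoint X.K))⁻¹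

theorem conj_planeHom {q : Equiv.Perm X.Ω} (hq : q ∈ PGammaL3 X.K) (g : vecStab X.K) :
    q * planeHom X.K g * q⁻¹ ∈ PGammaL3 X.K ∧
      (q * planeHom X.K g * q⁻¹) (q (planePoint X.K)) = q (planePoint X.K) ∧
      X.cocycle (q * planeHom X.K g * q⁻¹) (q (planePoint X.K)) =
        X.frame q * X.quot g * (X.frame q)⁻¹ := by
  refine ⟨mul_mem (mul_mem hq (X.planeHom_mem g).1) (inv_mem hq), ?_, ?_⟩
  · rw [Equiv.Perm.mul_apply, Equiv.Perm.inv_eq_iff_eq.2 rfl, Equiv.Perm.mul_apply,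
      (X.planeHom_mem g).2]
  · rw [X.cocycle_conj hq (X.planeHom_mem g).1 (X.planeHom_mem g).2, cocycle_planeHom, frame]
    group

theorem exists_cocycle_two_point {q : Equiv.Perm X.Ω} (hq : q ∈ PGammaL3 X.K) {α β : S}
    (hα : α ∈ X.B) (hβ : β ∈ X.B) : ∃ f ∈ PGammaL3 X.K, f (q (planePoint X.K)) = q (planePoint X.K) ∧
      f (q (planePoint' X.K)) = q (planePoint' X.K) ∧
      X.cocycle f (q (planePoint X.K)) = X.frame q * α * (X.frame q)⁻¹ ∧
      X.cocycle f (q (planePoint' X.K)) = X.frame (q * projHom X.K _ (swapMap X.K)) * β *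
        (X.frame (q * projHom X.K _ (swapMap X.K)))⁻¹ := by
  obtain ⟨h, hh, rfl⟩ := hα
  obtain ⟨h', hh', rfl⟩ := hβ
  obtain ⟨g, g', hg, hgg, ⟨c, hc⟩, c', hc'⟩ := exists_vecStab_two_point hh hh'
  obtain ⟨h1, h2, h3⟩ := X.conj_planeHom hq g
  have h4 := X.conj_planeHom (mul_mem hq X.projHom_swapMap_mem) g'
  have h5 : q * planeHom X.K g * q⁻¹ = q * projHom X.K _ (swapMap X.K) * planeHom X.K g' *
      (q * projHom X.K _ (swapMap X.K))⁻¹ := by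
    rw [mul_assoc q _ (planeHom X.K g'), hgg]
    group
  rw [← h5, Equiv.Perm.mul_apply q, projHom_swapMap_planePoint] at h4
  refine ⟨_, h1, h2, h4.2.1, ?_, ?_⟩
  · rw [h3, ← X.D_eq_of_smul hc]
    rfl
  · rw [h4.2.2, ← X.D_eq_of_smul hc']
    rfl

/-- With a cocycle prescribed at only one of the two points there is no field automorphism to
reconcile, so the whole semilinear Borel occurs, in contrast with `exists_cocycle_two_point`. -/
theorem exists_cocycle_eq_iff {q : Equiv.Perm X.Ω} (hq : q ∈ PGammaL3 X.K) {s : S} :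
    (∃ f ∈ PGammaL3 X.K, f (q (planePoint X.K)) = q (planePoint X.K) ∧
      f (q (planePoint' X.K)) = q (planePoint' X.K) ∧ X.cocycle f (q (planePoint X.K)) = s) ↔
      ∃ α ∈ X.Bs, s = X.frame q * α * (X.frame q)⁻¹ := by
  constructor
  · rintro ⟨f, hf, h1, h2, rfl⟩
    have e1 : (q⁻¹ * f * q) (planePoint X.K) = planePoint X.K := by
      rw [Equiv.Perm.mul_apply, Equiv.Perm.mul_apply, h1, Equiv.Perm.inv_eq_iff_eq]
    have e2 : (q⁻¹ * f * q) (planePoint' X.K) = planePoint' X.K := by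
      rw [Equiv.Perm.mul_apply, Equiv.Perm.mul_apply, h2, Equiv.Perm.inv_eq_iff_eq]
    obtain ⟨g, hg⟩ := X.exists_planeHom_eq (mul_mem (mul_mem (inv_mem hq) hf) hq) e1
    obtain rfl : f = q * planeHom X.K g * q⁻¹ := by
      rw [hg]
      group
    rw [← hg] at e2
    exact ⟨X.quot g, ⟨_, quotHom_mem_semilinearBorel e2, rfl⟩, (X.conj_planeHom hq g).2.2⟩
  · rintro ⟨_, ⟨h, hh, rfl⟩, rfl⟩
    have H := X.conj_planeHom hq (sectHom X.K h)
    refine ⟨_, H.1, H.2.1, ?_, ?_⟩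
    · rw [Equiv.Perm.mul_apply, Equiv.Perm.inv_eq_iff_eq.2 rfl, Equiv.Perm.mul_apply,
        planeHom_sectHom_planePoint' hh]
    · rw [H.2.2, quot, MonoidHom.comp_apply, quotHom_sectHom]

/-- The conjugators `x a b` and `x b a` must come from the same collineation, since both points are
treated simultaneously. A well-ordering decides which of the two ordered pairs supplies it; the
other uses its product with the swap. -/
theorem exists_two_point : ∃ x : X.Ω → X.Ω → S, ∀ a b, a ≠ b →
    (∀ α ∈ X.B, ∀ β ∈ X.B, ∃ f ∈ PGammaL3 X.K, f a = a ∧ f b = b ∧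
      X.cocycle f a = x a b * α * (x a b)⁻¹ ∧ X.cocycle f b = x b a * β * (x b a)⁻¹) ∧
    ∀ s, (∃ f ∈ PGammaL3 X.K, f a = a ∧ f b = b ∧ X.cocycle f a = s) ↔
      ∃ α ∈ X.Bs, s = x a b * α * (x a b)⁻¹ := by
  classical
  have hq : ∀ a b : X.Ω, ∃ q ∈ PGammaL3 X.K,
      a ≠ b → q (planePoint X.K) = a ∧ q (planePoint' X.K) = b := fun a b => by
    by_cases h : a = b
    · exact ⟨1, one_mem _, fun h' => absurd h h'⟩
    · obtain ⟨q, hq, h1⟩ := X.exists_two_transitive planePoint_ne h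
      exact ⟨q, hq, fun _ => h1⟩
  choose q hq hqa using hq
  set r := projHom X.K _ (swapMap X.K) with hr
  have hr0 : r (planePoint X.K) = planePoint' X.K := projHom_swapMap_planePoint
  have hr1 : r (planePoint' X.K) = planePoint X.K := projHom_swapMap_planePoint'
  have hqr : ∀ a b, a ≠ b → (q a b * r) (planePoint X.K) = b ∧
      (q a b * r) (planePoint' X.K) = a := fun a b hab => by
    rw [Equiv.Perm.mul_apply, Equiv.Perm.mul_apply, hr0, hr1]
    exact (hqa a b hab).symm
  refine ⟨fun a b => if WellOrderingRel a b then X.frame (q a b) else X.frame (q b a * r),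
    fun a b hab => ?_⟩
  have hba := Ne.symm hab
  rcases trichotomous_of WellOrderingRel a b with h | h | h
  · have h' : ¬ WellOrderingRel b a := asymm_of _ h
    simp only [if_pos h, if_neg h']
    constructor
    · intro α hα β hβ
      have := X.exists_cocycle_two_point (hq a b) hα hβ
      rwa [(hqa a b hab).1, (hqa a b hab).2] at this
    · intro s
      have := X.exists_cocycle_eq_iff (hq a b) (s := s)
      rwa [(hqa a b hab).1, (hqa a b hab).2] at this
  · exact absurd h hab
  · have h' : ¬ WellOrderingRel a b := asymm_of _ h
    simp only [if_pos h, if_neg h']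
    constructor
    · intro α hα β hβ
      have := X.exists_cocycle_two_point (hq b a) hβ hα
      rw [(hqa b a hba).1, (hqa b a hba).2] at this
      obtain ⟨f, hf, h1, h2, h3, h4⟩ := this
      exact ⟨f, hf, h2, h1, h4, h3⟩
    · intro s
      have := X.exists_cocycle_eq_iff (mul_mem (hq b a) X.projHom_swapMap_mem) (s := s)
      rwa [(hqr b a hba).1, (hqr b a hba).2] at this

end PlaneDatum

end BoundaryTree

/-! ### Gluing two plane data along the edges of a tree -/

namespace BoundaryTree

/-- Two plane data with the same group `S`, in general enough position for the resulting group
of tree automorphisms to be boundary-2-transitive. -/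
structure Gluing (S : Type) [Group S] where
  /-- the plane data -/
  X : Fin 2 → PlaneDatum S
  -- The free middle element `x` makes the factorization hold for arbitrary conjugates of the two
  -- Borel images, as required because the frames at the two ends of an edge are unrelated.
  factor : ∀ t t', t ≠ t' → ∀ x y, ∃ a ∈ (X t).B, ∃ b ∈ (X t').B, a * x * b = y
  isSolvable_Bs : ∀ t, Group.IsSolvable (X t).Bs
  not_isSolvable : ¬ Group.IsSolvable S
  eq_bot : ∀ N : Subgroup S, N.Normal → Group.IsSolvable N → N = ⊥

section Marking

-- The marking takes a type `t` and a proof of `ty v = t`, so that two vertices of equal type share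
-- one coordinate plane without casts.
variable {S : Type} [Group S] {V : Type*} {T : SimpleGraph V} {ty : V → Fin 2}
  {X : Fin 2 → PlaneDatum S} (κ : ∀ t v, ty v = t → ((X t).Ω ≃ T.neighborSet v))

/-- The coordinates of a bijection between two sets of neighbours with respect to a marking. -/
def coord {t : Fin 2} {v v' : V} (h : ty v = t) (h' : ty v' = t)
    (φ : T.neighborSet v ≃ T.neighborSet v') : Equiv.Perm (X t).Ω :=
  ((κ t v h).trans φ).trans (κ t v' h').symm

/-- The bijection between two sets of neighbours with given coordinates. -/
def ofCoord {t : Fin 2} {v v' : V} (h : ty v = t) (h' : ty v' = t)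
    (f : Equiv.Perm (X t).Ω) : T.neighborSet v ≃ T.neighborSet v' :=
  ((κ t v h).symm.trans f).trans (κ t v' h')

theorem coord_ofCoord {t : Fin 2} {v v' : V} (h : ty v = t) (h' : ty v' = t)
    (f : Equiv.Perm (X t).Ω) : coord κ h h' (ofCoord κ h h' f) = f := by
  ext a
  simp [coord, ofCoord]

theorem ofCoord_coord {t : Fin 2} {v v' : V} (h : ty v = t) (h' : ty v' = t)
    (φ : T.neighborSet v ≃ T.neighborSet v') : ofCoord κ h h' (coord κ h h' φ) = φ := by
  ext a
  simp [coord, ofCoord]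

theorem coord_apply_eq_iff {t : Fin 2} {v v' : V} (h : ty v = t) (h' : ty v' = t)
    (φ : T.neighborSet v ≃ T.neighborSet v') {w : T.neighborSet v} {w' : T.neighborSet v'} :
    coord κ h h' φ ((κ t v h).symm w) = (κ t v' h').symm w' ↔ φ w = w' := by
  simp [coord]

theorem coord_mul {t : Fin 2} {v v' v'' : V} (h : ty v = t) (h' : ty v' = t) (h'' : ty v'' = t)
    (φ : T.neighborSet v ≃ T.neighborSet v') (ψ : T.neighborSet v' ≃ T.neighborSet v'') :
    coord κ h h'' (φ.trans ψ) = coord κ h' h'' ψ * coord κ h h' φ := by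
  ext a
  simp [coord]

theorem coord_symm {t : Fin 2} {v v' : V} (h : ty v = t) (h' : ty v' = t)
    (φ : T.neighborSet v ≃ T.neighborSet v') : coord κ h' h φ.symm = (coord κ h h' φ)⁻¹ := rfl

theorem coord_refl {t : Fin 2} {v : V} (h : ty v = t) :
    coord κ h h (Equiv.refl (T.neighborSet v)) = 1 := by
  ext a
  simp [coord]

/-- The admissible bijections between sets of neighbours. -/
def admissible (v v' : V) : Set (T.neighborSet v ≃ T.neighborSet v') :=
  {φ | ∃ (t : Fin 2) (h : ty v = t) (h' : ty v' = t), coord κ h h' φ ∈ PGammaL3 (X t).K}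

theorem mem_admissible {t : Fin 2} {v v' : V} (h : ty v = t) (h' : ty v' = t)
    {φ : T.neighborSet v ≃ T.neighborSet v'} :
    φ ∈ admissible κ v v' ↔ coord κ h h' φ ∈ PGammaL3 (X t).K := by
  subst h
  refine ⟨?_, fun H => ⟨_, rfl, h', H⟩⟩
  rintro ⟨_, rfl, _, H⟩
  exact H

theorem ofCoord_mem {t : Fin 2} {v v' : V} (h : ty v = t) (h' : ty v' = t)
    {f : Equiv.Perm (X t).Ω} (hf : f ∈ PGammaL3 (X t).K) :
    ofCoord κ h h' f ∈ admissible κ v v' := by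
  rw [mem_admissible κ h h', coord_ofCoord]
  exact hf

/-- The cocycle on admissible bijections. -/
noncomputable def edgeCocycle {v v' : V} (φ : T.neighborSet v ≃ T.neighborSet v')
    (w : T.neighborSet v) : S :=
  -- Admissible bijections only join vertices of equal type, so the value `1` in the other case
  -- plays no role.
  if h : ty v' = ty v then (X (ty v)).cocycle (coord κ rfl h φ) ((κ _ v rfl).symm w) else 1

theorem edgeCocycle_eq {t : Fin 2} {v v' : V} (h : ty v = t) (h' : ty v' = t)
    (φ : T.neighborSet v ≃ T.neighborSet v') (w : T.neighborSet v) :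
    edgeCocycle κ φ w = (X t).cocycle (coord κ h h' φ) ((κ t v h).symm w) := by
  subst h
  rw [edgeCocycle, dif_pos h']

/-- The local system of a marking. -/
noncomputable def markingSystem (hty : ∀ v w, T.Adj v w → ty v ≠ ty w) : LocalSystem T S where
  L := admissible κ
  θ := edgeCocycle κ
  refl_mem v := by
    rw [mem_admissible κ rfl rfl, coord_refl]
    exact one_mem _
  symm_mem := by
    rintro v v' φ ⟨t, h, h', H⟩
    rw [mem_admissible κ h' h, coord_symm]
    exact inv_mem H
  trans_mem := by
    rintro v v' v'' φ ψ ⟨t, h, h', H⟩ ⟨_, rfl, h'', H'⟩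
    obtain rfl : ty v' = t := h'
    rw [mem_admissible κ h h'', coord_mul κ h rfl h'']
    exact mul_mem H' H
  θ_trans := by
    rintro v v' v'' φ ψ ⟨t, h, h', H⟩ ⟨_, rfl, h'', H'⟩ w
    obtain rfl : ty v' = t := h'
    rw [edgeCocycle_eq κ h h'', edgeCocycle_eq κ rfl h'', edgeCocycle_eq κ h rfl,
      coord_mul κ h rfl h'', PlaneDatum.cocycle_mul _ H' H,
      (coord_apply_eq_iff κ h rfl φ).2 rfl]
  extend := by
    rintro v v' φ ⟨t, h, h', H⟩ w
    have h1 := hty _ _ w.2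
    have h2 := hty _ _ (φ w).2
    have hs : ty (φ w) = ty w := by
      rw [h] at h1
      rw [h'] at h2
      clear H
      revert h1 h2
      generalize ty (φ w : V) = a, ty (w : V) = b
      clear h h'
      revert t a b
      decide
    -- The vertices `w` and `φ w` have equal type because there are only two types. A collineation
    -- with prescribed cocycle then exists because the point stabilizer maps onto `S`.
    obtain ⟨f, hf, hfa, hfs⟩ := (X (ty w)).exists_cocycle_eq ((κ _ _ rfl).symm ⟨v, w.2.symm⟩)
      ((κ _ _ hs).symm ⟨v', (φ w).2.symm⟩) (edgeCocycle κ φ w)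
    refine ⟨ofCoord κ rfl hs f, ofCoord_mem κ rfl hs hf, ?_, ?_⟩
    · have := (coord_apply_eq_iff κ rfl hs (ofCoord κ rfl hs f) (w := ⟨v, w.2.symm⟩)
        (w' := ⟨v', (φ w).2.symm⟩)).1 (by rw [coord_ofCoord]; exact hfa)
      rw [this]
    · rw [edgeCocycle_eq κ rfl hs, coord_ofCoord, hfs]

end Marking

namespace Gluing

variable {S : Type} [Group S] (Γ : Gluing S) {V : Type*} {T : SimpleGraph V} {ty : V → Fin 2}
  (κ : ∀ t v, ty v = t → ((Γ.X t).Ω ≃ T.neighborSet v))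
  (hty : ∀ v w, T.Adj v w → ty v ≠ ty w)

/-- The group of tree automorphisms defined by a gluing. -/
noncomputable abbrev group : Subgroup (T ≃g T) := (markingSystem κ hty).univGroup

/-- The groups `E` are conjugates of linear Borel images, which can be realized at both neighbours
at once and factorize `S` across an edge. The last clause records the larger semilinear Borel
images, which bound the action of path stabilizers and determine `Λ`. -/
theorem exists_factorizes : ∃ (x : ∀ v, T.neighborSet v → T.neighborSet v → S)
    (E : ∀ v, T.neighborSet v → T.neighborSet v → Subgroup S),
    (markingSystem κ hty).Factorizes ty E ∧ ∀ v w u, w ≠ u → ∀ s,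
      (∃ φ ∈ (markingSystem κ hty).L v v, φ w = w ∧ φ u = u ∧ (markingSystem κ hty).θ φ w = s) ↔
        ∃ α ∈ (Γ.X (ty v)).Bs, s = x v w u * α * (x v w u)⁻¹ := by
  choose x hx using fun t => (Γ.X t).exists_two_point
  let y : ∀ v, T.neighborSet v → T.neighborSet v → S := fun v w u =>
    x (ty v) ((κ _ v rfl).symm w) ((κ _ v rfl).symm u)
  have hne : ∀ {v} {w u : T.neighborSet v}, w ≠ u →
      (κ _ v rfl).symm w ≠ (κ _ v rfl).symm u := fun h h' => h ((κ _ _ rfl).symm.injective h')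
  refine ⟨y, fun v w u => (Γ.X (ty v)).B.map (MulAut.conj (y v w u)).toMonoidHom, ⟨?_, ?_, ?_⟩, ?_⟩
  · intro v v' htt w u w' u' hwu hwu'
    obtain ⟨f, hf, h1, h2⟩ := (Γ.X (ty v)).exists_two_transitive
      (a := (κ _ v rfl).symm w) (b := (κ _ v rfl).symm u)
      (c := (κ _ v' htt.symm).symm w') (d := (κ _ v' htt.symm).symm u')
      (hne hwu) (fun h => hwu' ((κ _ _ _).symm.injective h))
    refine ⟨ofCoord κ rfl htt.symm f, ofCoord_mem κ rfl htt.symm hf, ?_, ?_⟩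
    · rw [← coord_apply_eq_iff κ rfl htt.symm, coord_ofCoord, h1]
    · rw [← coord_apply_eq_iff κ rfl htt.symm, coord_ofCoord, h2]
  · rintro v w u hwu _ ⟨α, hα, rfl⟩ _ ⟨β, hβ, rfl⟩
    obtain ⟨f, hf, h1, h2, h3, h4⟩ := (hx (ty v) _ _ (hne hwu)).1 α hα β hβ
    refine ⟨ofCoord κ rfl rfl f, ofCoord_mem κ rfl rfl hf, ?_, ?_, ?_, ?_⟩
    · rw [← coord_apply_eq_iff κ rfl rfl, coord_ofCoord, h1]
    · rw [← coord_apply_eq_iff κ rfl rfl, coord_ofCoord, h2]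
    · refine (edgeCocycle_eq κ rfl rfl _ _).trans ?_
      rw [coord_ofCoord]
      exact h3
    · refine (edgeCocycle_eq κ rfl rfl _ _).trans ?_
      rw [coord_ofCoord]
      exact h4
  · intro v w u p hwu hpv s
    obtain ⟨a, ha, b, hb, hab⟩ := Γ.factor (ty v) (ty w) (hty _ _ w.2)
      ((y v w u)⁻¹ * y w ⟨v, w.2.symm⟩ p) ((y v w u)⁻¹ * s * y w ⟨v, w.2.symm⟩ p)
    refine ⟨_, ⟨a, ha, rfl⟩, _, ⟨b, hb, rfl⟩, ?_⟩
    change y v w u * a * (y v w u)⁻¹ * (y w ⟨v, w.2.symm⟩ p * b * (y w ⟨v, w.2.symm⟩ p)⁻¹) = s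
    have : y v w u * (a * ((y v w u)⁻¹ * y w ⟨v, w.2.symm⟩ p) * b) * (y w ⟨v, w.2.symm⟩ p)⁻¹ = s := by
      rw [hab]
      group
    rw [← this]
    group
  · intro v w u hwu s
    refine Iff.trans ?_ ((hx (ty v) _ _ (hne hwu)).2 s)
    constructor
    · rintro ⟨φ, hφ, h1, h2, h3⟩
      refine ⟨coord κ rfl rfl φ, (mem_admissible κ rfl rfl).1 hφ,
        (coord_apply_eq_iff κ rfl rfl φ).2 h1, (coord_apply_eq_iff κ rfl rfl φ).2 h2, ?_⟩
      exact (edgeCocycle_eq κ rfl rfl φ w).symm.trans h3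
    · rintro ⟨f, hf, h1, h2, h3⟩
      refine ⟨ofCoord κ rfl rfl f, ofCoord_mem κ rfl rfl hf, ?_, ?_, ?_⟩
      · rw [← coord_apply_eq_iff κ rfl rfl, coord_ofCoord, h1]
      · rw [← coord_apply_eq_iff κ rfl rfl, coord_ofCoord, h2]
      · refine (edgeCocycle_eq κ rfl rfl _ _).trans ?_
        rw [coord_ofCoord]
        exact h3

/-- The vector stabilizer as the stabilizer of a neighbour in the local action. -/
noncomputable def arcHom {v : V} (w : T.neighborSet v) :
    vecStab (Γ.X (ty v)).K →* Equiv.Perm (T.neighborSet v) :=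
  (κ _ v rfl).permCongrHom.toMonoidHom.comp ((Γ.X (ty v)).pointHom ((κ _ v rfl).symm w))

theorem arcHom_injective {v : V} (w : T.neighborSet v) : Function.Injective (Γ.arcHom κ w) :=
  (κ _ v rfl).permCongrHom.injective.comp (PlaneDatum.pointHom_injective _ _)

theorem coord_arcHom {v : V} (w : T.neighborSet v) (g : vecStab (Γ.X (ty v)).K) :
    coord κ rfl rfl (Γ.arcHom κ w g) = (Γ.X (ty v)).pointHom ((κ _ v rfl).symm w) g := by
  refine Equiv.ext fun a => ?_
  simp [coord, arcHom]

theorem arcHom_mem {v : V} (w : T.neighborSet v) (g : vecStab (Γ.X (ty v)).K) :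
    Γ.arcHom κ w g ∈ (markingSystem κ hty).L v v ∧ Γ.arcHom κ w g w = w ∧
      (markingSystem κ hty).θ (Γ.arcHom κ w g) w = (Γ.X (ty v)).quot g := by
  refine ⟨(mem_admissible κ rfl rfl).2 ?_, (coord_apply_eq_iff κ rfl rfl _).1 ?_,
    (edgeCocycle_eq κ rfl rfl _ _).trans ?_⟩
  · rw [coord_arcHom]
    exact PlaneDatum.pointHom_mem _ _ _
  · rw [coord_arcHom, PlaneDatum.pointHom_fix]
  · rw [coord_arcHom, PlaneDatum.cocycle_pointHom]

theorem exists_arcHom_eq {v : V} {w : T.neighborSet v} {p : Equiv.Perm (T.neighborSet v)}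
    (hp : p ∈ (markingSystem κ hty).L v v) (hw : p w = w) : ∃ g, Γ.arcHom κ w g = p := by
  obtain ⟨g, hg⟩ := (Γ.X (ty v)).exists_pointHom_eq ((mem_admissible κ rfl rfl).1 hp)
    ((coord_apply_eq_iff κ rfl rfl p).2 hw)
  refine ⟨g, ?_⟩
  rw [← ofCoord_coord κ rfl rfl (Γ.arcHom κ w g), coord_arcHom, hg, ofCoord_coord]

theorem mem_map_arcHom {v : V} {w : T.neighborSet v} {p : Equiv.Perm (T.neighborSet v)}
    {H : Subgroup S} : p ∈ (H.comap (Γ.X (ty v)).quot).map (Γ.arcHom κ w) ↔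
      p ∈ (markingSystem κ hty).L v v ∧ p w = w ∧ (markingSystem κ hty).θ p w ∈ H := by
  constructor
  · rintro ⟨g, hg, rfl⟩
    obtain ⟨h1, h2, h3⟩ := Γ.arcHom_mem κ hty w g
    exact ⟨h1, h2, h3 ▸ hg⟩
  · rintro ⟨h1, h2, h3⟩
    obtain ⟨g, rfl⟩ := Γ.exists_arcHom_eq κ hty h1 h2
    refine ⟨g, ?_, rfl⟩
    rw [(Γ.arcHom_mem κ hty w g).2.2] at h3
    exact h3

theorem range_arcHom (hT : T.IsTree) {x y : V} (h : T.Adj y x) :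
    (Γ.arcHom κ ⟨x, h⟩).range = localPointStab (Γ.group κ hty) h := by
  ext p
  rw [localPointStab, pointStab, Subgroup.mem_inf, LocalSystem.mem_localAction_univGroup _ hT,
    MulAction.mem_stabilizer_iff]
  constructor
  · rintro ⟨g, rfl⟩
    exact ⟨(Γ.arcHom_mem κ hty _ g).1, (Γ.arcHom_mem κ hty _ g).2.1⟩
  · rintro ⟨h1, h2⟩
    exact Γ.exists_arcHom_eq κ hty h1 h2

/-- The point stabilizer in the local action is isomorphic to the vector stabilizer. -/
noncomputable def arcEquiv (hT : T.IsTree) {x y : V} (h : T.Adj y x) :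
    vecStab (Γ.X (ty y)).K ≃* localPointStab (Γ.group κ hty) h :=
  ((Γ.arcHom κ ⟨x, h⟩).ofInjective (Γ.arcHom_injective κ _)).trans
    (MulEquiv.subgroupCongr (Γ.range_arcHom κ hty hT h))

theorem subtype_comp_arcEquiv (hT : T.IsTree) {x y : V} (h : T.Adj y x) :
    (localPointStab (Γ.group κ hty) h).subtype.comp (Γ.arcEquiv κ hty hT h).toMonoidHom =
      Γ.arcHom κ ⟨x, h⟩ := rfl

theorem not_isSolvable_localPointStab (hT : T.IsTree) {x y : V} (h : T.Adj y x) :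
    ¬ Group.IsSolvable (localPointStab (Γ.group κ hty) h) := fun _ =>
  Γ.not_isSolvable (Group.isSolvable_of_surjective
    (f := (Γ.X (ty y)).quot.comp (Γ.arcEquiv κ hty hT h).symm.toMonoidHom)
    ((Γ.X (ty y)).quot_surjective.comp (Γ.arcEquiv κ hty hT h).symm.surjective))

theorem map_socle (hT : T.IsTree) {x y : V} (h : T.Adj y x) :
    (socle (localPointStab (Γ.group κ hty) h)).map (localPointStab (Γ.group κ hty) h).subtype =
      (quotHom (Γ.X (ty y)).K).ker.map (Γ.arcHom κ ⟨x, h⟩) := by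
  rw [← socle_map_equiv (Γ.arcEquiv κ hty hT h), Subgroup.map_map, subtype_comp_arcEquiv,
    socle_vecStab]

/-- The kernel of the map onto `S` is soluble, being built from shears and scalars, while `S` has no
nontrivial soluble normal subgroup. -/
theorem map_solubleRadical (hT : T.IsTree) {x y : V} (h : T.Adj y x) :
    (solubleRadical (localPointStab (Γ.group κ hty) h)).map
      (localPointStab (Γ.group κ hty) h).subtype =
      ((⊥ : Subgroup S).comap (Γ.X (ty y)).quot).map (Γ.arcHom κ ⟨x, h⟩) := by
  set e := Γ.arcEquiv κ hty hT h
  have h1 : ((Γ.X (ty y)).quot.comp e.symm.toMonoidHom).ker =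
      (Γ.X (ty y)).quot.ker.map e.toMonoidHom := by
    rw [← MonoidHom.comap_ker]
    exact (Subgroup.map_equiv_eq_comap_symm e _).symm
  have h2 : Group.IsSolvable ((Γ.X (ty y)).quot.ker.map e.toMonoidHom) := by
    have := (Γ.X (ty y)).isSolvable_ker_quot
    exact Group.isSolvable_of_surjective
      (f := e.toMonoidHom.subgroupMap (Γ.X (ty y)).quot.ker)
      (MonoidHom.subgroupMap_surjective _ _)
  rw [solubleRadical_eq_ker ((Γ.X (ty y)).quot.comp e.symm.toMonoidHom)
    ((Γ.X (ty y)).quot_surjective.comp e.symm.surjective) (h1 ▸ h2) Γ.eq_bot, h1,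
    Subgroup.map_map, subtype_comp_arcEquiv]
  rfl

theorem theta_eq (hT : T.IsTree) {x y : V} (h : T.Adj y x) :
    Theta (Γ.group κ hty) x y =
      ((⊥ : Subgroup S).comap (Γ.X (ty y)).quot).map (Γ.arcHom κ ⟨x, h⟩) := by
  ext p
  rw [LocalSystem.mem_Theta_univGroup _ hT h, Γ.mem_map_arcHom κ hty, Subgroup.mem_bot]

/-- The constraint comes from the next vertex: its local action fixes both the origin and the third
vertex of the ray, so the cocycle on the first edge lies in a semilinear Borel image of the other
type. -/
theorem lambda_eq (hT : T.IsTree) (ρ : Ray T) : ∃ x : S, Lambda (Γ.group κ hty) ρ =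
    (((Γ.X (ty (ρ.vert 1))).Bs.map (MulAut.conj x).toMonoidHom).comap
      (Γ.X (ty (ρ.vert 0))).quot).map (Γ.arcHom κ ⟨ρ.vert 1, ρ.adj 0⟩) := by
  obtain ⟨x, E, hE, hx⟩ := Γ.exists_factorizes κ hty
  refine ⟨x (ρ.vert 1) ⟨ρ.vert 0, (ρ.adj 0).symm⟩ ⟨ρ.vert 2, ρ.adj 1⟩, ?_⟩
  ext p
  rw [hE.mem_Lambda hT, Γ.mem_map_arcHom κ hty, hx]
  · refine and_congr_right fun _ => and_congr_right fun _ => ?_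
    rw [Subgroup.mem_map]
    exact exists_congr fun α => and_congr_right fun _ => eq_comm
  · intro h
    have := ρ.injective (congrArg Subtype.val h)
    omega

theorem isBoundary2Transitive (hT : T.IsTree) : IsBoundary2Transitive (Γ.group κ hty) := by
  obtain ⟨x, E, hE, hx⟩ := Γ.exists_factorizes κ hty
  exact hE.isBoundary2Transitive hT hty

theorem isSolvable_map_arcHom {v : V} (w : T.neighborSet v) {H : Subgroup S}
    (hH : Group.IsSolvable H) :
    Group.IsSolvable ((H.comap (Γ.X (ty v)).quot).map (Γ.arcHom κ w)) := by
  have := isSolvable_comap _ (Γ.X (ty v)).isSolvable_ker_quot H hH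
  exact Group.isSolvable_of_surjective (MonoidHom.subgroupMap_surjective (Γ.arcHom κ w) _)

theorem isSolvable_conj_Bs (t : Fin 2) (x : S) :
    Group.IsSolvable ((Γ.X t).Bs.map (MulAut.conj x).toMonoidHom) := by
  have := Γ.isSolvable_Bs t
  exact Group.isSolvable_of_surjective
    (MonoidHom.subgroupMap_surjective (MulAut.conj x).toMonoidHom (Γ.X t).Bs)

theorem isSolvable_Lambda (hT : T.IsTree) (ρ : Ray T) : Group.IsSolvable (Lambda (Γ.group κ hty) ρ) := by
  obtain ⟨x, hx⟩ := Γ.lambda_eq κ hty hT ρ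
  rw [hx]
  exact Γ.isSolvable_map_arcHom κ _ (Γ.isSolvable_conj_Bs _ x)

theorem exists_complement (hT : T.IsTree) (ρ : Ray T) : ∃ (x : S)
    (A : Subgroup (Equiv.Perm (T.neighborSet (ρ.vert 0)))),
    IsInternalSemidirect (Lambda (Γ.group κ hty) ρ)
      ((socle (localPointStab (Γ.group κ hty) (ρ.adj 0))).map
        (localPointStab (Γ.group κ hty) (ρ.adj 0)).subtype) A ∧
      Nonempty (A ≃* ((Γ.X (ty (ρ.vert 1))).Bs.map (MulAut.conj x).toMonoidHom).comap
        (Γ.X (ty (ρ.vert 0))).D) := by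
  obtain ⟨x, hx⟩ := Γ.lambda_eq κ hty hT ρ
  rw [hx, Γ.map_socle κ hty hT]
  exact ⟨x, _, (Γ.X _).isInternalSemidirect (Γ.arcHom_injective κ _) _,
    (Γ.X _).nonempty_complement_equiv (Γ.arcHom_injective κ _) _⟩

/-- At the middle vertex two neighbours are fixed, so the local action lies over a Borel image.
Further out, an element that already fixes all neighbours of the parent has trivial cocycle on the
edge to the parent, so its local action lies in `Theta`. Both groups are soluble. -/
theorem isProsoluble_fixer (hT : T.IsTree) (hfin : ∀ v, (T.neighborSet v).Finite) {x y z : V} (hxy : T.Adj x y)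
    (hyz : T.Adj y z) (hxz : x ≠ z) : IsProsoluble (fixer (Γ.group κ hty) {x, y, z}) := by
  classical
  obtain ⟨c, E, hE, hc⟩ := Γ.exists_factorizes κ hty
  set Λ := markingSystem κ hty
  let c0 := c y ⟨x, hxy.symm⟩ ⟨z, hyz⟩
  let P0 := (((Γ.X (ty y)).Bs.map (MulAut.conj c0).toMonoidHom).comap (Γ.X (ty y)).quot).map
    (Γ.arcHom κ ⟨x, hxy.symm⟩)
  let P : ∀ v, Subgroup (Equiv.Perm (T.neighborSet v)) := fun v =>
    if h : v = y then h ▸ P0 else Theta (Γ.group κ hty) (parent hT y v) v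
  have hPy : P y = P0 := dif_pos rfl
  have hfix : ∀ g ∈ fixer (Γ.group κ hty) {x, y, z}, g ∈ Γ.group κ hty ∧ g x = x ∧ g y = y ∧
      g z = z := fun g hg => by
    have := mem_fixer.1 hg
    exact ⟨this.1, this.2 _ (by simp), this.2 _ (by simp), this.2 _ (by simp)⟩
  refine isProsoluble_of_local hT hfin _
    (isClosed_fixer (Λ.isClosed_univGroup hfin) _) y
    (fun g hg => (hfix g hg).2.2.1) P (fun v => ?_) (fun g hg h => ?_)
    fun v hvy g hg hw h hp => ?_
  · by_cases hv : v = y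
    · subst hv
      rw [hPy]
      exact Γ.isSolvable_map_arcHom κ _ (Γ.isSolvable_conj_Bs _ _)
    · rw [show P v = _ from dif_neg hv, Γ.theta_eq κ hty hT (adj_parent hT hv)]
      exact Γ.isSolvable_map_arcHom κ _ inferInstance
  · rw [hPy]
    obtain ⟨h1, h2, h3, h4⟩ := hfix g hg
    have h5 : loc g h ⟨x, hxy.symm⟩ = ⟨x, hxy.symm⟩ := Subtype.ext h2
    refine (Γ.mem_map_arcHom κ hty).2 ⟨Λ.loc_mem h1 h, h5, ?_⟩
    obtain ⟨α, hα, h6⟩ := (hc y ⟨x, hxy.symm⟩ ⟨z, hyz⟩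
      (fun e => hxz (congrArg Subtype.val e)) _).1
      ⟨loc g h, Λ.loc_mem h1 h, h5, Subtype.ext h4, rfl⟩
    exact ⟨α, hα, h6.symm⟩
  · rw [show P v = _ from dif_neg hvy,
      LocalSystem.mem_Theta_univGroup _ hT (adj_parent hT hvy)]
    have h1 := (hfix g hg).1
    refine ⟨Λ.loc_mem h1 h, Subtype.ext hp, ?_⟩
    rw [Λ.θ_loc h1 h hp (adj_parent hT hvy)]
    have h2 : loc g hp = Equiv.refl _ := Equiv.ext fun u => Subtype.ext (hw u u.2)
    rw [h2, Λ.θ_refl]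

theorem permIso_localAction (hT : T.IsTree) {t : Fin 2} {v : V} (hv : ty v = t) :
    PermIso (localAction (Γ.group κ hty) v) (PGammaL3 (Γ.X t).K) := by
  refine ⟨(κ t v hv).symm, ?_⟩
  ext f
  rw [Subgroup.mem_map]
  constructor
  · rintro ⟨p, hp, rfl⟩
    exact (mem_admissible κ hv hv).1 ((LocalSystem.mem_localAction_univGroup _ hT).1 hp)
  · intro hf
    refine ⟨ofCoord κ hv hv f,
      (LocalSystem.mem_localAction_univGroup _ hT).2 (ofCoord_mem κ hv hv hf), ?_⟩
    exact coord_ofCoord κ hv hv f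

end Gluing

end BoundaryTree

namespace BoundaryTree

/-! ## The exceptional action of `GL₂(5)` on five points -/

theorem ZMod.pow_four_eq_one {x : ZMod 5} (h : x ≠ 0) : x ^ 4 = 1 :=
  ZMod.pow_card_sub_one_eq_one h

/-- The exceptional action on five points of the matrix with rows `(a, b)` and `(c, d)`. -/
def quinticMap (a b c d k : ZMod 5) : ZMod 5 :=
  -- Cubes stand for inverses. Writing the Möbius map as `a/c - (Δ/c²) / (k + d/c)` with `Δ` the
  -- determinant, triangular matrices act affinely as usual and the inversion `-1/x` is replaced by
  -- `2 * x ^ 3`.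
  if c = 0 then (a * k + b) * d ^ 3
  else a * c ^ 3 + 2 * (a * d - b * c) * c ^ 6 * (k + d * c ^ 3) ^ 3

theorem quinticMap_zero (a b d k : ZMod 5) : quinticMap a b 0 d k = (a * k + b) * d ^ 3 :=
  if_pos rfl

theorem quinticMap_of_ne {c : ZMod 5} (hc : c ≠ 0) (a b d k : ZMod 5) : quinticMap a b c d k =
    a * c ^ 3 + 2 * (a * d - b * c) * c ^ 6 * (k + d * c ^ 3) ^ 3 :=
  if_neg hc

theorem quinticMap_smul {l : ZMod 5} (hl : l ≠ 0) (a b c d k : ZMod 5) :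
    quinticMap (l * a) (l * b) (l * c) (l * d) k = quinticMap a b c d k := by
  have h4 := ZMod.pow_four_eq_one hl
  by_cases hc : c = 0
  · subst hc
    rw [mul_zero, quinticMap_zero, quinticMap_zero]
    linear_combination (a * k + b) * d ^ 3 * h4
  · have h1 : l * d * (l * c) ^ 3 = d * c ^ 3 := by linear_combination d * c ^ 3 * h4
    rw [quinticMap_of_ne hc, quinticMap_of_ne (mul_ne_zero hl hc), h1]
    linear_combination (a * c ^ 3 + 2 * (a * d - b * c) * c ^ 6 * (k + d * c ^ 3) ^ 3 *
      (l ^ 4 + 1)) * h4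

theorem quinticMap_mul_aux : ∀ s Δ x : ZMod 5, s ≠ 0 → Δ ≠ 0 →
    3 * (s + 2 * Δ * x ^ 3) ^ 3 = s ^ 3 + 3 * Δ * s ^ 6 * (x - Δ * s ^ 3) ^ 3 := by
  decide

/-- The main case of multiplicativity: both lower left entries are `1` and the upper right entries
are expressed through the determinants. The lower left entry of the product is `a' + d`. If it
vanishes, `x ^ 5 = x` undoes the two cubes; otherwise the finite identity `quinticMap_mul_aux` is
needed. -/
theorem quinticMap_mul_of_one (a d Δ a' d' k : ZMod 5) {Δ' : ZMod 5} (hΔ' : Δ' ≠ 0) :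
    quinticMap (a * a' + (a * d - Δ)) (a * (a' * d' - Δ') + (a * d - Δ) * d') (a' + d)
      (a' * d' - Δ' + d * d') k =
      quinticMap a (a * d - Δ) 1 d (quinticMap a' (a' * d' - Δ') 1 d' k) := by
  have h1 : (1 : ZMod 5) ≠ 0 := one_ne_zero
  rw [quinticMap_of_ne h1, quinticMap_of_ne h1]
  simp only [one_pow, mul_one]
  by_cases hs : a' + d = 0
  · obtain rfl : d = -a' := by linear_combination hs
    have h5 : (5 : ZMod 5) = 0 := rfl
    have hx : (k + d') ^ 5 = k + d' := ZMod.pow_card _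
    rw [hs, quinticMap_zero]
    linear_combination a * ZMod.pow_four_eq_one hΔ' - Δ * Δ' ^ 3 * (k + d') * (3 * h5) - 16 * Δ * Δ' ^ 3 *
      ((k + d') ^ 4 + 1) * hx
  · have hs4 := ZMod.pow_four_eq_one hs
    have key := quinticMap_mul_aux _ _ (k + d') hs hΔ'
    have h5 : (5 : ZMod 5) = 0 := rfl
    have e : k + (a' * d' - Δ' + d * d') * (a' + d) ^ 3 = k + d' - Δ' * (a' + d) ^ 3 := by
      linear_combination d' * hs4
    rw [quinticMap_of_ne hs, e]
    generalize (k + d' - Δ' * (a' + d) ^ 3) ^ 3 = y at key ⊢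
    generalize (k + d') ^ 3 = z at key ⊢
    linear_combination a * hs4 + Δ * key +
      (Δ * Δ' * (a' + d) ^ 6 * y - Δ * (a' + d + 2 * Δ' * z) ^ 3) * h5

/-- Split by Bruhat cells: if one factor is triangular the claim is a computation modulo `x ^ 4 =
1`, and otherwise invariance under scalars reduces to lower left entries equal to `1`. -/
theorem quinticMap_mul {a b c d a' b' c' d' : ZMod 5} (hΔ : a * d - b * c ≠ 0)
    (hΔ' : a' * d' - b' * c' ≠ 0) (k : ZMod 5) :
    quinticMap (a * a' + b * c') (a * b' + b * d') (c * a' + d * c') (c * b' + d * d') k =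
      quinticMap a b c d (quinticMap a' b' c' d' k) := by
  by_cases hc : c = 0 <;> by_cases hc' : c' = 0
  · subst hc hc'
    have hd' : d' ≠ 0 := by
      rintro rfl
      simp at hΔ'
    rw [zero_mul, zero_mul, mul_zero, mul_zero, add_zero, add_zero, zero_add, quinticMap_zero,
      quinticMap_zero, quinticMap_zero]
    linear_combination b * d ^ 3 * ZMod.pow_four_eq_one hd'
  · subst hc
    have hd : d ≠ 0 := by
      rintro rfl
      simp at hΔ
    have hd4 := ZMod.pow_four_eq_one hd
    have hc4 := ZMod.pow_four_eq_one hc'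
    have e : d * d' * (d * c') ^ 3 = d' * c' ^ 3 := by linear_combination d' * c' ^ 3 * hd4
    rw [zero_mul, zero_mul, zero_add, zero_add, quinticMap_zero, quinticMap_of_ne hc',
      quinticMap_of_ne (mul_ne_zero hd hc'), e]
    linear_combination 2 * (a' * d' - b' * c') * c' ^ 6 * (k + d' * c' ^ 3) ^ 3 * a * d ^ 3 * hd4 +
      b * d ^ 3 * hc4
  · subst hc'
    have ha' : a' ≠ 0 := by
      rintro rfl
      simp at hΔ'
    have hd' : d' ≠ 0 := by
      rintro rfl
      simp at hΔ'
    have hd4 := ZMod.pow_four_eq_one hd'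
    have ha4 := ZMod.pow_four_eq_one ha'
    have hc4 := ZMod.pow_four_eq_one hc
    have e : (a' * k + b') * d' ^ 3 + d * c ^ 3 =
        a' * d' ^ 3 * (k + (c * b' + d * d') * (c * a') ^ 3) := by
      linear_combination -b' * d' ^ 3 * (a' ^ 4 * hc4 + ha4) - d * c ^ 3 * (d' ^ 4 * ha4 + hd4)
    rw [mul_zero, mul_zero, add_zero, add_zero, quinticMap_zero, quinticMap_of_ne hc,
      quinticMap_of_ne (mul_ne_zero hc ha'), e]
    generalize k + (c * b' + d * d') * (c * a') ^ 3 = x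
    linear_combination a * c ^ 3 * ha4 + 2 * (a * d - b * c) * c ^ 6 * x ^ 3 * a' ^ 3 * d' *
      (ha4 - (d' ^ 4 + 1) * hd4)
  · have e : ∀ {a b c d : ZMod 5}, c ≠ 0 → ∀ k, quinticMap a b c d k =
        quinticMap (a * c⁻¹) (a * c⁻¹ * (d * c⁻¹) - (a * d - b * c) * c⁻¹ ^ 2) 1 (d * c⁻¹) k :=
      fun {a b c d} h k => by
        rw [← quinticMap_smul h (a * c⁻¹) _ 1 (d * c⁻¹)]
        congr 1 <;> field_simp
        ring
    have hΔ2 : (a' * d' - b' * c') * c'⁻¹ ^ 2 ≠ 0 :=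
      mul_ne_zero hΔ' (pow_ne_zero _ (inv_ne_zero hc'))
    rw [e hc, e hc', ← quinticMap_mul_of_one _ _ _ _ _ _ hΔ2,
      ← quinticMap_smul (inv_ne_zero (mul_ne_zero hc hc'))]
    congr 1 <;> field_simp <;> ring

theorem exists_glGamma_eq {n K : Type*} [Fintype n] [DecidableEq n] [Nonempty n] [Field K]
    {g : GammaL K (n → K)} (hg : fieldAut K (n → K) g = 1) : ∃ A, glGamma n K A = g := by
  let e : (n → K) ≃ₗ[K] (n → K) :=
    { g.1 with
      map_add' := GammaL.map_add g
      map_smul' := fun a v => by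
        have := map_smul_fieldAut g a v
        rwa [hg] at this }
  refine ⟨Matrix.GeneralLinearGroup.toLin.symm
    ((LinearMap.GeneralLinearGroup.generalLinearEquiv K (n → K)).symm e), ?_⟩
  simp only [glGamma, MonoidHom.comp_apply, MulEquiv.toMonoidHom_eq_coe, MonoidHom.coe_coe,
    MulEquiv.apply_symm_apply]
  rfl

theorem glGamma_injective {n K : Type*} [Fintype n] [DecidableEq n] [Field K] :
    Function.Injective (glGamma n K) := fun A B h => by
  refine Units.ext (Matrix.ext_of_mulVec_single fun i => ?_)
  have := GammaL.ext_iff.1 h (Pi.single i 1)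
  rwa [glGamma_apply, glGamma_apply] at this

theorem quinticMap_one (k : ZMod 5) : quinticMap 1 0 0 1 k = k := by
  rw [quinticMap_zero]
  ring

theorem det_ne_zero {K : Type*} [Field K] (A : GL (Fin 2) K) :
    A.1 0 0 * A.1 1 1 - A.1 0 1 * A.1 1 0 ≠ 0 := by
  rw [← Matrix.det_fin_two]
  exact (Matrix.isUnits_det_units A).ne_zero

/-- The exceptional action of `GL₂(5)` on five points. -/
def quinticHom : GL (Fin 2) (ZMod 5) →* Equiv.Perm (ZMod 5) :=
  MonoidHom.toHomPerm
    { toFun := fun A k => quinticMap (A.1 0 0) (A.1 0 1) (A.1 1 0) (A.1 1 1) k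
      map_one' := funext fun k => quinticMap_one k
      map_mul' := fun A B => funext fun k => by
        refine Eq.trans ?_ (quinticMap_mul (det_ne_zero A) (det_ne_zero B) k)
        simp [Matrix.mul_apply, Fin.sum_univ_two] }

theorem quinticHom_apply (A : GL (Fin 2) (ZMod 5)) (k : ZMod 5) :
    quinticHom A k = quinticMap (A.1 0 0) (A.1 0 1) (A.1 1 0) (A.1 1 1) k := rfl

theorem quinticHom_eq_one_iff (A : GL (Fin 2) (ZMod 5)) :
    quinticHom A = 1 ↔ ∃ c : ZMod 5, ∀ u, A.1.mulVec u = c • u := by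
  constructor
  · intro h
    have h1 : ∀ k, quinticMap (A.1 0 0) (A.1 0 1) (A.1 1 0) (A.1 1 1) k = k :=
      Equiv.ext_iff.1 h
    have hc : A.1 1 0 = 0 := by
      -- Off the triangular matrices the map has the form `x + y * (k + z) ^ 3`, which is never the
      -- identity on five points.
      by_contra hc
      simp only [quinticMap_of_ne hc] at h1
      revert h1
      generalize A.1 0 0 * A.1 1 0 ^ 3 = x
      generalize 2 * (A.1 0 0 * A.1 1 1 - A.1 0 1 * A.1 1 0) * A.1 1 0 ^ 6 = y
      generalize A.1 1 1 * A.1 1 0 ^ 3 = z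
      revert x y z
      decide
    have hdet := det_ne_zero A
    rw [hc] at hdet h1
    simp only [quinticMap_zero] at h1
    have hd : A.1 1 1 ≠ 0 := by
      intro h
      simp [h] at hdet
    have hd4 := ZMod.pow_four_eq_one hd
    have hb : A.1 0 1 = 0 := by
      have := h1 0
      rw [mul_zero, zero_add] at this
      exact (mul_eq_zero.1 this).resolve_right (pow_ne_zero _ hd)
    have ha : A.1 0 0 = A.1 1 1 := by
      have := h1 1
      rw [hb] at this
      linear_combination A.1 1 1 * this - A.1 0 0 * hd4
    refine ⟨A.1 1 1, fun u => funext fun i => ?_⟩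
    fin_cases i <;> simp [Matrix.mulVec, dotProduct, Fin.sum_univ_two, hb, hc, ha]
  · rintro ⟨c, hc⟩
    have h0 : ∀ i, A.1 i 0 = c * (if i = 0 then 1 else 0) := fun i => by
      have := congrFun (hc ![1, 0]) i
      fin_cases i <;> simpa [Matrix.mulVec, dotProduct, Fin.sum_univ_two] using this
    have h1 : ∀ i, A.1 i 1 = c * (if i = 0 then 0 else 1) := fun i => by
      have := congrFun (hc ![0, 1]) i
      fin_cases i <;> simpa [Matrix.mulVec, dotProduct, Fin.sum_univ_two] using this
    have hc0 : c ≠ 0 := by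
      rintro rfl
      have := det_ne_zero A
      simp [h0, h1] at this
    refine Equiv.ext fun k => ?_
    rw [quinticHom_apply, h0, h0, h1, h1, quinticMap_smul hc0]
    exact quinticMap_one k

/-- A transitive permutation group on five points with a transposition is the symmetric group. -/
theorem eq_top_of_isSwap {H : Subgroup (Equiv.Perm (ZMod 5))}
    (h : ∀ i j, ∃ p ∈ H, p i = j) {g : Equiv.Perm (ZMod 5)} (hg : g ∈ H) (hs : g.IsSwap) :
    H = ⊤ := by
  have : MulAction.IsPretransitive H (ZMod 5) := ⟨fun i j => by
    obtain ⟨p, hp, hij⟩ := h i j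
    exact ⟨⟨p, hp⟩, hij⟩⟩
  refine Equiv.Perm.subgroup_eq_top_of_isPreprimitive_of_isSwap_mem
    (MulAction.IsPreprimitive.of_prime_card ?_) g hs hg
  rw [Nat.card_zmod]
  norm_num

/-- The upper triangular matrices. -/
noncomputable def upperMatrix {K : Type*} [Field K] (a b : K) {d : K} (ha : a ≠ 0) (hd : d ≠ 0) :
    GL (Fin 2) K :=
  Matrix.GeneralLinearGroup.mkOfDetNeZero !![a, b; 0, d] (by simp [ha, hd])

theorem quinticHom_upperMatrix {a d : ZMod 5} (b : ZMod 5) (ha : a ≠ 0) (hd : d ≠ 0)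
    (k : ZMod 5) : quinticHom (upperMatrix a b ha hd) k = (a * k + b) * d ^ 3 :=
  quinticMap_zero _ _ _ _

theorem quinticHom_surjective : Function.Surjective quinticHom := by
  rw [← MonoidHom.range_eq_top]
  refine eq_top_of_isSwap (g := Equiv.swap 2 3) (fun i j => ?_) ?_ ⟨2, 3, by decide, rfl⟩
  · refine ⟨_, ⟨upperMatrix 1 (j - i) one_ne_zero one_ne_zero, rfl⟩, ?_⟩
    rw [quinticHom_upperMatrix]
    ring
  -- This matrix acts as `k ↦ k ^ 3`, which exchanges `2` and `3` and fixes the other points.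
  · refine ⟨Matrix.GeneralLinearGroup.mkOfDetNeZero !![0, 2; 1, 0]
      (by rw [Matrix.det_fin_two_of]; decide), Equiv.ext fun k => ?_⟩
    change quinticMap 0 2 1 0 k = _
    revert k
    decide

end BoundaryTree

/-! ### The plane datum over the field with five elements -/

namespace BoundaryTree

/-- Over the field with five elements all semilinear maps are linear. -/
noncomputable def glGammaEquiv : GL (Fin 2) (ZMod 5) ≃* GammaL (ZMod 5) (Fin 2 → ZMod 5) :=
  MulEquiv.ofBijective (glGamma (Fin 2) (ZMod 5))
    ⟨glGamma_injective, fun _ => exists_glGamma_eq (Subsingleton.elim _ _)⟩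

/-- The plane datum of the exceptional action of `GL₂(5)` on five points. -/
noncomputable def quinticDatum : PlaneDatum (Equiv.Perm (ZMod 5)) where
  K := ZMod 5
  D := quinticHom.comp glGammaEquiv.symm.toMonoidHom
  surjective := quinticHom_surjective.comp glGammaEquiv.symm.surjective
  eq_one_iff h := by
    obtain ⟨A, rfl⟩ := glGammaEquiv.surjective h
    refine Iff.trans ?_ (quinticHom_eq_one_iff A)
    rw [MonoidHom.comp_apply]
    simp

theorem quinticDatum_D (A : GL (Fin 2) (ZMod 5)) :
    quinticDatum.D (glGamma (Fin 2) (ZMod 5) A) = quinticHom A := by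
  change quinticHom (glGammaEquiv.symm (glGammaEquiv A)) = _
  rw [MulEquiv.symm_apply_apply]

/-- The affine group of the line over the field with five elements. -/
def affineGroup : Subgroup (Equiv.Perm (ZMod 5)) where
  carrier := {p | ∃ m n, ∀ k, p k = m * k + n}
  one_mem' := ⟨1, 0, fun k => by simp⟩
  mul_mem' := by
    rintro p q ⟨m, n, h⟩ ⟨m', n', h'⟩
    refine ⟨m * m', m * n' + n, fun k => ?_⟩
    rw [Equiv.Perm.mul_apply, h', h]
    ring
  inv_mem' := by
    rintro p ⟨m, n, h⟩
    have hm : m ≠ 0 := by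
      rintro rfl
      have := p.injective ((h 0).trans ((by ring : 0 * 0 + n = 0 * 1 + n).trans (h 1).symm))
      exact zero_ne_one this
    refine ⟨m⁻¹, -(m⁻¹ * n), fun k => ?_⟩
    rw [Equiv.Perm.inv_eq_iff_eq, h]
    field_simp
    ring

theorem glGamma_mem_semilinearBorel {K : Type*} [Field K] {A : GL (Fin 2) K} :
    glGamma (Fin 2) K A ∈ semilinearBorel K ↔ A.1 1 0 = 0 := by
  rw [mem_semilinearBorel]
  constructor
  · rintro ⟨a, ha⟩
    have := congrFun ha 1
    rw [glGamma_apply] at this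
    simpa [Matrix.mulVec, dotProduct, Fin.sum_univ_two] using this.symm
  · intro h
    refine ⟨A.1 0 0, ?_⟩
    rw [glGamma_apply]
    ext i
    fin_cases i <;> simp [Matrix.mulVec, dotProduct, Fin.sum_univ_two, h]

/-- With `quinticDatum_Bs_le` this shows that the linear and the semilinear Borel image both equal
`AGL₁(5)`. -/
theorem affineGroup_le : affineGroup ≤ quinticDatum.B := by
  rintro p ⟨m, n, h⟩
  have hm : m ≠ 0 := by
    rintro rfl
    have := p.injective ((h 0).trans ((by ring : 0 * 0 + n = 0 * 1 + n).trans (h 1).symm))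
    exact zero_ne_one this
  refine ⟨glGamma (Fin 2) (ZMod 5) (upperMatrix m n hm one_ne_zero),
    ⟨fieldAut_glGamma _, glGamma_mem_semilinearBorel.2 rfl⟩, ?_⟩
  refine Equiv.ext fun k => ?_
  rw [quinticDatum_D, quinticHom_upperMatrix, h]
  ring

theorem quinticDatum_Bs_le : quinticDatum.Bs ≤ affineGroup := by
  rintro _ ⟨g, hg, rfl⟩
  obtain ⟨A, rfl⟩ := glGammaEquiv.surjective g
  have hA : A.1 1 0 = 0 := glGamma_mem_semilinearBorel.1 hg
  refine ⟨A.1 0 0 * A.1 1 1 ^ 3, A.1 0 1 * A.1 1 1 ^ 3, fun k => ?_⟩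
  refine (Equiv.congr_fun (quinticDatum_D A) k).trans ?_
  rw [quinticHom_apply, hA, quinticMap_zero]
  ring

theorem isSolvable_affineGroup : Group.IsSolvable affineGroup := by
  let f : affineGroup →* ZMod 5 :=
    { toFun := fun p => p.1 1 - p.1 0
      map_one' := by simp
      map_mul' := by
        rintro ⟨p, m, n, h⟩ ⟨q, m', n', h'⟩
        change p (q 1) - p (q 0) = _
        simp only [h, h']
        ring }
  have h : ∀ p ∈ f.toHomUnits.ker, ∀ k, p.1 k = k + p.1 0 := by
    rintro ⟨p, m, n, h⟩ hp k
    have h1 : p 1 - p 0 = 1 := congrArg Units.val hp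
    change p k = k + p 0
    rw [h, h] at h1 ⊢
    linear_combination k * h1
  have hker : Group.IsSolvable f.toHomUnits.ker := by
    refine Group.isSolvable_of_comm fun p q => Subtype.ext (Subtype.ext (Equiv.ext fun k => ?_))
    change p.1.1 (q.1.1 k) = q.1.1 (p.1.1 k)
    rw [h p.1 p.2, h q.1 q.2, h q.1 q.2 (p.1.1 k), h p.1 p.2 k]
    ring
  have := isSolvable_comap f.toHomUnits hker ⊤
    (Group.isSolvable_of_comm fun x y => mul_comm x y)
  rw [Subgroup.comap_top] at this
  exact Group.isSolvable_of_surjective (f := (⊤ : Subgroup affineGroup).subtype)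
    fun x => ⟨⟨x, trivial⟩, rfl⟩

theorem isSolvable_quinticDatum_Bs : Group.IsSolvable quinticDatum.Bs :=
  isSolvable_of_le quinticDatum_Bs_le isSolvable_affineGroup

theorem not_isSolvable_perm : ¬ Group.IsSolvable (Equiv.Perm (ZMod 5)) :=
  Equiv.Perm.not_isSolvable_fin_5

theorem not_isSolvable_alternating : ¬ Group.IsSolvable (alternatingGroup (ZMod 5)) := by
  intro h
  refine not_isSolvable_perm (Group.isSolvable_of_ker_le_range (alternatingGroup (ZMod 5)).subtype
    Equiv.Perm.sign ?_)
  rw [Subgroup.range_subtype]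
  exact le_rfl

theorem eq_bot_of_isSolvable (N : Subgroup (Equiv.Perm (ZMod 5))) (hN : N.Normal)
    (hs : Group.IsSolvable N) : N = ⊥ := by
  by_contra h
  have := Equiv.Perm.alternatingGroup_le_of_normal (N := N) (by rw [Nat.card_zmod])
    ((Subgroup.nontrivial_iff_ne_bot _).2 h)
  exact not_isSolvable_alternating (isSolvable_of_le this hs)

/-! ## The double cover of the alternating group on four points -/

/-- The lift of an element of the field with three elements to `0`, `1` or `-1`. -/
def signLift (x : ZMod 3) : ZMod 5 := if x = 0 then 0 else if x = 1 then 1 else -1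

/-- The entries of the reduction modulo `5` of the Hurwitz unit whose reduction modulo `3` has
rows `(a, b)` and `(c, d)`. -/
def hurwitz (a b c d : ZMod 3) : Fin 2 → Fin 2 → ZMod 5 :=
  let x := 2 * (a + d)
  let y := b - c
  let z := 2 * (2 * c - b - (a - d))
  let w := 2 * (2 * c - b + (a - d))
  -- `x, y, z, w` are the coordinates modulo 3 in a quaternion basis. If all are nonzero, the unit
  -- is half of a sum of four signed basis elements. Since `1/2 = -1` modulo 3, its signs are
  -- opposite to the lifts, and the factor is `-1/2 = 2` modulo 5.
  let s : ZMod 5 := if x * y * z * w = 0 then 1 else 2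
  ![![s * (signLift x + 2 * signLift w), s * (signLift y + 2 * signLift z)],
    ![s * (2 * signLift z - signLift y), s * (signLift x - 2 * signLift w)]]

set_option maxRecDepth 100000 in
theorem hurwitz_mul : ∀ a b c d : ZMod 3, a * d - b * c = 1 → ∀ a' b' c' d' : ZMod 3,
    a' * d' - b' * c' = 1 → ∀ i j,
      hurwitz (a * a' + b * c') (a * b' + b * d') (c * a' + d * c') (c * b' + d * d') i j =
      hurwitz a b c d i 0 * hurwitz a' b' c' d' 0 j +
        hurwitz a b c d i 1 * hurwitz a' b' c' d' 1 j := by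
  decide

-- The second half places the image inside the stabilizer of a point; together with
-- `exists_hurwitz_eq` the image is exactly the determinant-one part of that stabilizer.
set_option maxRecDepth 100000 in
theorem hurwitz_det : ∀ a b c d : ZMod 3, a * d - b * c = 1 →
    hurwitz a b c d 0 0 * hurwitz a b c d 1 1 - hurwitz a b c d 0 1 * hurwitz a b c d 1 0 = 1 ∧
    quinticMap (hurwitz a b c d 0 0) (hurwitz a b c d 0 1) (hurwitz a b c d 1 0)
      (hurwitz a b c d 1 1) 0 = 0 := by
  decide

set_option synthInstance.maxSize 1000 in
set_option maxRecDepth 100000 in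
theorem exists_hurwitz_eq : ∀ a b c d : ZMod 5, a * d - b * c = 1 → quinticMap a b c d 0 = 0 →
    ∃ a' b' c' d' : ZMod 3, a' * d' - b' * c' = 1 ∧
      ∀ i j, hurwitz a' b' c' d' i j = ![![a, b], ![c, d]] i j := by
  decide

set_option maxRecDepth 100000 in
theorem eq_one_of_hurwitz : ∀ a b c d : ZMod 3, a * d - b * c = 1 →
    hurwitz a b c d = ![![1, 0], ![0, 1]] → a = 1 ∧ b = 0 ∧ c = 0 ∧ d = 1 := by
  decide

theorem hurwitz_one : hurwitz 1 0 0 1 = ![![1, 0], ![0, 1]] := by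
  decide

theorem det_specialLinear (A : Matrix.SpecialLinearGroup (Fin 2) (ZMod 3)) :
    A.1 0 0 * A.1 1 1 - A.1 0 1 * A.1 1 0 = 1 := by
  rw [← Matrix.det_fin_two]
  exact A.2

/-- Reduction of Hurwitz units, as a homomorphism from `SL₂(3)` to `SL₂(5)`. -/
def hurwitzHom : Matrix.SpecialLinearGroup (Fin 2) (ZMod 3) →*
    Matrix.SpecialLinearGroup (Fin 2) (ZMod 5) where
  toFun A := ⟨hurwitz (A.1 0 0) (A.1 0 1) (A.1 1 0) (A.1 1 1), by
    exact (Matrix.det_fin_two _).trans (hurwitz_det _ _ _ _ (det_specialLinear A)).1⟩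
  map_one' := by
    refine Subtype.ext ?_
    change hurwitz 1 0 0 1 = _
    rw [hurwitz_one, Matrix.SpecialLinearGroup.coe_one, Matrix.one_fin_two]
    rfl
  map_mul' A B := by
    refine Subtype.ext (Matrix.ext fun i j => ?_)
    have e : ∀ i j, (A * B).1 i j = A.1 i 0 * B.1 0 j + A.1 i 1 * B.1 1 j := fun i j =>
      (Matrix.mul_apply).trans (Fin.sum_univ_two _)
    change hurwitz ((A * B).1 0 0) ((A * B).1 0 1) ((A * B).1 1 0) ((A * B).1 1 1) i j = _
    rw [e, e, e, e, hurwitz_mul _ _ _ _ (det_specialLinear A) _ _ _ _ (det_specialLinear B)]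
    exact ((Matrix.mul_apply).trans (Fin.sum_univ_two _)).symm

theorem hurwitzHom_injective : Function.Injective hurwitzHom := by
  refine (injective_iff_map_eq_one _).2 fun A hA => ?_
  have h : hurwitz (A.1 0 0) (A.1 0 1) (A.1 1 0) (A.1 1 1) = ![![1, 0], ![0, 1]] := by
    refine (congrArg Subtype.val hA).trans ?_
    rw [Matrix.SpecialLinearGroup.coe_one, Matrix.one_fin_two]
    rfl
  obtain ⟨h1, h2, h3, h4⟩ := eq_one_of_hurwitz _ _ _ _ (det_specialLinear A) h
  refine Subtype.ext (Matrix.ext fun i j => ?_)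
  fin_cases i <;> fin_cases j <;> simpa

/-- The stabilizer of the point `0` in the exceptional action of `GL₂(5)`. -/
def quinticStab : Subgroup (GL (Fin 2) (ZMod 5)) :=
  (MulAction.stabilizer (Equiv.Perm (ZMod 5)) (0 : ZMod 5)).comap quinticHom

theorem mem_quinticStab {A : GL (Fin 2) (ZMod 5)} : A ∈ quinticStab ↔ quinticHom A 0 = 0 := Iff.rfl

/-- The embedding of `SL₂(3)` in the stabilizer. -/
def slStab : Matrix.SpecialLinearGroup (Fin 2) (ZMod 3) →* quinticStab :=
  (Matrix.SpecialLinearGroup.toGL.comp hurwitzHom).codRestrict quinticStab fun A =>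
    (hurwitz_det _ _ _ _ (det_specialLinear A)).2

/-- The embedding of a cyclic group in the stabilizer. -/
noncomputable def torusStab : (ZMod 5)ˣ →* quinticStab where
  toFun d := ⟨upperMatrix 1 0 one_ne_zero d.ne_zero, by
    rw [mem_quinticStab, quinticHom_upperMatrix]
    ring⟩
  map_one' := Subtype.ext (Units.ext (Matrix.ext fun i j => by
    fin_cases i <;> fin_cases j <;> rfl))
  map_mul' d d' := Subtype.ext (Units.ext (Matrix.ext fun i j => by
    fin_cases i <;> fin_cases j <;> simp [upperMatrix, Matrix.GeneralLinearGroup.mkOfDetNeZero]))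

/-- The determinant on the stabilizer. -/
noncomputable def detStab : quinticStab →* (ZMod 5)ˣ :=
  Matrix.GeneralLinearGroup.det.comp quinticStab.subtype

theorem detStab_torusStab (d : (ZMod 5)ˣ) : detStab (torusStab d) = d := by
  refine Units.ext ?_
  change Matrix.det !![1, 0; 0, (d : ZMod 5)] = d
  rw [Matrix.det_fin_two_of]
  ring

theorem range_slStab : slStab.range = detStab.ker := by
  ext A
  constructor
  · rintro ⟨B, rfl⟩
    exact Units.ext (hurwitzHom B).2
  · intro h
    have h1 : A.1.1.det = 1 := congrArg Units.val h
    rw [Matrix.det_fin_two] at h1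
    obtain ⟨a, b, c, d, hdet, he⟩ := exists_hurwitz_eq _ _ _ _ h1 (mem_quinticStab.1 A.2)
    refine ⟨⟨!![a, b; c, d], by rw [Matrix.det_fin_two_of, hdet]⟩,
      Subtype.ext (Units.ext (Matrix.ext fun i j => ?_))⟩
    change hurwitz a b c d i j = _
    rw [he]
    fin_cases i <;> fin_cases j <;> rfl

theorem isComplement'_slStab : slStab.range.IsComplement' torusStab.range := by
  rw [range_slStab]
  refine Subgroup.isComplement'_of_disjoint_and_mul_eq_univ ?_ ?_
  · rw [Subgroup.disjoint_def]
    rintro _ h ⟨d, rfl⟩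
    rw [MonoidHom.mem_ker, detStab_torusStab] at h
    rw [h, map_one]
  · refine Set.eq_univ_of_forall fun A => ⟨A * (torusStab (detStab A))⁻¹, ?_,
      torusStab (detStab A), ⟨_, rfl⟩, inv_mul_cancel_right _ _⟩
    change _ ∈ detStab.ker
    rw [MonoidHom.mem_ker, map_mul, map_inv, detStab_torusStab, mul_inv_cancel]

/-- The determinant maps the stabilizer onto the cyclic group of units modulo 5, split by the
matrices `diag(1, d)`, and its kernel is the copy of `SL₂(3)` given by the Hurwitz units. -/
theorem isSL23ByCyclic_quinticStab : IsSL23ByCyclic quinticStab 4 := by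
  have hN : slStab.range.Normal := range_slStab ▸ inferInstance
  have h1 : Function.Injective slStab := fun A B h =>
    hurwitzHom_injective (Matrix.SpecialLinearGroup.toGL_injective (congrArg Subtype.val h))
  have h2 : Function.Injective torusStab := fun d d' h => by
    rw [← detStab_torusStab d, h, detStab_torusStab]
  have h3 : Nat.card (ZMod 5)ˣ = 4 := by
    rw [Nat.card_eq_fintype_card, ZMod.card_units_eq_totient, Nat.totient_prime (by norm_num)]
  have e : (ZMod 5)ˣ ≃* Multiplicative (ZMod 4) :=
    mulEquivOfCyclicCardEq (by rw [h3]; simp)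
  exact ⟨_, ⟨(SemidirectProduct.mulEquivSubgroup isComplement'_slStab).symm.trans
    (SemidirectProduct.congr' (MonoidHom.ofInjective h1).symm
      ((MonoidHom.ofInjective h2).symm.trans e))⟩⟩

end BoundaryTree

/-! ### Solubility of the Borel subgroups -/

namespace BoundaryTree

theorem isSolvable_of_ker {G H : Type*} [Group G] [Group H] (f : G →* H)
    (hker : Group.IsSolvable f.ker) (hH : Group.IsSolvable H) : Group.IsSolvable G :=
  Group.isSolvable_of_ker_le_range f.ker.subtype f (by rw [Subgroup.range_subtype])

theorem isSolvable_linearBorel {K : Type*} [Field K] : Group.IsSolvable (linearBorel K) := by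
  have hform : ∀ h : linearBorel K, h.1.1 ![1, 0] 1 = 0 ∧
      ∀ u, h.1.1 u = ![h.1.1 ![1, 0] 0 * u 0 + h.1.1 ![0, 1] 0 * u 1, h.1.1 ![0, 1] 1 * u 1] := by
    intro h
    obtain ⟨x, y, z, -, -, H⟩ := exists_of_mem_linearBorel h.2
    refine ⟨by simp [H], fun u => ?_⟩
    simp [H]
  let f : linearBorel K →* K × K :=
    { toFun := fun h => (h.1.1 ![1, 0] 0, h.1.1 ![0, 1] 1)
      map_one' := rfl
      map_mul' := fun g h => by
        refine Prod.ext ?_ ?_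
        · change g.1.1 (h.1.1 ![1, 0]) 0 = g.1.1 ![1, 0] 0 * h.1.1 ![1, 0] 0
          rw [(hform g).2 (h.1.1 ![1, 0]), (hform h).1]
          simp
        · change g.1.1 (h.1.1 ![0, 1]) 1 = g.1.1 ![0, 1] 1 * h.1.1 ![0, 1] 1
          rw [(hform g).2 (h.1.1 ![0, 1])]
          simp }
  refine isSolvable_of_ker f.toHomUnits ?_ (Group.isSolvable_of_comm fun x y => mul_comm x y)
  have hker : ∀ h ∈ f.toHomUnits.ker, ∀ u, h.1.1 u = ![u 0 + h.1.1 ![0, 1] 0 * u 1, u 1] := by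
    intro h hh u
    have h1 : f h = 1 := congrArg Units.val hh
    have h2 : h.1.1 ![1, 0] 0 = 1 := congrArg Prod.fst h1
    have h3 : h.1.1 ![0, 1] 1 = 1 := congrArg Prod.snd h1
    rw [(hform h).2 u, h2, h3, one_mul, one_mul]
  refine Group.isSolvable_of_comm fun g h =>
    Subtype.ext (Subtype.ext (GammaL.ext_iff.2 fun u => ?_))
  change g.1.1.1 (h.1.1.1 u) = h.1.1.1 (g.1.1.1 u)
  rw [hker g.1 g.2 (h.1.1.1 u), hker h.1 h.2 u, hker h.1 h.2 (g.1.1.1 u), hker g.1 g.2 u]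
  ext i
  fin_cases i
  · simp
    ring
  · simp

theorem isSolvable_semilinearBorel {K : Type*} [Field K] (hK : Group.IsSolvable (RingAut K)) :
    Group.IsSolvable (semilinearBorel K) := by
  refine isSolvable_of_ker ((fieldAut K (Fin 2 → K)).comp (semilinearBorel K).subtype) ?_ hK
  have : Group.IsSolvable (linearBorel K) := isSolvable_linearBorel
  refine Group.isSolvable_of_isSolvable_injective (G' := linearBorel K)
    (f := ((semilinearBorel K).subtype.comp
      ((fieldAut K (Fin 2 → K)).comp (semilinearBorel K).subtype).ker.subtype).codRestrict
        (linearBorel K) fun h => ⟨h.2, h.1.2⟩) ?_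
  intro g h hgh
  have h1 := congrArg Subtype.val hgh
  exact Subtype.ext (Subtype.ext h1)

/-! ## The projective line over the field with four elements -/

theorem natCard_galoisField_four : Nat.card (GaloisField 2 2) = 4 :=
  GaloisField.card 2 2 two_ne_zero

/-- Otherwise `0, 1, x, σ x, σ (σ x)` would be five distinct elements of a field with four. -/
theorem mul_self_ringAut (σ : RingAut (GaloisField 2 2)) : σ * σ = 1 := by
  classical
  refine RingEquiv.ext fun x => ?_
  change σ (σ x) = x
  by_contra h
  have h1 : σ x ≠ x := fun e => h (by rw [e, e])
  have hx0 : x ≠ 0 := by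
    rintro rfl
    simp at h1
  have hx1 : x ≠ 1 := by
    rintro rfl
    simp at h1
  have : Fintype (GaloisField 2 2) := Fintype.ofFinite _
  have hcard : ({0, 1, x, σ x, σ (σ x)} : Finset (GaloisField 2 2)).card = 5 := by
    have h2 : ∀ y, y ≠ 0 → σ y ≠ 0 := fun y => (map_ne_zero_iff σ σ.injective).2
    have h3 : ∀ y, y ≠ 1 → σ y ≠ 1 := fun y => (map_ne_one_iff σ σ.injective).2
    have h4 := h2 x hx0
    have h5 := h3 x hx1
    have h6 := h2 _ h4
    have h7 := h3 _ h5
    have h8 : σ (σ x) ≠ σ x := fun e => h1 (σ.injective e)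
    rw [Finset.card_insert_of_notMem, Finset.card_insert_of_notMem, Finset.card_insert_of_notMem,
      Finset.card_insert_of_notMem, Finset.card_singleton] <;>
      simp only [Finset.mem_insert, Finset.mem_singleton, not_or]
    · exact h8.symm
    · exact ⟨h1.symm, fun e => h e.symm⟩
    · exact ⟨hx1.symm, h5.symm, h7.symm⟩
    · exact ⟨zero_ne_one, hx0.symm, h4.symm, h6.symm⟩
  have := Finset.card_le_univ ({0, 1, x, σ x, σ (σ x)} : Finset (GaloisField 2 2))
  rw [hcard, ← Nat.card_eq_fintype_card, natCard_galoisField_four] at this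
  omega

theorem isSolvable_ringAut : Group.IsSolvable (RingAut (GaloisField 2 2)) := by
  refine Group.isSolvable_of_comm fun σ τ => ?_
  have h : ∀ σ : RingAut (GaloisField 2 2), σ⁻¹ = σ := fun σ =>
    inv_eq_of_mul_eq_one_left (mul_self_ringAut σ)
  rw [← h (σ * τ), mul_inv_rev, h, h]

theorem natCard_projectiveLine : Nat.card (ℙ (GaloisField 2 2) (Fin 2 → GaloisField 2 2)) = 5 := by
  rw [Projectivization.card_of_finrank_two _ _ (Module.finrank_fin_fun _),
    natCard_galoisField_four]

/-- A labelling of the points of the projective line over the field with four elements. -/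
noncomputable def lineLabel : ℙ (GaloisField 2 2) (Fin 2 → GaloisField 2 2) ≃ ZMod 5 :=
  have : Finite (ℙ (GaloisField 2 2) (Fin 2 → GaloisField 2 2)) :=
    Nat.finite_of_card_ne_zero (by rw [natCard_projectiveLine]; norm_num)
  Finite.equivFinOfCardEq natCard_projectiveLine

/-- The action of `ΓL₂(4)` on the projective line. -/
noncomputable def lineHom : GammaL (GaloisField 2 2) (Fin 2 → GaloisField 2 2) →*
    Equiv.Perm (ZMod 5) :=
  lineLabel.permCongrHom.toMonoidHom.comp (projHom _ _)

theorem lineHom_apply (h : GammaL (GaloisField 2 2) (Fin 2 → GaloisField 2 2))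
    (x : ℙ (GaloisField 2 2) (Fin 2 → GaloisField 2 2)) :
    lineHom h (lineLabel x) = lineLabel (projHom _ _ h x) := by
  simp [lineHom]

theorem lineHom_eq_one_iff (h : GammaL (GaloisField 2 2) (Fin 2 → GaloisField 2 2)) :
    lineHom h = 1 ↔ ∃ c : GaloisField 2 2, ∀ u, h.1 u = c • u := by
  rw [← projHom_eq_one_iff exists_ne_smul_pi]
  exact map_eq_one_iff lineLabel.permCongrHom.toMonoidHom lineLabel.permCongrHom.injective

/-- The coordinatewise Frobenius map. -/
noncomputable def frobeniusGamma : GammaL (GaloisField 2 2) (Fin 2 → GaloisField 2 2) :=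
  ⟨Equiv.piCongrRight fun _ => (frobeniusEquiv (GaloisField 2 2) 2).toEquiv,
    fun u v => funext fun i => map_add (frobeniusEquiv (GaloisField 2 2) 2) (u i) (v i),
    frobeniusEquiv (GaloisField 2 2) 2,
    fun a v => funext fun i => map_mul (frobeniusEquiv (GaloisField 2 2) 2) a (v i)⟩

theorem frobeniusGamma_apply (v : Fin 2 → GaloisField 2 2) (i : Fin 2) :
    frobeniusGamma.1 v i = v i ^ 2 := frobeniusEquiv_def _ _ _

/-- Frobenius fixes the three points defined over the prime field, leaving only two, and it does not
act trivially because it is not a scalar. -/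
theorem isSwap_frobeniusGamma : (lineHom frobeniusGamma).IsSwap := by
  classical
  have hfix : ∀ (v : Fin 2 → GaloisField 2 2) (hv : v ≠ 0), (∀ i, v i ^ 2 = v i) →
      lineLabel (Projectivization.mk _ v hv) ∉ (lineHom frobeniusGamma).support := by
    intro v hv h
    rw [Equiv.Perm.notMem_support, lineHom_apply]
    congr 1
    refine (projHom_mk_eq_iff _ hv hv).2 ⟨1, ?_⟩
    rw [one_smul]
    exact funext fun i => ((frobeniusGamma_apply v i).trans (h i)).symm
  have h10 : (![1, 0] : Fin 2 → GaloisField 2 2) ≠ 0 := fun h => one_ne_zero (congrFun h 0)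
  have h01 : (![0, 1] : Fin 2 → GaloisField 2 2) ≠ 0 := fun h => one_ne_zero (congrFun h 1)
  have h11 : (![1, 1] : Fin 2 → GaloisField 2 2) ≠ 0 := fun h => one_ne_zero (congrFun h 1)
  have hsub : (lineHom frobeniusGamma).support ⊆
      Finset.univ \ {lineLabel (Projectivization.mk _ _ h10),
        lineLabel (Projectivization.mk _ _ h01), lineLabel (Projectivization.mk _ _ h11)} := by
    intro k hk
    simp only [Finset.mem_sdiff, Finset.mem_univ, true_and, Finset.mem_insert,
      Finset.mem_singleton]
    rintro (rfl | rfl | rfl)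
    · exact hfix _ h10 (by simp [Fin.forall_fin_two]) hk
    · exact hfix _ h01 (by simp [Fin.forall_fin_two]) hk
    · exact hfix _ h11 (by simp [Fin.forall_fin_two]) hk
  have hne : ∀ (v w : Fin 2 → GaloisField 2 2) (hv : v ≠ 0) (hw : w ≠ 0),
      (∀ a : GaloisField 2 2, a • w ≠ v) →
      lineLabel (Projectivization.mk _ v hv) ≠ lineLabel (Projectivization.mk _ w hw) := by
    intro v w hv hw h he
    obtain ⟨a, ha⟩ := (Projectivization.mk_eq_mk_iff' _ _ _ _ _).1 (lineLabel.injective he)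
    exact h a ha
  rw [← Equiv.Perm.card_support_eq_two]
  refine le_antisymm ((Finset.card_le_card hsub).trans ?_)
    (Equiv.Perm.two_le_card_support_of_ne_one ?_)
  · rw [Finset.card_univ_sdiff, Finset.card_eq_three.2 ⟨_, _, _, ?_, ?_, ?_, rfl⟩, ZMod.card]
    · refine hne _ _ _ _ fun a h => ?_
      have := congrFun h 0
      simp at this
    · refine hne _ _ _ _ fun a h => ?_
      have h0 := congrFun h 0
      have h1 := congrFun h 1
      simp only [Pi.smul_apply, smul_eq_mul, Matrix.cons_val_zero, Matrix.cons_val_one] at h0 h1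
      rw [mul_one] at h0 h1
      exact zero_ne_one (h1.symm.trans h0)
    · refine hne _ _ _ _ fun a h => ?_
      have h0 := congrFun h 0
      have h1 := congrFun h 1
      simp only [Pi.smul_apply, smul_eq_mul, Matrix.cons_val_zero, Matrix.cons_val_one] at h0 h1
      rw [mul_one] at h0 h1
      exact zero_ne_one (h0.symm.trans h1)
  · intro h
    obtain ⟨c, hc⟩ := (lineHom_eq_one_iff _).1 h
    have hsq : ∀ x : GaloisField 2 2, x ^ 2 = c * x := fun x =>
      (frobeniusGamma_apply (fun _ => x) 0).symm.trans (congrFun (hc fun _ => x) 0)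
    have hc1 : c = 1 := by
      have := hsq 1
      rw [one_pow, mul_one] at this
      exact this.symm
    have : Fintype (GaloisField 2 2) := Fintype.ofFinite _
    have hle : (Finset.univ : Finset (GaloisField 2 2)) ⊆ {0, 1} := fun x _ => by
      have h1 : x * (x - 1) = 0 := by
        linear_combination (hsq x) + x * hc1
      rw [Finset.mem_insert, Finset.mem_singleton]
      exact (mul_eq_zero.1 h1).imp_right sub_eq_zero.1
    have h2 := Finset.card_le_card hle
    rw [Finset.card_univ, ← Nat.card_eq_fintype_card, natCard_galoisField_four] at h2
    have h3 := Finset.card_le_two (a := (0 : GaloisField 2 2)) (b := 1)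
    omega

theorem lineHom_surjective : Function.Surjective lineHom := by
  rw [← MonoidHom.range_eq_top]
  refine eq_top_of_isSwap (fun i j => ?_) ⟨_, rfl⟩ isSwap_frobeniusGamma
  obtain ⟨a, rfl⟩ := lineLabel.surjective i
  obtain ⟨c, rfl⟩ := lineLabel.surjective j
  have hex : ∀ a : ℙ (GaloisField 2 2) (Fin 2 → GaloisField 2 2), ∃ b, a ≠ b := fun a => by
    have : Nontrivial (ℙ (GaloisField 2 2) (Fin 2 → GaloisField 2 2)) :=
      lineLabel.nontrivial
    obtain ⟨b, hb⟩ := exists_ne a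
    exact ⟨b, hb.symm⟩
  obtain ⟨b, hb⟩ := hex a
  obtain ⟨d, hd⟩ := hex c
  obtain ⟨e, he, -⟩ := exists_projHom_two_transitive hb hd
  refine ⟨_, ⟨linGamma _ _ e, rfl⟩, ?_⟩
  rw [lineHom_apply, he]

/-- The plane datum of the action of `ΓL₂(4)` on the projective line. -/
noncomputable def lineDatum : PlaneDatum (Equiv.Perm (ZMod 5)) where
  K := GaloisField 2 2
  D := lineHom
  surjective := lineHom_surjective
  eq_one_iff := lineHom_eq_one_iff

theorem isSolvable_lineDatum_Bs : Group.IsSolvable lineDatum.Bs := by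
  have : Group.IsSolvable (semilinearBorel (GaloisField 2 2)) :=
    isSolvable_semilinearBorel isSolvable_ringAut
  exact Group.isSolvable_of_surjective
    (MonoidHom.subgroupMap_surjective lineHom (semilinearBorel (GaloisField 2 2)))

theorem lineDatum_Bs : lineDatum.Bs =
    MulAction.stabilizer (Equiv.Perm (ZMod 5)) (lineLabel (linePoint (GaloisField 2 2))) := by
  have key : ∀ h, h ∈ semilinearBorel (GaloisField 2 2) ↔
      lineHom h (lineLabel (linePoint _)) = lineLabel (linePoint _) := fun h => by
    rw [lineHom_apply, lineLabel.apply_eq_iff_eq]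
    rfl
  ext p
  constructor
  · rintro ⟨h, hh, rfl⟩
    exact (key h).1 hh
  · intro hp
    obtain ⟨h, rfl⟩ := lineHom_surjective p
    exact ⟨h, (key h).2 hp, rfl⟩

/-- Field automorphisms here square to the identity, so squares of semilinear maps are linear. -/
theorem mul_self_mem_lineDatum_B {p : Equiv.Perm (ZMod 5)}
    (hp : p (lineLabel (linePoint (GaloisField 2 2))) = lineLabel (linePoint (GaloisField 2 2))) :
    p * p ∈ lineDatum.B := by
  have : p ∈ lineDatum.Bs := by
    rw [lineDatum_Bs]
    exact hp
  obtain ⟨h, hh, rfl⟩ := this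
  refine ⟨h * h, ⟨?_, mul_mem hh hh⟩, map_mul _ _ _⟩
  exact (map_mul (fieldAut (GaloisField 2 2) (Fin 2 → GaloisField 2 2)) h h).trans
    (mul_self_ringAut _)

-- In `Sym(4)` three-cycles are squares of three-cycles and double transpositions are squares of
-- four-cycles, so every element of `Alt(4)` is a square.
set_option maxRecDepth 100000 in
theorem exists_mul_self_eq_of_sign : ∀ q : Equiv.Perm (Fin 5), q 0 = 0 → Equiv.Perm.sign q = 1 →
    ∃ r : Equiv.Perm (Fin 5), r 0 = 0 ∧ q = r * r := by
  decide

theorem mem_lineDatum_B {p : Equiv.Perm (ZMod 5)}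
    (hp : p (lineLabel (linePoint (GaloisField 2 2))) = lineLabel (linePoint (GaloisField 2 2)))
    (hs : Equiv.Perm.sign p = 1) : p ∈ lineDatum.B := by
  set i := lineLabel (linePoint (GaloisField 2 2)) with hi
  set t : Equiv.Perm (ZMod 5) := Equiv.addRight i with ht
  have ht0 : t 0 = i := zero_add i
  obtain ⟨r, hr, hpr⟩ := exists_mul_self_eq_of_sign (t⁻¹ * p * t)
    (by
      -- The exhaustive check is stated over `Fin 5`, to which `ZMod 5` unfolds.
      change (t⁻¹ * p * t) (0 : ZMod 5) = 0
      rw [Equiv.Perm.mul_apply, Equiv.Perm.mul_apply, ht0, hp, Equiv.Perm.inv_eq_iff_eq, ht0])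
    (by
      change Equiv.Perm.sign (t⁻¹ * p * t) = 1
      rw [map_mul, map_mul, hs, map_inv, mul_one, inv_mul_cancel])
  change Equiv.Perm (ZMod 5) at r
  change t⁻¹ * p * t = r * r at hpr
  change r 0 = 0 at hr
  have : p = t * r * t⁻¹ * (t * r * t⁻¹) := by
    have h1 : p = t * (t⁻¹ * p * t) * t⁻¹ := by group
    rw [h1, hpr]
    group
  rw [this]
  refine mul_self_mem_lineDatum_B ?_
  rw [← hi, Equiv.Perm.mul_apply, Equiv.Perm.mul_apply, Equiv.Perm.inv_eq_iff_eq.2 ht0.symm, hr, ht0]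

/-- Multiplication by two. -/
def doubling : Equiv.Perm (ZMod 5) := ⟨fun x => 2 * x, fun x => 3 * x, by decide, by decide⟩

set_option maxRecDepth 100000 in
theorem sign_doubling : Equiv.Perm.sign doubling = -1 := by
  decide

set_option maxRecDepth 100000 in
theorem sign_addRight : ∀ i : ZMod 5, Equiv.Perm.sign (Equiv.addRight i) = 1 := by
  decide

theorem exists_affine (i j : ZMod 5) (ε : ℤˣ) : ∃ a ∈ affineGroup, a i = j ∧
    Equiv.Perm.sign a = ε := by
  have h1 : ∀ i, Equiv.addRight i ∈ affineGroup := fun i => ⟨1, i, fun k => by simp⟩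
  have h2 : doubling ∈ affineGroup := ⟨2, 0, fun k => (add_zero _).symm⟩
  have h3 : (Equiv.addRight i : Equiv.Perm (ZMod 5))⁻¹ i = 0 := by
    rw [Equiv.Perm.inv_eq_iff_eq]
    simp
  rcases Int.units_eq_one_or ε with rfl | rfl
  · refine ⟨Equiv.addRight j * (Equiv.addRight i)⁻¹, mul_mem (h1 j) (inv_mem (h1 i)), ?_, ?_⟩
    · rw [Equiv.Perm.mul_apply, h3]
      simp
    · rw [map_mul, map_inv, sign_addRight, sign_addRight]
      rfl
  · refine ⟨Equiv.addRight j * doubling * (Equiv.addRight i)⁻¹,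
      mul_mem (mul_mem (h1 j) h2) (inv_mem (h1 i)), ?_, ?_⟩
    · rw [Equiv.Perm.mul_apply, Equiv.Perm.mul_apply, h3]
      simp [doubling]
    · rw [map_mul, map_mul, map_inv, sign_addRight, sign_addRight, sign_doubling]
      rfl

/-- The affine group is transitive and contains odd permutations fixing a point, so `a` can match
both the image of the base point and the sign. What is left is even and fixes the base point, hence
lies in the linear Borel image over the field with four elements. -/
theorem exists_mul_mul_eq (x y : Equiv.Perm (ZMod 5)) :
    ∃ a ∈ quinticDatum.B, ∃ b ∈ lineDatum.B, a * x * b = y := by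
  set i := lineLabel (linePoint (GaloisField 2 2)) with hi
  obtain ⟨a, ha, hij, hs⟩ := exists_affine (x i) (y i) (Equiv.Perm.sign y * (Equiv.Perm.sign x)⁻¹)
  refine ⟨a, affineGroup_le ha, (a * x)⁻¹ * y, mem_lineDatum_B ?_ ?_, by group⟩
  · rw [← hi, Equiv.Perm.mul_apply, Equiv.Perm.inv_eq_iff_eq, Equiv.Perm.mul_apply, hij]
  · rw [map_mul, map_inv, map_mul, hs]
    group

/-- The two plane data with the symmetric group on five points. -/
noncomputable def quinticGluing : Gluing (Equiv.Perm (ZMod 5)) where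
  X := ![quinticDatum, lineDatum]
  factor := by
    have h : ∀ x y : Equiv.Perm (ZMod 5),
        ∃ a ∈ lineDatum.B, ∃ b ∈ quinticDatum.B, a * x * b = y := fun x y => by
      obtain ⟨a, ha, b, hb, hab⟩ := exists_mul_mul_eq x⁻¹ y⁻¹
      refine ⟨b⁻¹, inv_mem hb, a⁻¹, inv_mem ha, ?_⟩
      rw [← inv_inj, ← hab]
      group
    intro t t' htt
    fin_cases t <;> fin_cases t'
    · exact absurd rfl htt
    · exact exists_mul_mul_eq
    · exact h
    · exact absurd rfl htt
  isSolvable_Bs t := by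
    fin_cases t
    · exact isSolvable_quinticDatum_Bs
    · exact isSolvable_lineDatum_Bs
  not_isSolvable := not_isSolvable_perm
  eq_bot := eq_bot_of_isSolvable

end BoundaryTree

namespace BoundaryTree

/-- Because `D` is onto, the conjugation lifts; hence the unknown conjugators in `lambda_eq` do not
affect the isomorphism type of the complement. -/
theorem nonempty_comap_conj_equiv {G S : Type*} [Group G] [Group S] {D : G →* S}
    (hD : Function.Surjective D) (H : Subgroup S) (x : S) :
    Nonempty ((H.map (MulAut.conj x).toMonoidHom).comap D ≃* H.comap D) := by
  obtain ⟨g, rfl⟩ := hD x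
  have : (H.map (MulAut.conj (D g)).toMonoidHom).comap D =
      (H.comap D).map (MulAut.conj g).toMonoidHom := by
    ext k
    constructor
    · rintro ⟨s, hs, hk⟩
      have h1 : D g * s * (D g)⁻¹ = D k := hk
      refine ⟨g⁻¹ * k * g, ?_, ?_⟩
      · change D (g⁻¹ * k * g) ∈ H
        rw [map_mul, map_mul, map_inv, ← h1]
        simpa [mul_assoc] using hs
      · change g * (g⁻¹ * k * g) * g⁻¹ = k
        group
    · rintro ⟨k, hk, rfl⟩
      refine ⟨D k, hk, ?_⟩
      change D g * D k * (D g)⁻¹ = D (g * k * g⁻¹)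
      simp
  rw [this]
  exact ⟨((H.comap D).equivMapOfInjective _ (MulAut.conj g).injective).symm⟩

/-! ## The one-dimensional semilinear group over the field with sixteen elements -/

theorem exists_algebra : ∃ _ : Algebra (GaloisField 2 2) (GaloisField 2 4),
    Module.finrank (GaloisField 2 2) (GaloisField 2 4) = 2 := by
  obtain ⟨f⟩ := FiniteField.nonempty_algHom_of_finrank_dvd (F := ZMod 2) (K := GaloisField 2 2)
    (L := GaloisField 2 4) (by
      rw [GaloisField.finrank 2 two_ne_zero, GaloisField.finrank 2 four_ne_zero]
      norm_num)
  refine ⟨f.toRingHom.toAlgebra, ?_⟩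
  let _ := f.toRingHom.toAlgebra
  have : Fintype (GaloisField 2 2) := Fintype.ofFinite _
  have : Fintype (GaloisField 2 4) := Fintype.ofFinite _
  have h := Module.card_eq_pow_finrank (K := GaloisField 2 2) (V := GaloisField 2 4)
  rw [← Nat.card_eq_fintype_card, ← Nat.card_eq_fintype_card, natCard_galoisField_four,
    GaloisField.card 2 4 four_ne_zero] at h
  exact (Nat.pow_right_injective (le_of_eq (by norm_num : 2 = 2)) (by
    have h4 : (2 : ℕ) ^ 4 = 4 ^ 2 := by norm_num
    exact Nat.pow_right_injective (by norm_num : 2 ≤ 4) (h4.symm.trans h) ▸ rfl)).symm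

theorem exists_generator (L : Type*) [Field L] [Finite L] :
    ∃ ζ : L, ζ ≠ 0 ∧ ∀ x : L, x ≠ 0 → ∃ n : ℕ, x = ζ ^ n := by
  obtain ⟨ζ, hζ⟩ := IsCyclic.exists_generator (α := Lˣ)
  refine ⟨ζ, ζ.ne_zero, fun x hx => ?_⟩
  obtain ⟨n, hn⟩ := mem_powers_iff_mem_zpowers.2 (hζ (Units.mk0 x hx))
  refine ⟨n, ?_⟩
  have := congrArg Units.val hn
  simpa using this.symm

/-- The semilinear map `x ↦ a x ^ (2 ^ j)`. -/
noncomputable def monomialMap {a : GaloisField 2 4} (ha : a ≠ 0) (j : ℕ) :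
    GammaL1 (GaloisField 2 4) :=
  ⟨(iterateFrobeniusEquiv (GaloisField 2 4) 2 j).toEquiv.trans (Equiv.mulLeft₀ a ha),
    fun u v => by simp [mul_add],
    iterateFrobeniusEquiv (GaloisField 2 4) 2 j, fun b v => by simp [mul_left_comm]⟩

theorem monomialMap_apply {a : GaloisField 2 4} (ha : a ≠ 0) (j : ℕ) (x : GaloisField 2 4) :
    (monomialMap ha j).1 x = a * x ^ 2 ^ j :=
  congrArg (a * ·) (iterateFrobeniusEquiv_def _ _ _ _)

section RestrictScalars

variable [Algebra (GaloisField 2 2) (GaloisField 2 4)]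

theorem GammaL1_le : GammaL1 (GaloisField 2 4) ≤ GammaL (GaloisField 2 2) (GaloisField 2 4) := by
  refine GammaL_le_of_algebra fun σ => ?_
  have : IsScalarTower (ZMod 2) (GaloisField 2 2) (GaloisField 2 4) :=
    IsScalarTower.of_algebraMap_eq' (Subsingleton.elim _ _)
  let σ' : GaloisField 2 4 ≃ₐ[ZMod 2] GaloisField 2 4 :=
    AlgEquiv.ofRingEquiv (f := σ) fun r => RingHom.congr_fun
      (Subsingleton.elim (σ.toRingHom.comp (algebraMap (ZMod 2) (GaloisField 2 4)))
        (algebraMap (ZMod 2) (GaloisField 2 4))) r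
  exact ⟨(σ'.restrictNormal (GaloisField 2 2)).toRingEquiv,
    fun a => (σ'.restrictNormal_commutes (GaloisField 2 2) a).symm⟩

variable (ℓ : GaloisField 2 4 ≃ₗ[GaloisField 2 2] (Fin 2 → GaloisField 2 2))

/-- The embedding of the one-dimensional semilinear group over the larger field in the
two-dimensional one over the smaller field. -/
noncomputable def restrictScalarsHom :
    GammaL1 (GaloisField 2 4) →* GammaL (GaloisField 2 2) (Fin 2 → GaloisField 2 2) :=
  (ℓ.toEquiv.permCongrHom.toMonoidHom.comp (GammaL1 (GaloisField 2 4)).subtype).codRestrict _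
    fun g => by
      obtain ⟨hadd, τ, hτ⟩ := GammaL1_le g.2
      refine ⟨fun u v => ?_, τ, fun a v => ?_⟩
      · change ℓ (g.1 (ℓ.symm (u + v))) = ℓ (g.1 (ℓ.symm u)) + ℓ (g.1 (ℓ.symm v))
        rw [map_add, hadd, map_add]
      · change ℓ (g.1 (ℓ.symm (a • v))) = τ a • ℓ (g.1 (ℓ.symm v))
        rw [map_smul, hτ, map_smul]

theorem restrictScalarsHom_apply (g : GammaL1 (GaloisField 2 4)) (x : GaloisField 2 4) :
    (restrictScalarsHom ℓ g).1 (ℓ x) = ℓ (g.1 x) := by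
  change ℓ (g.1 (ℓ.symm (ℓ x))) = _
  rw [LinearEquiv.symm_apply_apply]

theorem restrictScalarsHom_injective : Function.Injective (restrictScalarsHom ℓ) := fun _ _ hgh =>
  Subtype.ext (ℓ.toEquiv.permCongrHom.injective (congrArg Subtype.val hgh))

/-- The point spanned by a power of `ζ`. -/
noncomputable def powPoint {ζ : GaloisField 2 4} (hζ : ζ ≠ 0) (n : ℕ) :
    ℙ (GaloisField 2 2) (Fin 2 → GaloisField 2 2) :=
  Projectivization.mk _ (ℓ (ζ ^ n)) ((map_ne_zero_iff ℓ ℓ.injective).2 (pow_ne_zero n hζ))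

/-- `ζ ^ 5` is the norm of `ζ`, hence a scalar of the field with four elements. -/
theorem powPoint_periodic {ζ : GaloisField 2 4} (hζ : ζ ≠ 0) :
    Function.Periodic (powPoint ℓ hζ) 5 := fun n => by
  refine (Projectivization.mk_eq_mk_iff' _ _ _ _ _).2
    ⟨Algebra.norm (GaloisField 2 2) ζ, ?_⟩
  have h : algebraMap (GaloisField 2 2) (GaloisField 2 4) (Algebra.norm _ ζ) = ζ ^ 5 := by
    rw [FiniteField.algebraMap_norm_eq_pow, natCard_galoisField_four,
      GaloisField.card 2 4 four_ne_zero]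
    norm_num
  rw [← map_smul, Algebra.smul_def, h, pow_add, mul_comm]

theorem powPoint_val {ζ : GaloisField 2 4} (hζ : ζ ≠ 0) (n : ℕ) :
    powPoint ℓ hζ (n : ZMod 5).val = powPoint ℓ hζ n := by
  rw [ZMod.val_natCast]
  exact (powPoint_periodic ℓ hζ).map_mod_nat n

theorem powPoint_bijective {ζ : GaloisField 2 4} (hζ : ζ ≠ 0)
    (hgen : ∀ x : GaloisField 2 4, x ≠ 0 → ∃ n : ℕ, x = ζ ^ n) :
    Function.Bijective fun k : ZMod 5 => powPoint ℓ hζ k.val := by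
  have hfin : Finite (ℙ (GaloisField 2 2) (Fin 2 → GaloisField 2 2)) :=
    Finite.of_equiv _ lineLabel.symm
  refine Function.Surjective.bijective_of_nat_card_le (fun x => ?_)
    (by rw [natCard_projectiveLine, Nat.card_zmod])
  induction x using Projectivization.ind with
  | _ v hv =>
    obtain ⟨n, hn⟩ := hgen (ℓ.symm v) ((map_ne_zero_iff ℓ.symm ℓ.symm.injective).2 hv)
    refine ⟨n, (powPoint_val ℓ hζ n).trans ?_⟩
    refine (Projectivization.mk_eq_mk_iff' _ _ _ _ _).2 ⟨1, ?_⟩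
    rw [one_smul, ← hn, LinearEquiv.apply_symm_apply]

theorem projHom_powPoint {ζ : GaloisField 2 4} (hζ : ζ ≠ 0) {g : GammaL1 (GaloisField 2 4)}
    {i m : ℕ} (hg : ∀ k, g.1 (ζ ^ k) = ζ ^ (m * k + i)) (k : ℕ) :
    projHom _ _ (restrictScalarsHom ℓ g) (powPoint ℓ hζ k) = powPoint ℓ hζ (m * k + i) := by
  refine (projHom_mk_eq_iff _ _ _).2 ⟨1, ?_⟩
  rw [one_smul, restrictScalarsHom_apply, hg]

/-- The five points are labelled by exponents of a generator `ζ` modulo 5. Then `x ↦ ζ ^ i * x ^ (2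
^ j)` acts by `k ↦ 2 ^ j * k + i`, so `ΓL₁(16)` induces exactly the affine maps, and it contains the
scalars, which are the kernel of `lineHom`. -/
theorem exists_range_restrictScalarsHom : ∃ c : Equiv.Perm (ZMod 5),
    (restrictScalarsHom ℓ).range =
      (affineGroup.map (MulAut.conj c).toMonoidHom).comap lineHom := by
  obtain ⟨ζ, hζ, hgen⟩ := exists_generator (GaloisField 2 4)
  let c : Equiv.Perm (ZMod 5) :=
    (Equiv.ofBijective _ (powPoint_bijective ℓ hζ hgen)).trans lineLabel
  have hc : ∀ n : ℕ, c n = lineLabel (powPoint ℓ hζ n) := fun n =>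
    congrArg lineLabel (powPoint_val ℓ hζ n)
  have key : ∀ (g : GammaL1 (GaloisField 2 4)) (i m : ℕ), (∀ k, g.1 (ζ ^ k) = ζ ^ (m * k + i)) →
      ∀ k : ZMod 5, lineHom (restrictScalarsHom ℓ g) (c k) = c (m * k + i) := by
    intro g i m hg k
    obtain ⟨n, rfl⟩ := ZMod.natCast_zmod_surjective k
    rw [hc, lineHom_apply, projHom_powPoint ℓ hζ hg, ← hc]
    push_cast
    rfl
  refine ⟨c, le_antisymm ?_ fun h hh => ?_⟩
  · rintro _ ⟨g, rfl⟩
    obtain ⟨-, σ, hσ⟩ := g.2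
    have h1 : g.1 1 ≠ 0 := GammaL.map_ne_zero g one_ne_zero
    obtain ⟨i, hi⟩ := hgen _ h1
    obtain ⟨m, hm⟩ := hgen (σ ζ) ((map_ne_zero_iff σ σ.injective).2 hζ)
    have hg : ∀ k, g.1 (ζ ^ k) = ζ ^ (m * k + i) := fun k => by
      have := hσ (ζ ^ k) 1
      rwa [smul_eq_mul, smul_eq_mul, mul_one, map_pow σ, hm, hi, ← pow_mul, ← pow_add] at this
    refine ⟨c⁻¹ * lineHom (restrictScalarsHom ℓ g) * c, ⟨m, i, fun k => ?_⟩, ?_⟩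
    · rw [Equiv.Perm.mul_apply, Equiv.Perm.mul_apply, key g i m hg, Equiv.Perm.inv_eq_iff_eq]
    · change c * (c⁻¹ * lineHom (restrictScalarsHom ℓ g) * c) * c⁻¹ = _
      group
  · obtain ⟨p, ⟨m, n, hp⟩, hpc⟩ := hh
    have hpc' : c * p * c⁻¹ = lineHom h := hpc
    have hm : m ≠ 0 := by
      rintro rfl
      have := p.injective ((hp 0).trans ((by ring : 0 * 0 + n = 0 * 1 + n).trans (hp 1).symm))
      exact zero_ne_one this
    -- `2` generates the units modulo 5, so powers of Frobenius realize every slope.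
    have hpow : ∀ m : ZMod 5, m ≠ 0 → ∃ j : Fin 4, m = ((2 ^ j.val : ℕ) : ZMod 5) := by
      decide
    obtain ⟨j, hj⟩ := hpow m hm
    have hg : ∀ k, (monomialMap (pow_ne_zero n.val hζ) j.val).1 (ζ ^ k) =
        ζ ^ (2 ^ j.val * k + n.val) := fun k => by
      rw [monomialMap_apply]
      ring
    set g := monomialMap (pow_ne_zero n.val hζ) j.val
    have hgh : lineHom (restrictScalarsHom ℓ g) = lineHom h := by
      rw [← hpc']
      refine Equiv.ext fun k => ?_
      obtain ⟨k, rfl⟩ := c.surjective k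
      rw [key g _ _ hg, Equiv.Perm.mul_apply, Equiv.Perm.mul_apply, Equiv.Perm.inv_eq_iff_eq.2 rfl,
        hp, ← hj, ZMod.natCast_zmod_val]
    have h1 : lineHom (h * (restrictScalarsHom ℓ g)⁻¹) = 1 := by
      rw [map_mul, map_inv, hgh, mul_inv_cancel]
    obtain ⟨a, ha⟩ := (lineHom_eq_one_iff _).1 h1
    have ha' : ∀ u, h.1 u = a • (restrictScalarsHom ℓ g).1 u := fun u => by
      have := ha ((restrictScalarsHom ℓ g).1 u)
      rwa [GammaL.coe_mul_apply, GammaL.inv_apply_apply] at this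
    have ha0 : a ≠ 0 := by
      rintro rfl
      refine GammaL.map_ne_zero h (v := ![1, 0]) (fun e => one_ne_zero (congrFun e 0)) ?_
      rw [ha', zero_smul]
    have hb : algebraMap (GaloisField 2 2) (GaloisField 2 4) a ≠ 0 :=
      (map_ne_zero _).2 ha0
    -- The two maps agree projectively, hence differ by a scalar `a`, which is itself multiplication
    -- by an element of the larger field.
    refine ⟨monomialMap hb 0 * g, GammaL.ext_iff.2 fun u => ?_⟩
    obtain ⟨x, rfl⟩ := ℓ.surjective u
    rw [ha', restrictScalarsHom_apply, restrictScalarsHom_apply, GammaL.coe_mul_apply,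
      monomialMap_apply, pow_zero, pow_one, ← map_smul, Algebra.smul_def]

end RestrictScalars

theorem nonempty_comap_lineHom_equiv (x : Equiv.Perm (ZMod 5)) :
    Nonempty ((affineGroup.map (MulAut.conj x).toMonoidHom).comap lineHom ≃*
      GammaL1 (GaloisField 2 4)) := by
  obtain ⟨_, hrank⟩ := exists_algebra
  have ℓ : GaloisField 2 4 ≃ₗ[GaloisField 2 2] (Fin 2 → GaloisField 2 2) :=
    LinearEquiv.ofFinrankEq _ _ (by rw [hrank, Module.finrank_fin_fun])
  obtain ⟨c, hc⟩ := exists_range_restrictScalarsHom ℓ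
  obtain ⟨e₁⟩ := nonempty_comap_conj_equiv lineHom_surjective affineGroup x
  obtain ⟨e₂⟩ := nonempty_comap_conj_equiv lineHom_surjective affineGroup c
  exact ⟨e₁.trans (e₂.symm.trans ((MulEquiv.subgroupCongr hc).symm.trans
    (MonoidHom.ofInjective (restrictScalarsHom_injective ℓ)).symm))⟩

end BoundaryTree

/-! ### Complements, degrees and the final assembly -/

namespace BoundaryTree

theorem quinticDatum_Bs : quinticDatum.Bs = affineGroup :=
  le_antisymm quinticDatum_Bs_le
    (affineGroup_le.trans (Subgroup.map_mono inf_le_right))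

theorem isSL23ByCyclic_of_mulEquiv {A B : Type*} [Group A] [Group B] (e : A ≃* B) {n : ℕ}
    (h : IsSL23ByCyclic B n) : IsSL23ByCyclic A n := by
  obtain ⟨φ, ⟨f⟩⟩ := h
  exact ⟨φ, ⟨e.trans f⟩⟩

theorem nonempty_comap_comp_equiv {G G' S : Type*} [Group G] [Group G'] [Group S] (e : G ≃* G')
    (f : G →* S) (H : Subgroup S) :
    Nonempty (H.comap (f.comp e.symm.toMonoidHom) ≃* H.comap f) := by
  have h : (H.comap f).map e.toMonoidHom = H.comap (f.comp e.symm.toMonoidHom) :=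
    Subgroup.map_equiv_eq_comap_symm e (H.comap f)
  exact ⟨(MulEquiv.subgroupCongr h).symm.trans
    ((H.comap f).equivMapOfInjective _ e.injective).symm⟩

theorem isSL23ByCyclic_comap (x : Equiv.Perm (ZMod 5)) :
    IsSL23ByCyclic ((lineDatum.Bs.map (MulAut.conj x).toMonoidHom).comap quinticDatum.D) 4 := by
  obtain ⟨y, hy⟩ : ∃ y : Equiv.Perm (ZMod 5), y 0 = lineLabel (linePoint (GaloisField 2 2)) :=
    ⟨Equiv.addRight _, zero_add _⟩
  have h1 : lineDatum.Bs.map (MulAut.conj x).toMonoidHom =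
      (MulAction.stabilizer (Equiv.Perm (ZMod 5)) (0 : ZMod 5)).map
        (MulAut.conj (x * y)).toMonoidHom := by
    rw [lineDatum_Bs, ← hy, map_mul]
    have h2 : MulAction.stabilizer (Equiv.Perm (ZMod 5)) (y 0) =
        (MulAction.stabilizer (Equiv.Perm (ZMod 5)) (0 : ZMod 5)).map
          (MulAut.conj y).toMonoidHom :=
      MulAction.stabilizer_smul_eq_stabilizer_map_conj y (0 : ZMod 5)
    rw [h2, Subgroup.map_map]
    rfl
  rw [h1]
  obtain ⟨e₁⟩ := nonempty_comap_conj_equiv quinticDatum.surjective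
    (MulAction.stabilizer (Equiv.Perm (ZMod 5)) (0 : ZMod 5)) (x * y)
  have h3 : Nonempty ((MulAction.stabilizer (Equiv.Perm (ZMod 5)) (0 : ZMod 5)).comap
      quinticDatum.D ≃* quinticStab) := nonempty_comap_comp_equiv glGammaEquiv quinticHom _
  obtain ⟨e₂⟩ := h3
  exact isSL23ByCyclic_of_mulEquiv (e₁.trans e₂) isSL23ByCyclic_quinticStab

theorem nonempty_comap_equiv (x : Equiv.Perm (ZMod 5)) :
    Nonempty ((quinticDatum.Bs.map (MulAut.conj x).toMonoidHom).comap lineDatum.D ≃*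
      GammaL1 (GaloisField 2 4)) := by
  rw [quinticDatum_Bs]
  exact nonempty_comap_lineHom_equiv x

theorem natCard_plane (t : Fin 2) :
    Nat.card (quinticGluing.X t).Ω = (![31, 21] : Fin 2 → ℕ) t := by
  have h1 : Nat.card (ℙ (ZMod 5) (Fin 3 → ZMod 5)) = 31 := by
    rw [Projectivization.card_of_finrank _ _ (Module.finrank_fin_fun _), Nat.card_zmod]
    decide
  have h2 : Nat.card (ℙ (GaloisField 2 2) (Fin 3 → GaloisField 2 2)) = 21 := by
    rw [Projectivization.card_of_finrank _ _ (Module.finrank_fin_fun _), natCard_galoisField_four]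
    decide
  fin_cases t
  · exact h1
  · exact h2

theorem IsSemiregularTree.nonempty_marking {V : Type*} {T : SimpleGraph V} {ty : V → Fin 2}
    (hT : IsSemiregularTree T ty ![31, 21]) :
    Nonempty (∀ t v, ty v = t → ((quinticGluing.X t).Ω ≃ T.neighborSet v)) := by
  have h : ∀ t v, ty v = t → Nonempty ((quinticGluing.X t).Ω ≃ T.neighborSet v) := by
    rintro _ v rfl
    obtain ⟨h1, h2⟩ := hT.degree v
    have h3 := natCard_plane (ty v)
    have h4 : 0 < (![31, 21] : Fin 2 → ℕ) (ty v) := by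
      generalize ty v = t
      revert t
      decide
    have h5 : Finite (quinticGluing.X (ty v)).Ω := Nat.finite_of_card_ne_zero (by omega)
    have := h1.to_subtype
    exact Finite.card_eq.1 (h3.trans (h2.symm.trans (Nat.card_coe_set_eq _).symm))
  exact ⟨fun t v hv => (h t v hv).some⟩

end BoundaryTree

open BoundaryTree

theorem mainTheorem9 :
    ∃ (V : Type) (T : SimpleGraph V) (ty : V → Fin 2) (G : Subgroup (T ≃g T)),
      -- `T` is the (31,21)-semiregular tree, and `G` is a closed boundary-2-transitive group
      -- with the local actions `PΓL₃(5)` and `PΓL₃(4)`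
      IsSemiregularTree T ty ![31, 21] ∧
      IsInClassH ty G (PGammaL3 (ZMod 5)) (PGammaL3 (GaloisField 2 2)) ∧
      -- `G` is locally prosoluble; stabilizers of paths of length 2 are prosoluble
      IsLocallyProsoluble G ∧
      (∀ x y z, T.Adj x y → T.Adj y z → x ≠ z → IsProsoluble (fixer G {x, y, z})) ∧
      -- the point stabilizers of the local actions are insoluble; arc stabilizers are not
      -- prosoluble
      (∀ x y, ∀ h : T.Adj y x, ¬ Group.IsSolvable (localPointStab G h)) ∧
      (∀ x y, T.Adj x y → ¬ IsProsoluble (fixer G {x, y})) ∧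
      -- `Λ_t` is soluble, of the form `W_t ⋊ A` with `W_t` the socle of `F_t(ω)`, where
      -- `A = SL₂(3) ⋊ C₄` or `A = SL₂(3) ⋊ C₂` if `t = 0`, and `A = ΓL₁(16)` if `t = 1`
      (∀ ρ : Ray T, Group.IsSolvable (Lambda G ρ) ∧
        ∃ A : Subgroup (Equiv.Perm (T.neighborSet (ρ.vert 0))),
          IsInternalSemidirect (Lambda G ρ)
            ((socle (localPointStab G (ρ.adj 0))).map (localPointStab G (ρ.adj 0)).subtype) A ∧
          (ty (ρ.vert 0) = 0 → IsSL23ByCyclic A 4 ∨ IsSL23ByCyclic A 2) ∧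
          (ty (ρ.vert 0) = 1 → Nonempty (A ≃* GammaL1 (GaloisField 2 4)))) ∧
      -- `Θ_t` is the soluble radical of `F_t(ω)`
      (∀ x y, ∀ h : T.Adj y x,
        Theta G x y = (solubleRadical (localPointStab G h)).map (localPointStab G h).subtype) := by
  obtain ⟨V, T, ty, v, hsemi⟩ : ∃ (V : Type) (T : SimpleGraph V) (ty : V → Fin 2) (_ : V),
      IsSemiregularTree T ty ![31, 21] :=
    ⟨_, _, _, ⟨[], trivial⟩, isSemiregularTree_addressTree ![31, 21] (by decide)⟩
  obtain ⟨κ⟩ := hsemi.nonempty_marking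
  have hT := hsemi.isTree
  have hty := hsemi.type_ne
  have hfin : ∀ v, (T.neighborSet v).Finite := fun v => (hsemi.degree v).1
  have hpro : ∀ x y z, T.Adj x y → T.Adj y z → x ≠ z →
      IsProsoluble (fixer (quinticGluing.group κ hty) {x, y, z}) := fun x y z =>
    quinticGluing.isProsoluble_fixer κ hty hT hfin
  have hins : ∀ x y, ∀ h : T.Adj y x,
      ¬ Group.IsSolvable (localPointStab (quinticGluing.group κ hty) h) := fun x y h =>
    quinticGluing.not_isSolvable_localPointStab κ hty hT h
  refine ⟨V, T, ty, quinticGluing.group κ hty, hsemi,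
    ⟨(markingSystem κ hty).isClosed_univGroup hfin, quinticGluing.isBoundary2Transitive κ hty hT,
      fun v hv => quinticGluing.permIso_localAction κ hty hT hv,
      fun v hv => quinticGluing.permIso_localAction κ hty hT hv⟩, ?_, hpro, hins,
    fun x y h => not_isProsoluble_fixer h.symm (hfin y) (hins x y h.symm), fun ρ => ?_,
    fun x y h => ?_⟩
  · have h1 : 1 < (T.neighborSet v).ncard := by
      rw [(hsemi.degree v).2]
      generalize ty v = t
      revert t
      decide
    obtain ⟨x, hx, z, hz, hxz⟩ := (Set.one_lt_ncard (hfin v)).1 h1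
    exact isLocallyProsoluble_of_fixer (by simp) (hpro x v z hx.symm hz hxz)
  · refine ⟨quinticGluing.isSolvable_Lambda κ hty hT ρ, ?_⟩
    obtain ⟨x, A, hA, ⟨e⟩⟩ := quinticGluing.exists_complement κ hty hT ρ
    have hne := hty _ _ (ρ.adj 0)
    -- The cyclic factor always has order 4 here, since every unit modulo 5 is a determinant on the
    -- stabilizer.
    refine ⟨A, hA, fun h => Or.inl ?_, fun h => ?_⟩
    · have h1 : ty (ρ.vert 1) = 1 := by
        rw [h] at hne
        exact Fin.eq_one_of_ne_zero _ hne.symm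
      rw [h, h1] at e
      exact isSL23ByCyclic_of_mulEquiv e (isSL23ByCyclic_comap x)
    · have h1 : ty (ρ.vert 1) = 0 := by
        by_contra h0
        exact hne (h.trans (Fin.eq_one_of_ne_zero _ h0).symm)
      rw [h, h1] at e
      exact (nonempty_comap_equiv x).map e.trans
  · rw [quinticGluing.theta_eq κ hty hT h, quinticGluing.map_solubleRadical κ hty hT h]
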